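/- Let $d\ge 1$ and $\bar\lambda\in(-\infty,+\infty]$. For $V\in L^1_{\rm loc}(\mathbb R^d)$ real-valued and bounded from below, let $$\lambda_i(V)=\inf_{\dim S=i}\ \sup_{\psi\in S,\ \|\psi\|_{2}=1}\int_{\mathbb R^d}\big(|\nabla\psi|^2+V|\psi|^2\big)\,dx\qquad(i\ge1)$$ be the min-max values of $-\Delta+V$ ($S$ a subspace of $L^2(\mathbb R^d;\mathbb C)$; the energy is $+\infty$ outside the form domain). These are the eigenvalues below the essential spectrum, counted with multiplicity, continued by the bottom of the essential spectrum if there are only finitely many. Call $V$ admissible if moreover $\lim_{i\to\infty}\lambda_i(V)=\bar\lambda$, so that the spectrum of $-\Delta+V$ in $(-\infty,\bar\lambda)$ consists of the $\lambda_i(V)<\bar\lambda$. Let $F,G:\mathbb R\to[0,+\infty]$ be such that, for $\Phi=F$ and for $\Phi=G$, $\Phi$ is convex on $(-\infty,\bar\lambda)$, is $C^1$ with injective derivative in the interior of $\{s<\bar\lambda:\Phi(s)<\infty\}$, and $\Phi(s)\to0$ as $s\to\bar\lambda^-$. Write $(\Phi')^{-1}$ for the inverse of $\Phi'$ on this interior.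 Suppose that $$\sum_{i\ge1}F(\lambda_i(V))\le\int_{\mathbb R^d}G(V(x))\,dx\qquad\text{for every admissible }V.$$ Define $$\beta(s)=-\int_0^s(-F')^{-1}(t)\,dt,\qquad H(s)=\int_s^0(G')^{-1}(-t)\,dt$$ for those $s\ge0$ for which $(0,s)$ is contained in the range of $-F'$ (respectively $-G'$) and the integral converges. Let $(\nu_i)_{i\ge1}$ be nonnegative numbers, $(\psi_i)_{i\ge1}$ an orthonormal sequence in $L^2(\mathbb R^d;\mathbb C)$, and $\rho=\sum_i\nu_i|\psi_i|^2$. Assume that every $\beta(\nu_i)$ is defined and that, for almost every $x$, $\rho(x)$ is finite and $H(\rho(x))$ is defined. Then $$\sum_{i}\nu_i\int_{\mathbb R^d}|\nabla\psi_i|^2\,dx+\sum_{i}\beta(\nu_i)\ \ge\ \int_{\mathbb R^d}H(\rho)\,dx,$$ where $\int|\nabla\psi_i|^2=+\infty$ if $\psi_i\notin H^1(\mathbb R^d)$, in the following sense: with $a_\pm=\max(\pm a,0)$, one has in $[0,+\infty]$ $$\int H(\rho)_+\,dx+\sum_i\beta(\nu_i)_-\ \le\ \sum_i\nu_i\int|\nabla\psi_i|^2\,dx+\sum_i\beta(\nu_i)_++\int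 H(\rho)_-\,dx;$$ in particular, the displayed inequality holds between real numbers whenever $\sum_i\nu_i\int|\nabla\psi_i|^2<\infty$, $\sum_i\beta(\nu_i)$ converges absolutely and $H(\rho)$ is integrable. -/

import Mathlib

open MeasureTheory Set Filter Topology
open scoped ENNReal ContDiff

/-- The Euclidean space `ℝ^d`. -/
abbrev Rd (d : ℕ) : Type := EuclideanSpace ℝ (Fin d)

/-- The complex Hilbert space `L²(ℝ^d)`. -/
abbrev L2Rd (d : ℕ) : Type := Lp ℂ 2 (volume : Measure (Rd d))

/-- `g = ∇ψ` in the sense of distributions: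
`∫ ψ ∂ⱼφ = - ∫ φ gⱼ` for every real test function `φ` and every coordinate `j`. -/
def IsWeakGradient {d : ℕ} (ψ : Rd d → ℂ) (g : Rd d → EuclideanSpace ℂ (Fin d)) : Prop :=
  ∀ φ : Rd d → ℝ, ContDiff ℝ ∞ φ → HasCompactSupport φ → ∀ j : Fin d,
    ∫ x, (fderiv ℝ φ x (EuclideanSpace.single j 1)) • ψ x = - ∫ x, φ x • g x j

/-- The Dirichlet integral `∫ |∇ψ|² ∈ [0,∞]`. The weak gradient is unique almost everywhere, so the
infimum is over at most one class of functions; it is `∞` if `ψ` has no weak gradient in `L²`,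
that is, if `ψ ∉ H¹(ℝ^d)`. -/
noncomputable def gradEnergy {d : ℕ} (ψ : L2Rd d) : ℝ≥0∞ :=
  ⨅ (g : Rd d → EuclideanSpace ℂ (Fin d)) (_ : MemLp g 2 volume) (_ : IsWeakGradient ψ g),
    ∫⁻ x, ‖g x‖ₑ ^ 2

/-- The quadratic form `E[ψ] = ∫ (|∇ψ|² + V |ψ|²)` of `-Δ + V`. For `V` bounded from below
(the only case in which it is used) the subtracted integral is finite, and the value is `+∞`
exactly outside the form domain. -/
noncomputable def schrodingerEnergy {d : ℕ} (V : Rd d → ℝ) (ψ : L2Rd d) : EReal :=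
  (gradEnergy ψ : EReal) + ((∫⁻ x, ENNReal.ofReal (V x) * ‖ψ x‖ₑ ^ 2 : ℝ≥0∞) : EReal)
    - ((∫⁻ x, ENNReal.ofReal (- V x) * ‖ψ x‖ₑ ^ 2 : ℝ≥0∞) : EReal)

/-- The min-max values of `-Δ + V`, numbered from `0` (so `schrodingerEigenvalue V i` is
`λ_{i+1}(V)`): the infimum over the `(i+1)`-dimensional subspaces `S` of `L²(ℝ^d)` of the supremum
of `E[ψ]` over the unit vectors of `S`. These are the eigenvalues below the bottom of the essential
spectrum, in nondecreasing order and with multiplicity; if there are only finitely many, the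
sequence is continued by the bottom of the essential spectrum. -/
noncomputable def schrodingerEigenvalue {d : ℕ} (V : Rd d → ℝ) (i : ℕ) : EReal :=
  ⨅ (S : Submodule ℂ (L2Rd d)) (_ : Module.finrank ℂ S = i + 1),
    ⨆ (ψ : L2Rd d) (_ : ψ ∈ S) (_ : ‖ψ‖ = 1), schrodingerEnergy V ψ

/-- Potentials `V ∈ L¹_loc(ℝ^d)`, bounded from below, for which `λ_i(V) → b`. By the min-max
principle the last condition says that `b ∈ (-∞, +∞]` is the bottom of the essential spectrum, i.e.
that the spectrum of `-Δ + V` in `(-∞, b)` consists exactly of the eigenvalues `λ_i(V) < b`. -/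
structure AdmissiblePotential {d : ℕ} (b : EReal) (V : Rd d → ℝ) : Prop where
  locallyIntegrable : LocallyIntegrable V volume
  bounded_below : ∃ c : ℝ, ∀ᵐ x, c ≤ V x
  tendsto : Tendsto (schrodingerEigenvalue V) atTop (𝓝 b)

/-- The effective domain `{s < b : Φ(s) < ∞}` of `Φ : (-∞, b) → [0,∞]`. -/
def finiteDomain (b : EReal) (Φ : ℝ → ℝ≥0∞) : Set ℝ := {s | (s : EReal) < b ∧ Φ s ≠ ⊤}

/-- The derivative `Φ'` on the interior of the effective domain. -/
noncomputable def profileDeriv (Φ : ℝ → ℝ≥0∞) : ℝ → ℝ := deriv fun s => (Φ s).toReal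

/-- The assumptions on the functions `F` and `G`: on `(-∞, b)` the function `Φ` is convex with
values in `[0,∞]`, it is `C¹` with invertible derivative where it is finite, and it vanishes at `b`,
so that `Φ(s) = - ∫_s^b Φ'`. -/
structure ConvexProfile (b : EReal) (Φ : ℝ → ℝ≥0∞) : Prop where
  convexOn : ConvexOn ℝ (finiteDomain b Φ) fun s => (Φ s).toReal
  contDiffOn : ContDiffOn ℝ 1 (fun s => (Φ s).toReal) (interior (finiteDomain b Φ))
  deriv_injOn : InjOn (profileDeriv Φ) (interior (finiteDomain b Φ))
  tendsto_zero : Tendsto Φ (comap Real.toEReal (𝓝[<] b)) (𝓝 0)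

/-- The inverse function `(Φ')⁻¹` (a junk value outside the range of `Φ'`). -/
noncomputable def profileDerivInv (b : EReal) (Φ : ℝ → ℝ≥0∞) : ℝ → ℝ :=
  Function.invFunOn (profileDeriv Φ) (interior (finiteDomain b Φ))

/-- The numbers `s ≥ 0` for which `∫_0^s (Φ')⁻¹(-t) dt` makes sense: `-t` is in the range of `Φ'`
for `0 < t < s`, and the integral converges. -/
def transformDomain (b : EReal) (Φ : ℝ → ℝ≥0∞) : Set ℝ :=
  {s | 0 ≤ s ∧ (∀ t ∈ Ioo 0 s, -t ∈ profileDeriv Φ '' interior (finiteDomain b Φ)) ∧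
    IntervalIntegrable (fun t => profileDerivInv b Φ (-t)) volume 0 s}

/-- `β(s) = - ∫_0^s (-F')⁻¹(t) dt`, where `(-F')⁻¹(t) = (F')⁻¹(-t)`. -/
noncomputable def betaFun (b : EReal) (F : ℝ → ℝ≥0∞) (s : ℝ) : ℝ :=
  - ∫ t in (0 : ℝ)..s, profileDerivInv b F (-t)

/-- `H(s) = ∫_s^0 (G')⁻¹(-t) dt`. -/
noncomputable def HFun (b : EReal) (G : ℝ → ℝ≥0∞) (s : ℝ) : ℝ :=
  ∫ t in s..(0 : ℝ), profileDerivInv b G (-t)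

/-- The kinetic energy `K[ν,ψ] = ∑ ν_i ∫ |∇ψ_i|² ∈ [0,∞]`. -/
noncomputable def kineticEnergy {d : ℕ} (ν : ℕ → ℝ) (ψ : ℕ → L2Rd d) : ℝ≥0∞ :=
  ∑' i, ENNReal.ofReal (ν i) * gradEnergy (ψ i)

/-- The density `ρ = ∑ ν_i |ψ_i|²`, with values in `[0,∞]`. -/
noncomputable def density {d : ℕ} (ν : ℕ → ℝ) (ψ : ℕ → L2Rd d) (x : Rd d) : ℝ≥0∞ :=
  ∑' i, ENNReal.ofReal (ν i) * ‖ψ i x‖ₑ ^ 2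

/-! The function `β` is a Legendre transform: `β(r) ≥ -F(s) - r s` wherever `F(s)` is finite, with
equality at `s = (F')⁻¹(-r)` for `r` below some point of the domain (`ConvexProfile.le_betaFun`,
`ConvexProfile.betaFun_eq`). `H` is the same transform of `G`, so everything is phrased with
`betaFun`.

Let `ψ_1, …, ψ_n` be orthonormal with finite Dirichlet integrals, and let `V` be admissible with
each `V|ψ_i|²` integrable and all `λ_k ≤ b`. Diagonalizing the form of `-Δ + V` on their span gives
`E[ψ_i] = ∑_k p_ik μ_k` with `p` doubly stochastic and `μ_k ≥ λ_k(V)`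
(`exists_doublyStochastic_energy`). Hence `∑ ν_i E[ψ_i] + ∑ β(ν_i) = ∑ p_ik (ν_i μ_k + β(ν_i)) ≥ -∑
F(λ_k) ≥ -∫ G(V)`. As `∑ ν_i ∫ V|ψ_i|² = ∫ V ρ`, kinetic energy plus `∑ β(ν_i)` is at least `-∫
(G(V) + V ρ)`, and the pointwise best choice `V = (G')⁻¹(-ρ)` turns the integrand into `H(ρ)`.

This `V` may be unbounded below, is not given where `ρ = 0`, and need not satisfy `λ_i(V) → b`. It
is therefore clamped between a constant `s_k` and a confining potential `τ_k → b` with `∫ G(τ_k)`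
small, and `k → ∞` (`finite_family_inequality`). Clamped potentials are admissible because their
sublevel sets below `b` have finite measure, so that only finitely many min-max values lie below any
number less than `b` (`eventually_le_schrodingerEigenvalue`): an orthonormal family with bounded
Dirichlet integrals cannot crowd into a set of finite measure. The quantitative form is
`density_le_add_oscillation`, which combines Bessel's inequality for local averages with the
translation estimate `translate_sq_le`.

For a sequence, the finite result is applied to `θ_n ν_i`, `i < n`, with `θ_n ↑ 1`. Fatou handles
`H₊`. Dominated convergence for `H₋` needs a majorant (`ConvexProfile.exists_neg_part_bound`) which
may contain a constant on `{ρ > c}`. In that case `G` is finite at a negative number, and testing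
the hypothesis on a potential well shows the same for `F`. Then `β` grows at least linearly, the
`ν_i` are bounded, and `{ρ > c}` has finite measure by the density estimate. -/

/-! ### Convex profiles and their Legendre transforms -/

section Profile

variable {b : EReal} {Φ : ℝ → ℝ≥0∞}

/-- The filter of real numbers tending to `b` from below. -/
noncomputable abbrev belowFilter (b : EReal) : Filter ℝ := comap Real.toEReal (𝓝[<] b)

lemma eventually_belowFilter_iff (hb : b ≠ ⊥) {p : ℝ → Prop} :
    (∀ᶠ s in belowFilter b, p s) ↔ ∃ l : EReal, l < b ∧ ∀ s : ℝ, l < s → (s : EReal) < b → p s := by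
  constructor
  · intro h
    obtain ⟨U, hU, hUp⟩ := mem_comap.1 h
    obtain ⟨l, hl, hlU⟩ := (mem_nhdsLT_iff_exists_Ioo_subset' (bot_lt_iff_ne_bot.2 hb)).1 hU
    exact ⟨l, hl, fun s h1 h2 => hUp (hlU ⟨h1, h2⟩)⟩
  · rintro ⟨l, hl, h⟩
    refine mem_comap.2 ⟨Ioo l b, Ioo_mem_nhdsLT hl, fun s hs => h s hs.1 hs.2⟩

lemma belowFilter_neBot (hb : b ≠ ⊥) : (belowFilter b).NeBot := by
  rw [← frequently_true_iff_neBot]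
  intro h
  obtain ⟨l, hl, h⟩ := (eventually_belowFilter_iff hb).1 h
  obtain ⟨s, h1, h2⟩ := EReal.lt_iff_exists_real_btwn.1 hl
  exact h s h1 h2 trivial

lemma eventually_gt_belowFilter (hb : b ≠ ⊥) {M : EReal} (hM : M < b) :
    ∀ᶠ s : ℝ in belowFilter b, M < (s : EReal) :=
  (eventually_belowFilter_iff hb).2 ⟨M, hM, fun _ h _ => h⟩

lemma ConvexProfile.eventually_mem (hΦ : ConvexProfile b Φ) (hb : b ≠ ⊥) :
    ∀ᶠ s in belowFilter b, s ∈ interior (finiteDomain b Φ) := by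
  obtain ⟨l, hl, h⟩ := (eventually_belowFilter_iff hb).1
    (hΦ.tendsto_zero.eventually_lt_const (zero_lt_one' ℝ≥0∞))
  refine (eventually_belowFilter_iff hb).2 ⟨l, hl, fun s h1 h2 => ?_⟩
  have ho : IsOpen (Real.toEReal ⁻¹' Ioo l b) := isOpen_Ioo.preimage continuous_coe_real_ereal
  refine mem_interior.2 ⟨_, fun t ht => ⟨ht.2, ((h t ht.1 ht.2).trans_le le_top).ne⟩, ho, h1, h2⟩

lemma finiteDomain_lt {s : ℝ} (hs : s ∈ interior (finiteDomain b Φ)) : (s : EReal) < b :=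
  (interior_subset hs).1

lemma finiteDomain_ofReal {s : ℝ} (hs : s ∈ interior (finiteDomain b Φ)) :
    ENNReal.ofReal (Φ s).toReal = Φ s := ENNReal.ofReal_toReal (interior_subset hs).2

lemma ConvexProfile.tendsto_toReal (hΦ : ConvexProfile b Φ) :
    Tendsto (fun s => (Φ s).toReal) (belowFilter b) (𝓝 0) := by
  have := (ENNReal.tendsto_toReal ENNReal.zero_ne_top).comp hΦ.tendsto_zero
  rwa [ENNReal.toReal_zero] at this

lemma ConvexProfile.hasDerivAt (hΦ : ConvexProfile b Φ) {u : ℝ}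
    (hu : u ∈ interior (finiteDomain b Φ)) :
    HasDerivAt (fun s => (Φ s).toReal) (profileDeriv Φ u) u :=
  ((hΦ.contDiffOn.differentiableOn (by simp)).differentiableAt
    (isOpen_interior.mem_nhds hu)).hasDerivAt

lemma ConvexProfile.continuousOn_deriv (hΦ : ConvexProfile b Φ) :
    ContinuousOn (profileDeriv Φ) (interior (finiteDomain b Φ)) :=
  hΦ.contDiffOn.continuousOn_deriv_of_isOpen isOpen_interior (by simp)

lemma ConvexProfile.subgradient (hΦ : ConvexProfile b Φ) {u s : ℝ}
    (hu : u ∈ interior (finiteDomain b Φ)) (hs : s ∈ finiteDomain b Φ) :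
    (Φ u).toReal + profileDeriv Φ u * (s - u) ≤ (Φ s).toReal := by
  rcases lt_trichotomy u s with h | h | h
  · have := hΦ.convexOn.le_slope_of_hasDerivAt (interior_subset hu) hs h (hΦ.hasDerivAt hu)
    rw [slope_def_field, le_div_iff₀ (by linarith)] at this
    linarith
  · subst h; simp
  · have := hΦ.convexOn.slope_le_of_hasDerivAt hs (interior_subset hu) h (hΦ.hasDerivAt hu)
    rw [slope_def_field, div_le_iff₀ (by linarith)] at this
    linarith

lemma ConvexProfile.monotoneOn_deriv (hΦ : ConvexProfile b Φ) :
    MonotoneOn (profileDeriv Φ) (interior (finiteDomain b Φ)) := by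
  intro u hu v hv huv
  rcases huv.eq_or_lt with h | h
  · rw [h]
  have h1 := hΦ.subgradient hu (interior_subset hv)
  have h2 := hΦ.subgradient hv (interior_subset hu)
  nlinarith

/-- A nonnegative slope at `u` persists to the right of `u`; as `Φ ≥ 0` tends to `0` at `b`, it
would vanish there, so `Φ'` would be constant, against injectivity. -/
lemma ConvexProfile.deriv_neg (hΦ : ConvexProfile b Φ) (hb : b ≠ ⊥) {u : ℝ}
    (hu : u ∈ interior (finiteDomain b Φ)) : profileDeriv Φ u < 0 := by
  by_contra! h
  have := belowFilter_neBot hb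
  have key : ∀ v ∈ interior (finiteDomain b Φ), u ≤ v → (Φ v).toReal = 0 := by
    intro v hv huv
    refine le_antisymm (ge_of_tendsto hΦ.tendsto_toReal ?_) ENNReal.toReal_nonneg
    filter_upwards [hΦ.eventually_mem hb, eventually_gt_belowFilter hb (finiteDomain_lt hv)]
      with s hs hvs
    have h1 := hΦ.subgradient hv (interior_subset hs)
    have h2 : 0 ≤ profileDeriv Φ v := h.trans (hΦ.monotoneOn_deriv hu hv huv)
    have h3 : v < s := by exact_mod_cast hvs
    nlinarith
  have key' : ∀ v ∈ interior (finiteDomain b Φ), u < v → profileDeriv Φ v = 0 := by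
    intro v hv huv
    have h0 : (fun s => (Φ s).toReal) =ᶠ[𝓝 v] fun _ => 0 := by
      filter_upwards [isOpen_interior.mem_nhds hv, lt_mem_nhds huv] with s hs hus
      exact key s hs hus.le
    unfold profileDeriv
    rw [h0.deriv_eq]
    simp
  obtain ⟨v, hv, huv⟩ := ((hΦ.eventually_mem hb).and
    (eventually_gt_belowFilter hb (finiteDomain_lt hu))).exists
  obtain ⟨w, hw, hvw⟩ := ((hΦ.eventually_mem hb).and
    (eventually_gt_belowFilter hb (finiteDomain_lt hv))).exists
  have huv' : u < v := by exact_mod_cast huv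
  have hvw' : v < w := by exact_mod_cast hvw
  have := hΦ.deriv_injOn hv hw (by rw [key' v hv huv', key' w hw (huv'.trans hvw')])
  exact hvw'.ne this

lemma betaFun_eq_HFun (b : EReal) (Φ : ℝ → ℝ≥0∞) : HFun b Φ = betaFun b Φ := by
  funext s
  rw [HFun, betaFun, intervalIntegral.integral_symm]

/-- The open interval of the `t > 0` below some element of the domain of the transform. -/
def openTransformDomain (b : EReal) (Φ : ℝ → ℝ≥0∞) : Set ℝ :=
  {t | 0 < t ∧ ∃ r ∈ transformDomain b Φ, t < r}

lemma isOpen_openTransformDomain : IsOpen (openTransformDomain b Φ) := by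
  have : openTransformDomain b Φ = ⋃ r ∈ transformDomain b Φ, Ioo 0 r := by
    ext t; simp [openTransformDomain]
  rw [this]
  exact isOpen_biUnion fun _ _ => isOpen_Ioo

/-- The point `(Φ')⁻¹(-t)`, at which `s ↦ Φ(s) + t s` is minimal. -/
noncomputable def legendrePoint (b : EReal) (Φ : ℝ → ℝ≥0∞) (t : ℝ) : ℝ := profileDerivInv b Φ (-t)

lemma legendrePoint_spec {t : ℝ} (ht : t ∈ openTransformDomain b Φ) :
    legendrePoint b Φ t ∈ interior (finiteDomain b Φ) ∧
      profileDeriv Φ (legendrePoint b Φ t) = -t := by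
  obtain ⟨h0, r, hr, htr⟩ := ht
  have h := hr.2.1 t ⟨h0, htr⟩
  exact ⟨Function.invFunOn_mem h, Function.invFunOn_eq h⟩

lemma legendrePoint_mem {t : ℝ} (ht : t ∈ openTransformDomain b Φ) :
    legendrePoint b Φ t ∈ interior (finiteDomain b Φ) := (legendrePoint_spec ht).1

lemma ConvexProfile.legendrePoint_min (hΦ : ConvexProfile b Φ) {t s : ℝ}
    (ht : t ∈ openTransformDomain b Φ) (hs : s ∈ finiteDomain b Φ) :
    (Φ (legendrePoint b Φ t)).toReal + t * legendrePoint b Φ t ≤ (Φ s).toReal + t * s := by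
  obtain ⟨h1, h2⟩ := legendrePoint_spec ht
  have := hΦ.subgradient h1 hs
  rw [h2] at this
  linarith

lemma ConvexProfile.legendrePoint_antitone (hΦ : ConvexProfile b Φ) :
    AntitoneOn (legendrePoint b Φ) (openTransformDomain b Φ) := by
  intro t ht t' ht' htt
  rcases htt.eq_or_lt with h | h
  · rw [h]
  have h1 := hΦ.legendrePoint_min ht (interior_subset (legendrePoint_mem ht'))
  have h2 := hΦ.legendrePoint_min ht' (interior_subset (legendrePoint_mem ht))
  nlinarith

lemma ConvexProfile.legendrePoint_eq (hΦ : ConvexProfile b Φ) {u : ℝ}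
    (hu : u ∈ interior (finiteDomain b Φ)) (ht : -profileDeriv Φ u ∈ openTransformDomain b Φ) :
    legendrePoint b Φ (-profileDeriv Φ u) = u := by
  obtain ⟨h1, h2⟩ := legendrePoint_spec ht
  exact hΦ.deriv_injOn h1 hu (by rw [h2, neg_neg])

lemma ConvexProfile.continuousOn_legendrePoint (hΦ : ConvexProfile b Φ) :
    ContinuousOn (legendrePoint b Φ) (openTransformDomain b Φ) := by
  intro t ht
  have hnhds := isOpen_openTransformDomain.mem_nhds ht
  refine ContinuousAt.continuousWithinAt ?_
  have hm : MonotoneOn (fun t => -legendrePoint b Φ t) (openTransformDomain b Φ) :=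
    fun x hx y hy hxy => neg_le_neg (hΦ.legendrePoint_antitone hx hy hxy)
  have : ContinuousAt (fun t => -legendrePoint b Φ t) t := by
    -- A monotone function is continuous where its image is a neighbourhood of the value. Every `u`
    -- near the value is attained, namely at `-Φ'(u)`, by continuity of `Φ'`.
    refine continuousAt_of_monotoneOn_of_image_mem_nhds hm hnhds ?_
    obtain ⟨h1, h2⟩ := legendrePoint_spec ht
    have hc : ContinuousAt (fun u => -profileDeriv Φ u) (legendrePoint b Φ t) :=
      (hΦ.continuousOn_deriv.continuousAt (isOpen_interior.mem_nhds h1)).neg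
    have hn : ∀ᶠ u in 𝓝 (legendrePoint b Φ t), u ∈ interior (finiteDomain b Φ) ∧
        -profileDeriv Φ u ∈ openTransformDomain b Φ :=
      Filter.Eventually.and (isOpen_interior.mem_nhds h1) (hc (by simp only [h2, neg_neg]; exact hnhds))
    have hn' := (continuous_neg.tendsto (-legendrePoint b Φ t)).eventually
      (by rw [neg_neg]; exact hn)
    filter_upwards [hn'] with v hv
    exact ⟨_, hv.2, by simp only; rw [hΦ.legendrePoint_eq hv.1 hv.2, neg_neg]⟩
  exact this.neg.congr (Eventually.of_forall fun x => neg_neg _)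

lemma betaFun_zero : betaFun b Φ 0 = 0 := by simp [betaFun]

lemma zero_mem_transformDomain : (0 : ℝ) ∈ transformDomain b Φ :=
  ⟨le_rfl, fun t ht => absurd (ht.1.trans ht.2) (lt_irrefl _), by simp⟩

lemma transformDomain_of_le {r r' : ℝ} (hr : r ∈ transformDomain b Φ) (h0 : 0 ≤ r') (h : r' ≤ r) :
    r' ∈ transformDomain b Φ :=
  ⟨h0, fun t ht => hr.2.1 t ⟨ht.1, ht.2.trans_le h⟩,
    hr.2.2.mono_set (by rw [uIcc_of_le h0, uIcc_of_le (h0.trans h)]; exact Icc_subset_Icc_right h)⟩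

lemma mem_openTransformDomain {t r : ℝ} (hr : r ∈ transformDomain b Φ) (h0 : 0 < t) (h : t < r) :
    t ∈ openTransformDomain b Φ := ⟨h0, r, hr, h⟩

lemma openTransformDomain_subset : openTransformDomain b Φ ⊆ transformDomain b Φ :=
  fun _ ⟨h0, _, hr, h⟩ => transformDomain_of_le hr h0.le h.le

lemma continuousOn_betaFun {r : ℝ} (hr : r ∈ transformDomain b Φ) :
    ContinuousOn (betaFun b Φ) (Icc 0 r) := by
  have h := (intervalIntegrable_iff_integrableOn_Icc_of_le hr.1).1 hr.2.2
  have := intervalIntegral.continuousOn_primitive_interval (μ := volume)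
    (by rw [uIcc_of_le hr.1]; exact h)
  rw [uIcc_of_le hr.1] at this
  exact this.neg

lemma betaFun_sub {r r' : ℝ} (hr : r ∈ transformDomain b Φ) (h0 : 0 ≤ r') (h : r' ≤ r) :
    betaFun b Φ r' - betaFun b Φ r = ∫ t in r'..r, legendrePoint b Φ t := by
  have h1 := (transformDomain_of_le hr h0 h).2.2
  have := intervalIntegral.integral_interval_sub_left hr.2.2 h1
  rw [betaFun, betaFun]
  simp only [legendrePoint]
  linarith

/-- Exchanging the two points gives `(x - t) h(x) ≤ m(x) - m(t) ≤ (x - t) h(t)`. This yields the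
envelope formula for the Legendre transform without second derivatives of `Φ`. -/
lemma hasDerivAt_of_forall_le_add_mul {m h : ℝ → ℝ} {U : Set ℝ} (hU : IsOpen U)
    (hm : ∀ t ∈ U, ∀ t' ∈ U, m t' ≤ m t + (t' - t) * h t) (hc : ContinuousOn h U) {t : ℝ}
    (ht : t ∈ U) : HasDerivAt m (h t) t := by
  rw [hasDerivAt_iff_isLittleO, Asymptotics.isLittleO_iff]
  intro c hcpos
  have h1 : ∀ᶠ x in 𝓝 t, |h x - h t| < c := by
    have := (hc.continuousAt (hU.mem_nhds ht)).eventually (Metric.ball_mem_nhds _ hcpos)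
    simpa [Real.dist_eq] using this
  filter_upwards [h1, hU.mem_nhds ht] with x hx hxU
  have h2 := hm t ht x hxU
  have h3 := hm x hxU t ht
  have h4 : |(x - t) * (h x - h t)| ≤ c * |x - t| := by
    rw [abs_mul, mul_comm]; gcongr
  rw [Real.norm_eq_abs, Real.norm_eq_abs, smul_eq_mul]
  rw [abs_le] at h4 ⊢
  constructor <;> nlinarith

/-- The minimum `m(t)` of `Φ(s) + t s` has derivative equal to the minimizer, which is also the
derivative of `-β`. Both `m` and `β` tend to `0` at `0+`, so `β = -m`. -/
lemma ConvexProfile.betaFun_eq (hΦ : ConvexProfile b Φ) (hb : b ≠ ⊥) {t : ℝ}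
    (ht : t ∈ openTransformDomain b Φ) :
    betaFun b Φ t = -((Φ (legendrePoint b Φ t)).toReal + t * legendrePoint b Φ t) := by
  set m : ℝ → ℝ := fun t => (Φ (legendrePoint b Φ t)).toReal + t * legendrePoint b Φ t with hm
  have hmem : ∀ s ∈ Ioc 0 t, s ∈ openTransformDomain b Φ := fun s hs =>
    ⟨hs.1, by obtain ⟨_, r, hr, htr⟩ := ht; exact ⟨r, hr, hs.2.trans_lt htr⟩⟩
  have hsq : ∀ s ∈ openTransformDomain b Φ, ∀ s' ∈ openTransformDomain b Φ,
      m s' ≤ m s + (s' - s) * legendrePoint b Φ s := by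
    intro s hs s' hs'
    have := hΦ.legendrePoint_min hs' (interior_subset (legendrePoint_mem hs))
    simp only [hm]; linarith
  have hder : ∀ s ∈ openTransformDomain b Φ, HasDerivAt m (legendrePoint b Φ s) s := fun s hs =>
    hasDerivAt_of_forall_le_add_mul isOpen_openTransformDomain hsq hΦ.continuousOn_legendrePoint hs
  have htd := openTransformDomain_subset ht
  have hdiff : ∀ s ∈ Ioc 0 t, m t - m s = betaFun b Φ s - betaFun b Φ t := by
    intro s hs
    rw [betaFun_sub htd hs.1.le hs.2]
    symm
    refine intervalIntegral.integral_eq_sub_of_hasDerivAt (fun x hx => ?_) ?_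
    · rw [uIcc_of_le hs.2] at hx
      exact hder x (hmem x ⟨hs.1.trans_le hx.1, hx.2⟩)
    · exact htd.2.2.mono_set (by
        rw [uIcc_of_le hs.2, uIcc_of_le ht.1.le]; exact Icc_subset_Icc_left hs.1.le)
  have hev : ∀ᶠ s in 𝓝[>] (0 : ℝ), s ∈ Ioc 0 t := Ioc_mem_nhdsGT ht.1
  have hid : Tendsto (fun s : ℝ => s) (𝓝[>] 0) (𝓝 0) := tendsto_nhdsWithin_of_tendsto_nhds tendsto_id
  have hm0 : Tendsto m (𝓝[>] 0) (𝓝 0) := by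
    -- Lower bound for `m`: the minimizer decreases in `s`, so `m(s) ≥ s · legendrePoint s ≥ s ·
    -- legendrePoint t`. For the upper bound, `m(s) ≤ Φ(u) + s u` with a fixed `u` at which `Φ(u) <
    -- ε / 2`.
    have hlow : ∀ᶠ s in 𝓝[>] (0 : ℝ), s * legendrePoint b Φ t ≤ m s := by
      filter_upwards [hev] with s hs
      have := hΦ.legendrePoint_antitone (hmem s hs) ht hs.2
      have h0 : 0 ≤ (Φ (legendrePoint b Φ s)).toReal := ENNReal.toReal_nonneg
      simp only [hm]
      nlinarith [hs.1]
    rw [Metric.tendsto_nhds]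
    intro ε hε
    have := belowFilter_neBot hb
    obtain ⟨u, hu, hu2⟩ := ((hΦ.eventually_mem hb).and
      (hΦ.tendsto_toReal.eventually_lt_const (half_pos hε))).exists
    have e1 : ∀ᶠ s in 𝓝[>] (0 : ℝ), s * u < ε / 2 := by
      have : Tendsto (fun s : ℝ => s * u) (𝓝[>] 0) (𝓝 (0 * u)) := hid.mul_const u
      rw [zero_mul] at this
      exact this.eventually_lt_const (half_pos hε)
    have e2 : ∀ᶠ s in 𝓝[>] (0 : ℝ), -ε < s * legendrePoint b Φ t := by
      have : Tendsto (fun s : ℝ => s * legendrePoint b Φ t) (𝓝[>] 0) (𝓝 (0 * _)) := hid.mul_const _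
      rw [zero_mul] at this
      exact this.eventually_const_lt (by linarith)
    filter_upwards [hev, hlow, e1, e2] with s hs h1 h2 h3
    have := hΦ.legendrePoint_min (hmem s hs) (interior_subset hu)
    rw [Real.dist_eq, sub_zero, abs_lt]
    simp only [hm] at *
    constructor <;> linarith
  have hb0 : Tendsto (betaFun b Φ) (𝓝[>] 0) (𝓝 0) := by
    have h := (continuousOn_betaFun htd) 0 ⟨le_rfl, ht.1.le⟩
    rw [ContinuousWithinAt, betaFun_zero] at h
    refine h.mono_left ?_
    rw [← nhdsWithin_Ioc_eq_nhdsGT ht.1]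
    exact nhdsWithin_mono _ Ioc_subset_Icc_self
  have hlim : Tendsto (fun s => m t - m s) (𝓝[>] 0) (𝓝 (m t - 0)) := tendsto_const_nhds.sub hm0
  have hlim' : Tendsto (fun s => m t - m s) (𝓝[>] 0) (𝓝 (0 - betaFun b Φ t)) := by
    refine (hb0.sub tendsto_const_nhds).congr' ?_
    filter_upwards [hev] with s hs
    exact (hdiff s hs).symm
  have := tendsto_nhds_unique hlim hlim'
  simp only [hm] at this
  linarith

/-- Fenchel's inequality. At the right end point of the domain `-r` need not be a value of `Φ'`, so
the bound is taken as a limit from `t < r`. -/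
lemma ConvexProfile.le_betaFun (hΦ : ConvexProfile b Φ) (hb : b ≠ ⊥) {r s : ℝ}
    (hr : r ∈ transformDomain b Φ) (hs : s ∈ finiteDomain b Φ) :
    -(Φ s).toReal - r * s ≤ betaFun b Φ r := by
  rcases hr.1.eq_or_lt with h | h
  · rw [← h, betaFun_zero]
    have : 0 ≤ (Φ s).toReal := ENNReal.toReal_nonneg
    linarith
  have hev : ∀ᶠ t in 𝓝[<] r, t ∈ Ico 0 r ∧ 0 < t :=
    (show ∀ᶠ t in 𝓝[<] r, t ∈ Ico 0 r from Ico_mem_nhdsLT h).and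
      (mem_of_superset (Ioo_mem_nhdsLT h) fun t ht => ht.1)
  have hc : Tendsto (betaFun b Φ) (𝓝[<] r) (𝓝 (betaFun b Φ r)) := by
    refine (continuousOn_betaFun hr r ⟨h.le, le_rfl⟩).mono_left ?_
    rw [← nhdsWithin_Ico_eq_nhdsLT h]
    exact nhdsWithin_mono _ Ico_subset_Icc_self
  have hid : Tendsto (fun s : ℝ => s) (𝓝[<] r) (𝓝 r) := tendsto_nhdsWithin_of_tendsto_nhds tendsto_id
  refine le_of_tendsto_of_tendsto (tendsto_const_nhds.sub (hid.mul_const s)) hc ?_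
  filter_upwards [hev] with t ht
  have htd := mem_openTransformDomain hr ht.2 ht.1.2
  rw [hΦ.betaFun_eq hb htd]
  have := hΦ.legendrePoint_min htd hs
  linarith

/-- At the end point `b`, if it is finite, `-b r` is a lower bound of the transform. -/
lemma ConvexProfile.neg_mul_le_betaFun (hΦ : ConvexProfile b Φ) (hb : b ≠ ⊥) {r x : ℝ}
    (hr : r ∈ transformDomain b Φ) (hx : b ≤ x) : -(r * x) ≤ betaFun b Φ r := by
  have := belowFilter_neBot hb
  have hlim : Tendsto (fun s => -(Φ s).toReal - r * x) (belowFilter b) (𝓝 (-0 - r * x)) :=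
    hΦ.tendsto_toReal.neg.sub tendsto_const_nhds
  rw [neg_zero, zero_sub] at hlim
  refine le_of_tendsto hlim ?_
  filter_upwards [hΦ.eventually_mem hb] with s hs
  refine le_trans ?_ (hΦ.le_betaFun hb hr (interior_subset hs))
  have h1 : s ≤ x := by exact_mod_cast (finiteDomain_lt hs).le.trans hx
  nlinarith [hr.1]

/-- Convexity of the transform together with `β(0) = 0`: the minimizer for `θ r` is used as a
competitor for `r`, and `Φ ≥ 0`. -/
lemma ConvexProfile.betaFun_mul_le (hΦ : ConvexProfile b Φ) (hb : b ≠ ⊥) {r θ : ℝ}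
    (hr : r ∈ transformDomain b Φ) (h0 : 0 < θ) (h1 : θ < 1) :
    betaFun b Φ (θ * r) ≤ θ * betaFun b Φ r := by
  rcases hr.1.eq_or_lt with h | h
  · rw [← h]; simp [betaFun_zero]
  have htd := mem_openTransformDomain hr (mul_pos h0 h) (by nlinarith : θ * r < r)
  rw [hΦ.betaFun_eq hb htd]
  have := hΦ.le_betaFun hb hr (interior_subset (legendrePoint_mem htd))
  have h3 : 0 ≤ (Φ (legendrePoint b Φ (θ * r))).toReal := ENNReal.toReal_nonneg
  nlinarith

end Profile

/-! ### Weak gradients and the Dirichlet integral -/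

section WeakGradient

variable {d : ℕ}

lemma IsWeakGradient.congr {ψ : Rd d → ℂ} {g g' : Rd d → EuclideanSpace ℂ (Fin d)}
    (h : IsWeakGradient ψ g) (hg : g =ᵐ[volume] g') : IsWeakGradient ψ g' := by
  intro φ h1 h2 j
  rw [h φ h1 h2 j]
  congr 1
  refine integral_congr_ae ?_
  filter_upwards [hg] with x hx
  rw [hx]

lemma memLp_coord {g : Rd d → EuclideanSpace ℂ (Fin d)} (hg : MemLp g 2 volume) (j : Fin d) :
    MemLp (fun x => g x j) 2 volume := by
  refine hg.of_le ?_ (Eventually.of_forall fun x => PiLp.norm_apply_le (g x) j)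
  exact ((EuclideanSpace.proj j : EuclideanSpace ℂ (Fin d) →L[ℂ] ℂ).continuous).comp_aestronglyMeasurable
    hg.1

/-- The fundamental lemma of the calculus of variations, one coordinate at a time. It makes the
infimum in `gradEnergy` an infimum over one class. -/
lemma IsWeakGradient.ae_eq {ψ : Rd d → ℂ} {g g' : Rd d → EuclideanSpace ℂ (Fin d)}
    (h : IsWeakGradient ψ g) (h' : IsWeakGradient ψ g') (hg : MemLp g 2 volume)
    (hg' : MemLp g' 2 volume) : g =ᵐ[volume] g' := by
  have key : ∀ j, ∀ᵐ x, g x j = g' x j := by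
    intro j
    refine ae_eq_of_integral_contDiff_smul_eq ((memLp_coord hg j).locallyIntegrable (by norm_num))
      ((memLp_coord hg' j).locallyIntegrable (by norm_num)) fun φ h1 h2 => ?_
    have := (h φ h1 h2 j).symm.trans (h' φ h1 h2 j)
    exact neg_injective this
  filter_upwards [ae_all_iff.2 key] with x hx
  ext j
  exact hx j

lemma gradEnergy_eq {ψ : L2Rd d} {g : Rd d → EuclideanSpace ℂ (Fin d)} (hg : MemLp g 2 volume)
    (h : IsWeakGradient ψ g) : gradEnergy ψ = ∫⁻ x, ‖g x‖ₑ ^ 2 := by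
  refine le_antisymm (iInf_le_of_le g (iInf_le_of_le hg (iInf_le _ h))) ?_
  refine le_iInf fun g' => le_iInf fun hg' => le_iInf fun h' => ?_
  refine (lintegral_congr_ae ?_).le
  filter_upwards [h.ae_eq h' hg hg'] with x hx
  rw [hx]

lemma exists_weakGradient {ψ : L2Rd d} (h : gradEnergy ψ ≠ ⊤) :
    ∃ g : Rd d → EuclideanSpace ℂ (Fin d), StronglyMeasurable g ∧ MemLp g 2 volume ∧
      IsWeakGradient ψ g := by
  obtain ⟨g, hg⟩ := iInf_lt_iff.1 (lt_top_iff_ne_top.2 h)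
  obtain ⟨hg, hg'⟩ := iInf_lt_iff.1 hg
  obtain ⟨hw, -⟩ := iInf_lt_iff.1 hg'
  exact ⟨hg.1.mk g, hg.1.stronglyMeasurable_mk, hg.ae_eq hg.1.ae_eq_mk, hw.congr hg.1.ae_eq_mk⟩

lemma lintegral_sq_enorm_ne_top {F : Type*} [NormedAddCommGroup F] {g : Rd d → F}
    (hg : MemLp g 2 volume) : ∫⁻ x, ‖g x‖ₑ ^ 2 ≠ ⊤ := by
  have := (lintegral_rpow_enorm_lt_top_of_eLpNorm_lt_top two_ne_zero ENNReal.ofNat_ne_top hg.2).ne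
  simpa using this

lemma memLp_two_of_lintegral {F : Type*} [NormedAddCommGroup F] {g : Rd d → F}
    (hm : AEStronglyMeasurable g volume) (hg : ∫⁻ x, ‖g x‖ₑ ^ 2 ≠ ⊤) : MemLp g 2 volume := by
  refine ⟨hm, ?_⟩
  rw [eLpNorm_lt_top_iff_lintegral_rpow_enorm_lt_top two_ne_zero ENNReal.ofNat_ne_top]
  simpa using hg.lt_top

lemma sq_lintegral_le {α : Type*} [MeasurableSpace α] {μ : Measure α} {f : α → ℝ≥0∞}
    (hf : AEMeasurable f μ) : (∫⁻ a, f a ∂μ) ^ 2 ≤ μ univ * ∫⁻ a, f a ^ 2 ∂μ := by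
  have h := ENNReal.lintegral_mul_le_Lp_mul_Lq μ Real.HolderConjugate.two_two
    (aemeasurable_const (b := (1 : ℝ≥0∞))) hf
  have h2 := pow_le_pow_left' h 2
  simp only [Pi.mul_apply, one_mul, ENNReal.one_rpow, lintegral_one, mul_pow] at h2
  refine h2.trans_eq ?_
  rw [← ENNReal.rpow_natCast, ← ENNReal.rpow_mul, ← ENNReal.rpow_natCast, ← ENNReal.rpow_mul]
  norm_num

/-- The derivative `∑ⱼ hⱼ gⱼ` in the direction `h`. -/
noncomputable def directional (h : Rd d) (z : EuclideanSpace ℂ (Fin d)) : ℂ :=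
  ∑ j, (h j : ℂ) * z j

lemma norm_directional_le (h : Rd d) (z : EuclideanSpace ℂ (Fin d)) :
    ‖directional h z‖ ≤ ‖h‖ * ‖z‖ := by
  refine (norm_sum_le _ _).trans ?_
  have := Real.sum_mul_le_sqrt_mul_sqrt Finset.univ (fun j => ‖h j‖) (fun j => ‖z j‖)
  rw [EuclideanSpace.norm_eq, EuclideanSpace.norm_eq]
  refine le_trans (le_of_eq ?_) this
  refine Finset.sum_congr rfl fun j _ => ?_
  rw [norm_mul, Complex.norm_real]

lemma continuous_directional (h : Rd d) : Continuous (directional h) := by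
  unfold directional; fun_prop

lemma fderiv_eq_sum (φ : Rd d → ℝ) (x h : Rd d) :
    fderiv ℝ φ x h = ∑ j, h j * fderiv ℝ φ x (EuclideanSpace.single j 1) := by
  conv_lhs => rw [← (EuclideanSpace.basisFun (Fin d) ℝ).sum_repr h]
  simp

lemma integrable_test_smul {φ : Rd d → ℝ} {f : Rd d → ℂ} (h1 : Continuous φ)
    (h2 : HasCompactSupport φ) (hf : MemLp f 2 volume) : Integrable (fun x => φ x • f x) :=
  (hf.locallyIntegrable (by norm_num)).integrable_smul_left_of_hasCompactSupport h1 h2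

lemma IsWeakGradient.directional {ψ : Rd d → ℂ} {g : Rd d → EuclideanSpace ℂ (Fin d)}
    (hψ : MemLp ψ 2 volume) (hg : MemLp g 2 volume)
    (h : IsWeakGradient ψ g) {φ : Rd d → ℝ} (h1 : ContDiff ℝ ∞ φ) (h2 : HasCompactSupport φ)
    (v : Rd d) : ∫ x, (fderiv ℝ φ x v) • ψ x = - ∫ x, φ x • directional v (g x) := by
  have e1 : ∀ x, (fderiv ℝ φ x v) • ψ x
      = ∑ j, (v j : ℂ) * ((fderiv ℝ φ x (EuclideanSpace.single j 1)) • ψ x) := by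
    intro x
    rw [fderiv_eq_sum, Finset.sum_smul]
    refine Finset.sum_congr rfl fun j _ => ?_
    simp [mul_assoc]
  have e2 : ∀ x, φ x • _root_.directional v (g x) = ∑ j, (v j : ℂ) * (φ x • g x j) := by
    intro x
    rw [_root_.directional, Finset.smul_sum]
    refine Finset.sum_congr rfl fun j _ => ?_
    simp; ring
  have hc : ∀ j : Fin d, Continuous fun x => fderiv ℝ φ x (EuclideanSpace.single j 1) := fun j =>
    (h1.continuous_fderiv (by simp)).clm_apply continuous_const
  simp_rw [e1, e2]
  rw [integral_finsetSum, integral_finsetSum, ← Finset.sum_neg_distrib]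
  · refine Finset.sum_congr rfl fun j _ => ?_
    rw [integral_const_mul, integral_const_mul, h φ h1 h2 j, mul_neg]
  · exact fun j _ => (integrable_test_smul h1.continuous h2 (memLp_coord hg j)).const_mul _
  · exact fun j _ => (integrable_test_smul (hc j) (h2.fderiv_apply ℝ _) hψ).const_mul _

end WeakGradient

/-! ### Translations of Sobolev functions -/

section Translation

variable {d : ℕ}

/-- Supplies joint integrability in `(t, x)` of functions of `x + t h`, as needed for the exchanges
of integrals below. -/
lemma measurePreserving_shear (h : Rd d) :
    MeasurePreserving (fun p : ℝ × Rd d => (p.1, p.2 + p.1 • h))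
      ((volume.restrict (Ioc (0 : ℝ) 1)).prod volume)
      ((volume.restrict (Ioc (0 : ℝ) 1)).prod volume) := by
  refine (MeasurePreserving.id _).skew_product (g := fun (t : ℝ) (x : Rd d) => x + t • h) ?_ ?_
  · exact Continuous.measurable (by unfold Function.uncurry; fun_prop)
  · exact Eventually.of_forall fun t => (measurePreserving_add_right volume (t • h)).map_eq

lemma integrable_shear {f : Rd d → ℝ} (hf : Integrable f) (h : Rd d) :
    Integrable (fun p : ℝ × Rd d => f (p.2 + p.1 • h))
      ((volume.restrict (Ioc (0 : ℝ) 1)).prod volume) := by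
  have h1 := hf.comp_snd (volume.restrict (Ioc (0 : ℝ) 1))
  exact ((measurePreserving_shear h).integrable_comp h1.1).2 h1

lemma norm_smul_le_sq_add_sq (a : ℝ) (z : ℂ) : ‖a • z‖ ≤ a ^ 2 + ‖z‖ ^ 2 := by
  rw [norm_smul, Real.norm_eq_abs, ← sq_abs a]
  nlinarith [sq_nonneg (|a| - ‖z‖), sq_nonneg |a|, sq_nonneg ‖z‖]

lemma integrable_sq_of_test {φ : Rd d → ℝ} (h1 : Continuous φ) (h2 : HasCompactSupport φ) :
    Integrable fun x => φ x ^ 2 := by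
  refine (h1.pow 2).integrable_of_hasCompactSupport ?_
  rw [sq]
  exact h2.mul_right

/-- Weak form of `ψ(x + h) - ψ(x) = ∫₀¹ h · ∇ψ(x + t h) dt`. The translation is moved onto `φ`,
where the classical formula holds; after Fubini the weak gradient is inserted for each `t` and the
translation is moved back. -/
lemma integral_test_translate {ψ : Rd d → ℂ} {g : Rd d → EuclideanSpace ℂ (Fin d)}
    (hψ : MemLp ψ 2 volume) (hψm : StronglyMeasurable ψ)
    (hg : MemLp g 2 volume) (hgm : StronglyMeasurable g)
    (hw : IsWeakGradient ψ g) {φ : Rd d → ℝ} (h1 : ContDiff ℝ ∞ φ) (h2 : HasCompactSupport φ)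
    (h : Rd d) :
    ∫ x, φ x • (ψ (x + h) - ψ x)
      = ∫ x, φ x • ∫ t in Ioc (0 : ℝ) 1, directional h (g (x + t • h)) := by
  have hφ' : Continuous fun x => fderiv ℝ φ x h :=
    (h1.continuous_fderiv (by simp)).clm_apply continuous_const
  have hwm : MemLp (fun x => directional h (g x)) 2 volume :=
    hg.of_le_mul (c := ‖h‖) ((continuous_directional h).comp_aestronglyMeasurable hg.1)
      (Eventually.of_forall fun x => norm_directional_le h (g x))
  have hws : StronglyMeasurable fun x => directional h (g x) :=
    (continuous_directional h).comp_stronglyMeasurable hgm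
  have hcomp : ∀ t : ℝ, HasCompactSupport fun x => φ (x - t • h) := fun t =>
    h2.comp_homeomorph (Homeomorph.subRight (t • h))
  have I1 : Integrable (fun p : ℝ × Rd d => (-(fderiv ℝ φ (p.2 - p.1 • h) h)) • ψ p.2)
      ((volume.restrict (Ioc (0 : ℝ) 1)).prod volume) := by
    have b1 := integrable_shear (integrable_sq_of_test hφ' (h2.fderiv_apply ℝ h)) (-h)
    have b2 := ((memLp_two_iff_integrable_sq_norm hψ.1).1 hψ).comp_snd
      (volume.restrict (Ioc (0 : ℝ) 1))
    refine (b1.add b2).mono' ?_ (Eventually.of_forall fun p => ?_)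
    · have m1 : Continuous fun p : ℝ × Rd d => -(fderiv ℝ φ (p.2 - p.1 • h) h) :=
        (hφ'.comp (by fun_prop : Continuous fun p : ℝ × Rd d => p.2 - p.1 • h)).neg
      exact m1.aestronglyMeasurable.smul (hψm.comp_measurable measurable_snd).aestronglyMeasurable
    · refine (norm_smul_le_sq_add_sq _ _).trans (le_of_eq ?_)
      simp [sub_eq_add_neg]
  have I2 : Integrable (fun p : ℝ × Rd d => φ p.2 • directional h (g (p.2 + p.1 • h)))
      ((volume.restrict (Ioc (0 : ℝ) 1)).prod volume) := by
    have b1 := integrable_shear ((memLp_two_iff_integrable_sq_norm hwm.1).1 hwm) h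
    have b2 := (integrable_sq_of_test h1.continuous h2).comp_snd (volume.restrict (Ioc (0 : ℝ) 1))
    refine (b2.add b1).mono' ?_ (Eventually.of_forall fun p => norm_smul_le_sq_add_sq _ _)
    refine AEStronglyMeasurable.smul (h1.continuous.comp continuous_snd).aestronglyMeasurable ?_
    exact (hws.comp_measurable (by fun_prop : Measurable fun p : ℝ × Rd d => p.2 + p.1 • h)).aestronglyMeasurable
  have hψh : MemLp (fun x => ψ (x + h)) 2 volume :=
    hψ.comp_measurePreserving (measurePreserving_add_right volume h)
  have s1 : ∫ x, φ x • (ψ (x + h) - ψ x) = ∫ x, (φ (x - h) - φ x) • ψ x := by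
    have e : ∫ x, φ x • ψ (x + h) = ∫ x, φ (x - h) • ψ x := by
      rw [← integral_add_right_eq_self (fun x => φ (x - h) • ψ x) h]
      simp
    simp_rw [smul_sub, sub_smul]
    rw [integral_sub (integrable_test_smul h1.continuous h2 hψh)
      (integrable_test_smul h1.continuous h2 hψ), integral_sub _
      (integrable_test_smul h1.continuous h2 hψ), e]
    have := hcomp 1
    rw [one_smul] at this
    exact integrable_test_smul (h1.continuous.comp (by fun_prop)) this hψ
  have s2 : ∀ x, (φ (x - h) - φ x) • ψ x
      = ∫ t in Ioc (0 : ℝ) 1, (-(fderiv ℝ φ (x - t • h) h)) • ψ x := by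
    intro x
    rw [integral_smul_const, ← intervalIntegral.integral_of_le zero_le_one]
    congr 1
    rw [intervalIntegral.integral_eq_sub_of_hasDerivAt (f := fun t : ℝ => φ (x - t • h))]
    · simp
    · intro t _
      have hd : HasDerivAt (fun t : ℝ => x - t • h) (-h) t := by
        have := ((hasDerivAt_id t).smul_const h).const_sub x
        simpa using this
      have := ((h1.differentiable (by simp)) (x - t • h)).hasFDerivAt.comp_hasDerivAt t hd
      simpa [Function.comp_def] using this
    · exact (hφ'.comp (by fun_prop)).neg.intervalIntegrable _ _
  have s3 : ∀ t : ℝ, ∫ x, (-(fderiv ℝ φ (x - t • h) h)) • ψ x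
      = ∫ x, φ x • directional h (g (x + t • h)) := by
    intro t
    have hd : ContDiff ℝ ∞ fun x => φ (x - t • h) := h1.comp (by fun_prop)
    have e := IsWeakGradient.directional hψ hg hw hd (hcomp t) h
    simp_rw [fderiv_comp_sub] at e
    simp_rw [neg_smul]
    rw [integral_neg, e, neg_neg,
      ← integral_add_right_eq_self (fun x => φ (x - t • h) • directional h (g x)) (t • h)]
    simp
  rw [s1]
  simp_rw [s2]
  rw [integral_integral_swap (f := fun x t => (-(fderiv ℝ φ (x - t • h) h)) • ψ x) I1.swap]
  simp_rw [s3]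
  rw [integral_integral_swap (f := fun t x => φ x • directional h (g (x + t • h))) I2]
  simp_rw [integral_smul]

lemma translate_sq_le {ψ : L2Rd d} (h : Rd d) :
    ∫⁻ x, ‖ψ (x + h) - ψ x‖ₑ ^ 2 ≤ ‖h‖ₑ ^ 2 * gradEnergy ψ := by
  by_cases hfin : gradEnergy ψ = ⊤
  -- For `h = 0` the right side is `0 * ⊤ = 0`, so this case has to be separated from the trivial
  -- bound by `⊤`.
  · by_cases h0 : h = 0
    · simp [h0]
    · rw [hfin, ENNReal.mul_top]
      · exact le_top
      · simpa using h0
  obtain ⟨g, hgm, hg, hw⟩ := exists_weakGradient hfin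
  rw [gradEnergy_eq hg hw]
  have hψ : MemLp ψ 2 volume := Lp.memLp ψ
  have hψm : StronglyMeasurable ψ := Lp.stronglyMeasurable ψ
  have hws : StronglyMeasurable fun x => directional h (g x) :=
    (continuous_directional h).comp_stronglyMeasurable hgm
  have hjm : StronglyMeasurable fun p : Rd d × ℝ => directional h (g (p.1 + p.2 • h)) :=
    hws.comp_measurable (by fun_prop)
  set u : Rd d → ℂ := fun x => ∫ t in Ioc (0 : ℝ) 1, directional h (g (x + t • h)) with hu
  have hum : StronglyMeasurable u := StronglyMeasurable.integral_prod_right (f := fun x t => _) hjm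
  have hb : ∫⁻ x, ‖u x‖ₑ ^ 2 ≤ ‖h‖ₑ ^ 2 * ∫⁻ x, ‖g x‖ₑ ^ 2 := by
    have p1 : ∀ x, ‖u x‖ₑ ^ 2 ≤ ∫⁻ t in Ioc (0 : ℝ) 1, ‖directional h (g (x + t • h))‖ₑ ^ 2 := by
      intro x
      refine (pow_le_pow_left' (enorm_integral_le_lintegral_enorm _) 2).trans ?_
      refine (sq_lintegral_le ?_).trans_eq (by simp)
      exact ((hws.comp_measurable (by fun_prop : Measurable fun t : ℝ => x + t • h)).enorm).aemeasurable
    refine (lintegral_mono p1).trans ?_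
    rw [lintegral_lintegral_swap (f := fun x t => ‖directional h (g (x + t • h))‖ₑ ^ 2)
      ((hjm.enorm.pow_const 2).aemeasurable)]
    have p2 : ∀ t : ℝ, ∫⁻ x, ‖directional h (g (x + t • h))‖ₑ ^ 2 ≤ ‖h‖ₑ ^ 2 * ∫⁻ x, ‖g x‖ₑ ^ 2 := by
      intro t
      rw [lintegral_add_right_eq_self (fun x => ‖directional h (g x)‖ₑ ^ 2) (t • h),
        ← lintegral_const_mul _ (hgm.enorm.pow_const 2)]
      refine lintegral_mono fun x => ?_
      rw [← mul_pow]
      refine pow_le_pow_left' ?_ 2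
      rw [← ofReal_norm, ← ofReal_norm, ← ofReal_norm, ← ENNReal.ofReal_mul (norm_nonneg _)]
      exact ENNReal.ofReal_le_ofReal (norm_directional_le h (g x))
    refine (lintegral_mono fun t => p2 t).trans ?_
    simp
  have hu2 : MemLp u 2 volume := by
    refine memLp_two_of_lintegral hum.aestronglyMeasurable (ne_top_of_le_ne_top ?_ hb)
    exact ENNReal.mul_ne_top (by simp) (lintegral_sq_enorm_ne_top hg)
  have hψh : MemLp (fun x => ψ (x + h)) 2 volume :=
    hψ.comp_measurePreserving (measurePreserving_add_right volume h)
  have hae : ∀ᵐ x, ψ (x + h) - ψ x = u x :=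
    ae_eq_of_integral_contDiff_smul_eq ((hψh.sub hψ).locallyIntegrable (by norm_num))
      (hu2.locallyIntegrable (by norm_num)) fun φ h1 h2 =>
        integral_test_translate hψ hψm hg hgm hw h1 h2 h
  refine le_trans (lintegral_congr_ae ?_).le hb
  filter_upwards [hae] with x hx
  rw [hx]

end Translation

/-! ### Local averages and the density of an orthonormal family -/

section LocalAverage

variable {d : ℕ}

/-- The mean value of `ψ` over the ball of radius `ℓ` around `x`. -/
noncomputable def ballAverage (ℓ : ℝ) (ψ : Rd d → ℂ) (x : Rd d) : ℂ :=
  ⨍ h in Metric.ball (0 : Rd d) ℓ, ψ (x + h)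

/-- The mean square oscillation of `ψ` over the ball of radius `ℓ` around `x`. -/
noncomputable def ballOscillation (ℓ : ℝ) (ψ : Rd d → ℂ) (x : Rd d) : ℝ≥0∞ :=
  (volume (Metric.ball (0 : Rd d) ℓ))⁻¹ *
    ∫⁻ h in Metric.ball (0 : Rd d) ℓ, ‖ψ (x + h) - ψ x‖ₑ ^ 2

lemma volume_ball_ne_zero {ℓ : ℝ} (hℓ : 0 < ℓ) : volume (Metric.ball (0 : Rd d) ℓ) ≠ 0 :=
  (Metric.measure_ball_pos volume 0 hℓ).ne'

lemma volume_ball_ne_top {ℓ : ℝ} : volume (Metric.ball (0 : Rd d) ℓ) ≠ ⊤ :=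
  measure_ball_lt_top.ne

lemma measurable_ballOscillation (ℓ : ℝ) (ψ : L2Rd d) : Measurable (ballOscillation ℓ ψ) := by
  have hψm : StronglyMeasurable ψ := Lp.stronglyMeasurable ψ
  refine Measurable.const_mul ?_ _
  have hm : Measurable fun p : Rd d × Rd d => ‖ψ (p.1 + p.2) - ψ p.1‖ₑ ^ 2 :=
    ((hψm.comp_measurable (by fun_prop)).sub (hψm.comp_measurable measurable_fst)).enorm.pow_const 2
  exact hm.lintegral_prod_right

lemma lintegral_ballOscillation_le {ℓ : ℝ} (hℓ : 0 < ℓ) (ψ : L2Rd d) :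
    ∫⁻ x, ballOscillation ℓ ψ x ≤ ENNReal.ofReal ℓ ^ 2 * gradEnergy ψ := by
  have hψm : StronglyMeasurable ψ := Lp.stronglyMeasurable ψ
  have hm : Measurable fun p : Rd d × Rd d => ‖ψ (p.1 + p.2) - ψ p.1‖ₑ ^ 2 :=
    ((hψm.comp_measurable (by fun_prop)).sub (hψm.comp_measurable measurable_fst)).enorm.pow_const 2
  unfold ballOscillation
  rw [lintegral_const_mul _ (Measurable.lintegral_prod_right hm),
    lintegral_lintegral_swap (f := fun x h => ‖ψ (x + h) - ψ x‖ₑ ^ 2) hm.aemeasurable]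
  have h1 : ∫⁻ h in Metric.ball (0 : Rd d) ℓ, ∫⁻ x, ‖ψ (x + h) - ψ x‖ₑ ^ 2
      ≤ ∫⁻ _ in Metric.ball (0 : Rd d) ℓ, ENNReal.ofReal ℓ ^ 2 * gradEnergy ψ := by
    refine setLIntegral_mono' measurableSet_ball fun h hh => (translate_sq_le h).trans ?_
    gcongr
    rw [← ofReal_norm]
    exact ENNReal.ofReal_le_ofReal (mem_ball_zero_iff.1 hh).le
  refine (mul_le_mul_right h1 _).trans_eq ?_
  rw [setLIntegral_const, mul_comm (_ * _) (volume _), ← mul_assoc, ENNReal.inv_mul_cancel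
    (volume_ball_ne_zero hℓ) volume_ball_ne_top, one_mul]

lemma enorm_sq_add_le (a c : ℂ) : ‖a + c‖ₑ ^ 2 ≤ 2 * ‖a‖ₑ ^ 2 + 2 * ‖c‖ₑ ^ 2 := by
  have h : ‖a + c‖ ^ 2 ≤ 2 * ‖a‖ ^ 2 + 2 * ‖c‖ ^ 2 := by
    have := norm_add_le a c
    nlinarith [sq_nonneg (‖a‖ - ‖c‖), norm_nonneg (a + c)]
  have h2 := ENNReal.ofReal_le_ofReal h
  rw [ENNReal.ofReal_add (by positivity) (by positivity), ENNReal.ofReal_mul (by norm_num),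
    ENNReal.ofReal_mul (by norm_num), ENNReal.ofReal_pow (norm_nonneg _),
    ENNReal.ofReal_pow (norm_nonneg _), ENNReal.ofReal_pow (norm_nonneg _), ofReal_norm,
    ofReal_norm, ofReal_norm] at h2
  simpa using h2

lemma enorm_sq_le_average_add_oscillation {ℓ : ℝ} (hℓ : 0 < ℓ) (ψ : L2Rd d) (x : Rd d) :
    ‖ψ x‖ₑ ^ 2 ≤ 2 * ‖ballAverage ℓ ψ x‖ₑ ^ 2 + 2 * ballOscillation ℓ ψ x := by
  have hψ : MemLp ψ 2 volume := Lp.memLp ψ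
  have hψm : StronglyMeasurable ψ := Lp.stronglyMeasurable ψ
  set B := Metric.ball (0 : Rd d) ℓ with hB
  have hv0 : volume B ≠ 0 := volume_ball_ne_zero hℓ
  have hvt : volume B ≠ ⊤ := volume_ball_ne_top
  have hvr : volume.real B ≠ 0 := (ENNReal.toReal_pos hv0 hvt).ne'
  have hfm : IsFiniteMeasure (volume.restrict B) := ⟨by simpa using hvt.lt_top⟩
  have hint : Integrable (fun h => ψ (x + h)) (volume.restrict B) :=
    ((hψ.comp_measurePreserving (measurePreserving_add_left volume x)).restrict B).integrable
      (by norm_num)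
  have hdiff : ballAverage ℓ ψ x - ψ x = ⨍ h in B, (ψ (x + h) - ψ x) := by
    rw [ballAverage, setAverage_eq, setAverage_eq, integral_sub hint (integrable_const _),
      setIntegral_const, smul_sub, smul_smul, inv_mul_cancel₀ hvr, one_smul]
  have hosc : ‖ballAverage ℓ ψ x - ψ x‖ₑ ^ 2 ≤ ballOscillation ℓ ψ x := by
    rw [hdiff, setAverage_eq, enorm_smul, mul_pow, ballOscillation]
    have h1 : ‖∫ h in B, (ψ (x + h) - ψ x)‖ₑ ^ 2
        ≤ volume B * ∫⁻ h in B, ‖ψ (x + h) - ψ x‖ₑ ^ 2 := by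
      refine (pow_le_pow_left' (enorm_integral_le_lintegral_enorm _) 2).trans ?_
      refine (sq_lintegral_le ?_).trans_eq (by simp)
      exact ((hψm.comp_measurable (by fun_prop : Measurable fun h => x + h)).sub
        stronglyMeasurable_const).enorm.aemeasurable
    have h2 : ‖(volume.real B)⁻¹‖ₑ = (volume B)⁻¹ := by
      rw [Real.enorm_eq_ofReal (by positivity), ENNReal.ofReal_inv_of_pos
        (lt_of_le_of_ne measureReal_nonneg hvr.symm), Measure.real, ENNReal.ofReal_toReal hvt]
    rw [h2]
    refine (mul_le_mul_right h1 _).trans_eq ?_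
    rw [← hB, sq, mul_assoc, ← mul_assoc _ (volume B), ENNReal.inv_mul_cancel hv0 hvt, one_mul]
  have h3 := enorm_sq_add_le (ballAverage ℓ ψ x) (-(ballAverage ℓ ψ x - ψ x))
  rw [enorm_neg, neg_sub, add_sub_cancel] at h3
  exact h3.trans (by gcongr)

/-- The averages are `|B|⁻¹ ⟨1_B, ψ_i⟩`, so Bessel's inequality bounds the sum by `|B|⁻² ‖1_B‖² =
|B|⁻¹`. -/
lemma sum_ballAverage_le {ι : Type*} {ℓ : ℝ} (hℓ : 0 < ℓ) {ψ : ι → L2Rd d}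
    (hψ : Orthonormal ℂ ψ) (x : Rd d) :
    ∑' i, ‖ballAverage ℓ (ψ i) x‖ₑ ^ 2 ≤ (volume (Metric.ball (0 : Rd d) ℓ))⁻¹ := by
  set B := Metric.ball x ℓ with hB
  have hvol : volume B = volume (Metric.ball (0 : Rd d) ℓ) := Measure.addHaar_ball_center _ _ _
  have hv0 : volume B ≠ 0 := hvol ▸ volume_ball_ne_zero hℓ
  have hvt : volume B ≠ ⊤ := measure_ball_lt_top.ne
  have hvr : 0 < volume.real B := ENNReal.toReal_pos hv0 hvt
  set e : L2Rd d := indicatorConstLp 2 (measurableSet_ball (x := x) (ε := ℓ)) hvt (1 : ℂ) with he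
  have hne : ‖e‖ ^ 2 = volume.real B := by
    rw [he, norm_indicatorConstLp (by norm_num) (by norm_num), norm_one, one_mul,
      ENNReal.toReal_ofNat, ← Real.sqrt_eq_rpow, Real.sq_sqrt hvr.le]
  have hA : ∀ i, ballAverage ℓ (ψ i) x = (volume.real B)⁻¹ • inner ℂ e (ψ i) := by
    intro i
    rw [he, L2.inner_indicatorConstLp_one, ballAverage, setAverage_eq]
    congr 1
    · rw [Measure.real, Measure.real, hvol]
    · have := (measurePreserving_add_left volume x).setIntegral_preimage_emb
        (MeasurableEquiv.addLeft x).measurableEmbedding (fun y => ψ i y) B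
      rw [← this]
      congr 2
      ext h; simp [hB, Metric.mem_ball]
  rw [ENNReal.tsum_eq_iSup_sum]
  refine iSup_le fun s => ?_
  have h1 := hψ.sum_inner_products_le e (s := s)
  have h2 : ∑ i ∈ s, ‖ballAverage ℓ (ψ i) x‖ ^ 2 ≤ (volume.real B)⁻¹ := by
    have : ∀ i, ‖ballAverage ℓ (ψ i) x‖ ^ 2 = ((volume.real B)⁻¹) ^ 2 * ‖inner ℂ (ψ i) e‖ ^ 2 := by
      intro i
      rw [hA, norm_smul, mul_pow, norm_inner_symm, Real.norm_eq_abs, sq_abs]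
    simp_rw [this]
    rw [← Finset.mul_sum]
    refine (mul_le_mul_of_nonneg_left (h1.trans_eq hne) (by positivity)).trans_eq ?_
    field_simp
  have h3 := ENNReal.ofReal_le_ofReal h2
  rw [ENNReal.ofReal_sum_of_nonneg fun i _ => by positivity, ENNReal.ofReal_inv_of_pos hvr,
    Measure.real, ENNReal.ofReal_toReal hvt, hvol] at h3
  refine le_trans (le_of_eq (Finset.sum_congr rfl fun i _ => ?_)) h3
  rw [ENNReal.ofReal_pow (norm_nonneg _), ofReal_norm]

/-- The density of an orthonormal family with bounded occupation numbers is bounded, up to an error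
controlled by the kinetic energy. -/
theorem density_le_add_oscillation {ι : Type*} [Countable ι] {ℓ : ℝ} (hℓ : 0 < ℓ) {ψ : ι → L2Rd d}
    (hψ : Orthonormal ℂ ψ) {ν : ι → ℝ≥0∞} {m : ℝ≥0∞} (hν : ∀ i, ν i ≤ m) :
    ∃ D : Rd d → ℝ≥0∞, Measurable D ∧
      ∫⁻ x, D x ≤ ENNReal.ofReal ℓ ^ 2 * ∑' i, ν i * gradEnergy (ψ i) ∧
      ∀ x, ∑' i, ν i * ‖ψ i x‖ₑ ^ 2
        ≤ 2 * (m * (volume (Metric.ball (0 : Rd d) ℓ))⁻¹) + 2 * D x := by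
  refine ⟨fun x => ∑' i, ν i * ballOscillation ℓ (ψ i) x,
    Measurable.tsum fun i => (measurable_ballOscillation ℓ (ψ i)).const_mul _, ?_, fun x => ?_⟩
  · rw [lintegral_tsum fun i => ((measurable_ballOscillation ℓ (ψ i)).const_mul _).aemeasurable,
      ← ENNReal.tsum_mul_left]
    refine ENNReal.tsum_le_tsum fun i => ?_
    rw [lintegral_const_mul _ (measurable_ballOscillation ℓ (ψ i)), mul_left_comm]
    exact mul_le_mul_right (lintegral_ballOscillation_le hℓ (ψ i)) _
  · calc ∑' i, ν i * ‖ψ i x‖ₑ ^ 2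
        ≤ ∑' i, (2 * (m * ‖ballAverage ℓ (ψ i) x‖ₑ ^ 2)
            + 2 * (ν i * ballOscillation ℓ (ψ i) x)) := by
          refine ENNReal.tsum_le_tsum fun i => ?_
          refine (mul_le_mul_right (enorm_sq_le_average_add_oscillation hℓ (ψ i) x) _).trans ?_
          rw [mul_add, mul_left_comm, mul_left_comm (ν i) 2 (ballOscillation _ _ _)]
          gcongr
          exact hν i
      _ ≤ _ := by
          rw [ENNReal.tsum_add, ENNReal.tsum_mul_left, ENNReal.tsum_mul_left, ENNReal.tsum_mul_left]
          gcongr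
          exact sum_ballAverage_le hℓ hψ x

end LocalAverage

/-! ### The quadratic form on finite linear combinations -/

section MinMax

variable {d : ℕ}

lemma Lp_coeFn_sum_smul {ι : Type*} (s : Finset ι) (c : ι → ℂ) (ψ : ι → L2Rd d) :
    ⇑(∑ i ∈ s, c i • ψ i) =ᵐ[volume] fun x => ∑ i ∈ s, c i * ψ i x := by
  classical
  induction s using Finset.induction_on with
  | empty =>
    simp only [Finset.sum_empty]
    exact Lp.coeFn_zero ℂ 2 volume
  | insert i s hi ih =>
    rw [Finset.sum_insert hi]
    filter_upwards [Lp.coeFn_add (c i • ψ i) (∑ i ∈ s, c i • ψ i), Lp.coeFn_smul (c i) (ψ i), ih]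
      with x h1 h2 h3
    rw [h1, Pi.add_apply, h2, h3, Finset.sum_insert hi]
    rfl

lemma memLp_sum_smul {ι F : Type*} [NormedAddCommGroup F] [NormedSpace ℂ F] (s : Finset ι)
    (c : ι → ℂ) {g : ι → Rd d → F} (hg : ∀ i, MemLp (g i) 2 volume) :
    MemLp (fun x => ∑ i ∈ s, c i • g i x) 2 volume :=
  memLp_finsetSum s fun i _ => (hg i).const_smul (c i)

lemma IsWeakGradient.sum_smul {ι : Type*} (s : Finset ι) (c : ι → ℂ) {ψ : ι → L2Rd d}
    {g : ι → Rd d → EuclideanSpace ℂ (Fin d)} (hg : ∀ i, MemLp (g i) 2 volume)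
    (hw : ∀ i, IsWeakGradient (ψ i) (g i)) :
    IsWeakGradient (∑ i ∈ s, c i • ψ i : L2Rd d) (fun x => ∑ i ∈ s, c i • g i x) := by
  intro φ h1 h2 j
  have hc : Continuous fun x => fderiv ℝ φ x (EuclideanSpace.single j 1) :=
    (h1.continuous_fderiv (by simp)).clm_apply continuous_const
  have e1 : ∫ x, (fderiv ℝ φ x (EuclideanSpace.single j 1)) • (∑ i ∈ s, c i • ψ i : L2Rd d) x
      = ∫ x, ∑ i ∈ s, c i * ((fderiv ℝ φ x (EuclideanSpace.single j 1)) • ψ i x) := by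
    refine integral_congr_ae ?_
    filter_upwards [Lp_coeFn_sum_smul s c ψ] with x hx
    rw [hx, Finset.smul_sum]
    exact Finset.sum_congr rfl fun i _ => (mul_smul_comm _ _ _).symm
  have e2 : ∀ x, φ x • (∑ i ∈ s, c i • g i x) j = ∑ i ∈ s, c i * (φ x • g i x j) := by
    intro x
    rw [WithLp.ofLp_sum, Finset.sum_apply, Finset.smul_sum]
    exact Finset.sum_congr rfl fun i _ => (mul_smul_comm _ _ _).symm
  rw [e1]
  simp_rw [e2]
  rw [integral_finsetSum, integral_finsetSum, ← Finset.sum_neg_distrib]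
  · refine Finset.sum_congr rfl fun i _ => ?_
    rw [integral_const_mul, integral_const_mul, hw i φ h1 h2 j, mul_neg]
  · exact fun i _ => (integrable_test_smul h1.continuous h2 (memLp_coord (hg i) j)).const_mul _
  · exact fun i _ => (integrable_test_smul hc (h2.fderiv_apply ℝ _) (Lp.memLp (ψ i))).const_mul _

lemma lintegral_ofReal_mul_sq {V : Rd d → ℝ} {ψ : Rd d → ℂ} :
    ∫⁻ x, ENNReal.ofReal (V x) * ‖ψ x‖ₑ ^ 2 = ∫⁻ x, ENNReal.ofReal (V x * ‖ψ x‖ ^ 2) := by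
  refine lintegral_congr fun x => ?_
  rw [ENNReal.ofReal_mul' (by positivity), ENNReal.ofReal_pow (norm_nonneg _), ofReal_norm]

lemma gradEnergy_eq_ofReal {ψ : L2Rd d} {g : Rd d → EuclideanSpace ℂ (Fin d)}
    (hg : MemLp g 2 volume) (hw : IsWeakGradient ψ g) :
    gradEnergy ψ = ENNReal.ofReal (∫ x, ‖g x‖ ^ 2) := by
  rw [gradEnergy_eq hg hw, ofReal_integral_eq_lintegral_ofReal
    ((memLp_two_iff_integrable_sq_norm hg.1).1 hg) (Eventually.of_forall fun x => by positivity)]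
  refine lintegral_congr fun x => ?_
  rw [ENNReal.ofReal_pow (norm_nonneg _), ofReal_norm]

lemma schrodingerEnergy_eq {V : Rd d → ℝ} {ψ : L2Rd d} {g : Rd d → EuclideanSpace ℂ (Fin d)}
    (hg : MemLp g 2 volume) (hw : IsWeakGradient ψ g) (hV : Integrable fun x => V x * ‖ψ x‖ ^ 2) :
    schrodingerEnergy V ψ = (((∫ x, ‖g x‖ ^ 2) + ∫ x, V x * ‖ψ x‖ ^ 2 : ℝ) : EReal) := by
  have h1 : ∫⁻ x, ENNReal.ofReal (V x * ‖ψ x‖ ^ 2) ≠ ⊤ := hV.lintegral_lt_top.ne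
  have h2 : ∫⁻ x, ENNReal.ofReal (-(V x * ‖ψ x‖ ^ 2)) ≠ ⊤ := hV.neg.lintegral_lt_top.ne
  rw [schrodingerEnergy, gradEnergy_eq_ofReal hg hw, lintegral_ofReal_mul_sq,
    lintegral_ofReal_mul_sq]
  simp_rw [neg_mul]
  rw [integral_eq_lintegral_pos_part_sub_lintegral_neg_part hV, EReal.coe_ennreal_ofReal,
    max_eq_left (integral_nonneg fun x => by positivity), ← EReal.coe_ennreal_toReal h1,
    ← EReal.coe_ennreal_toReal h2, ← EReal.coe_add, ← EReal.coe_sub, add_sub_assoc]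

/-- The matrix of the quadratic form of `-Δ + V` with respect to the functions `ψ i`. -/
noncomputable def formMatrix {ι : Type*} (V : Rd d → ℝ) (ψ : ι → Rd d → ℂ)
    (g : ι → Rd d → EuclideanSpace ℂ (Fin d)) : Matrix ι ι ℂ :=
  fun i j => ∫ x, (inner ℂ (g i x) (g j x) + V x * inner ℂ (ψ i x) (ψ j x))

lemma integrable_inner_of_memLp {F : Type*} [NormedAddCommGroup F] [InnerProductSpace ℂ F]
    {f g : Rd d → F} (hf : MemLp f 2 volume) (hg : MemLp g 2 volume) :
    Integrable fun x => (inner ℂ (f x) (g x) : ℂ) := by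
  refine (((memLp_two_iff_integrable_sq_norm hf.1).1 hf).add
    ((memLp_two_iff_integrable_sq_norm hg.1).1 hg)).mono' (hf.1.inner hg.1)
    (Eventually.of_forall fun x => ?_)
  refine (norm_inner_le_norm _ _).trans ?_
  simp only [Pi.add_apply]
  nlinarith [sq_nonneg (‖f x‖ - ‖g x‖), sq_nonneg ‖f x‖, sq_nonneg ‖g x‖]

lemma integrable_potential_inner {V : Rd d → ℝ} (hVm : Measurable V) {f g : Rd d → ℂ}
    (hf : AEStronglyMeasurable f volume) (hg : AEStronglyMeasurable g volume)
    (hVf : Integrable fun x => V x * ‖f x‖ ^ 2) (hVg : Integrable fun x => V x * ‖g x‖ ^ 2) :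
    Integrable fun x => (V x : ℂ) * (inner ℂ (f x) (g x) : ℂ) := by
  refine (hVf.norm.add hVg.norm).mono' ?_ (Eventually.of_forall fun x => ?_)
  · exact (Complex.measurable_ofReal.comp hVm).aestronglyMeasurable.mul (hf.inner hg)
  · have h1 : ‖(inner ℂ (f x) (g x) : ℂ)‖ ≤ ‖f x‖ ^ 2 + ‖g x‖ ^ 2 := by
      refine (norm_inner_le_norm _ _).trans ?_
      nlinarith [sq_nonneg (‖f x‖ - ‖g x‖), sq_nonneg ‖f x‖, sq_nonneg ‖g x‖]
    simp only [norm_mul, Complex.norm_real, Pi.add_apply, norm_pow, norm_norm]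
    rw [← mul_add]
    exact mul_le_mul_of_nonneg_left h1 (norm_nonneg _)

lemma formMatrix_isHermitian {ι : Type*} (V : Rd d → ℝ) (ψ : ι → Rd d → ℂ)
    (g : ι → Rd d → EuclideanSpace ℂ (Fin d)) : (formMatrix V ψ g).IsHermitian := by
  ext i j
  rw [Matrix.conjTranspose_apply, formMatrix, formMatrix, RCLike.star_def, ← integral_conj]
  refine integral_congr_ae (Eventually.of_forall fun x => ?_)
  simp only [map_add, map_mul, Complex.conj_ofReal, inner_conj_symm]

/-- Sesquilinear expansion of the energy of `∑ c_i ψ_i`. The integrability assertion shows that the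
span stays in the form domain. -/
lemma formMatrix_apply_sum {ι : Type*} [Fintype ι] {V : Rd d → ℝ} (hVm : Measurable V)
    {ψ : ι → Rd d → ℂ} (hψ : ∀ i, MemLp (ψ i) 2 volume)
    {g : ι → Rd d → EuclideanSpace ℂ (Fin d)} (hg : ∀ i, MemLp (g i) 2 volume)
    (hV : ∀ i, Integrable fun x => V x * ‖ψ i x‖ ^ 2) (c : ι → ℂ) :
    Integrable (fun x => V x * ‖∑ i, c i * ψ i x‖ ^ 2) ∧
    ∑ i, ∑ j, (starRingEnd ℂ) (c i) * (formMatrix V ψ g i j * c j)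
      = (((∫ x, ‖∑ i, c i • g i x‖ ^ 2) + ∫ x, V x * ‖∑ i, c i * ψ i x‖ ^ 2 : ℝ) : ℂ) := by
  have hI1 : ∀ i j, Integrable fun x => (inner ℂ (g i x) (g j x) : ℂ) := fun i j =>
    integrable_inner_of_memLp (hg i) (hg j)
  have hI2 : ∀ i j, Integrable fun x => (V x : ℂ) * (inner ℂ (ψ i x) (ψ j x) : ℂ) := fun i j =>
    integrable_potential_inner hVm (hψ i).1 (hψ j).1 (hV i) (hV j)
  have p1 : ∀ x, ((‖∑ i, c i • g i x‖ ^ 2 : ℝ) : ℂ)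
      = ∑ i, ∑ j, (starRingEnd ℂ) (c i) * (inner ℂ (g i x) (g j x) * c j) := by
    intro x
    have := inner_self_eq_norm_sq_to_K (𝕜 := ℂ) (∑ i, c i • g i x)
    push_cast
    rw [← Complex.coe_algebraMap] at *
    rw [← this, sum_inner]
    refine Finset.sum_congr rfl fun i _ => ?_
    rw [inner_sum]
    refine Finset.sum_congr rfl fun j _ => ?_
    rw [inner_smul_left, inner_smul_right]
    ring
  have p2 : ∀ x, ((V x * ‖∑ i, c i * ψ i x‖ ^ 2 : ℝ) : ℂ)
      = ∑ i, ∑ j, (starRingEnd ℂ) (c i) * (V x * inner ℂ (ψ i x) (ψ j x) * c j) := by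
    intro x
    have := inner_self_eq_norm_sq_to_K (𝕜 := ℂ) (∑ i, c i • ψ i x)
    simp_rw [smul_eq_mul] at this
    push_cast
    rw [← Complex.coe_algebraMap] at *
    rw [← this, sum_inner, Finset.mul_sum]
    refine Finset.sum_congr rfl fun i _ => ?_
    rw [inner_sum, Finset.mul_sum]
    refine Finset.sum_congr rfl fun j _ => ?_
    rw [← smul_eq_mul (c i), ← smul_eq_mul (c j) (ψ j x), inner_smul_left, inner_smul_right]
    ring
  have hV2 : Integrable (fun x => ((V x * ‖∑ i, c i * ψ i x‖ ^ 2 : ℝ) : ℂ)) := by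
    simp_rw [p2]
    exact integrable_finsetSum _ fun i _ => integrable_finsetSum _ fun j _ =>
      ((hI2 i j).mul_const _).const_mul _
  have hV3 : Integrable (fun x => V x * ‖∑ i, c i * ψ i x‖ ^ 2) := by
    exact hV2.re.congr (Eventually.of_forall fun x => Complex.ofReal_re _)
  refine ⟨hV3, ?_⟩
  push_cast
  rw [← integral_complex_ofReal, ← integral_complex_ofReal]
  simp_rw [p1, p2]
  rw [integral_finsetSum _ fun i _ => integrable_finsetSum _ fun j _ =>
      ((hI1 i j).mul_const _).const_mul _,
    integral_finsetSum _ fun i _ => integrable_finsetSum _ fun j _ =>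
      ((hI2 i j).mul_const _).const_mul _, ← Finset.sum_add_distrib]
  refine Finset.sum_congr rfl fun i _ => ?_
  rw [integral_finsetSum _ fun j _ => ((hI1 i j).mul_const _).const_mul _,
    integral_finsetSum _ fun j _ => ((hI2 i j).mul_const _).const_mul _, ← Finset.sum_add_distrib]
  refine Finset.sum_congr rfl fun j _ => ?_
  rw [integral_const_mul, integral_const_mul, integral_mul_const, integral_mul_const, formMatrix,
    integral_add (hI1 i j) (hI2 i j)]
  ring

end MinMax

/-! ### Diagonalization on the span and doubly stochastic weights -/

section Diagonalization

variable {d : ℕ}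

lemma Matrix.IsHermitian.form_eq_sum_eigenvalues {n : ℕ} {M : Matrix (Fin n) (Fin n) ℂ}
    (hM : M.IsHermitian) (c : EuclideanSpace ℂ (Fin n)) :
    ∑ i, ∑ j, (starRingEnd ℂ) (c i) * (M i j * c j)
      = ((∑ k, hM.eigenvalues k * ‖(inner ℂ (hM.eigenvectorBasis k) c : ℂ)‖ ^ 2 : ℝ) : ℂ) := by
  set T := Matrix.toEuclideanLin M with hT
  have hsym : T.IsSymmetric := Matrix.isSymmetric_toEuclideanLin_iff.2 hM
  have h1 : ∑ i, ∑ j, (starRingEnd ℂ) (c i) * (M i j * c j) = inner ℂ c (T c) := by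
    rw [PiLp.inner_apply]
    refine Finset.sum_congr rfl fun i _ => ?_
    rw [← Finset.mul_sum, RCLike.inner_apply, mul_comm]
    rfl
  have h2 : ∀ k, T (hM.eigenvectorBasis k) = (hM.eigenvalues k : ℂ) • hM.eigenvectorBasis k := by
    intro k
    ext i
    have := congrFun (hM.mulVec_eigenvectorBasis k) i
    simpa [hT, Matrix.toEuclideanLin] using this
  rw [h1, ← hM.eigenvectorBasis.sum_inner_mul_inner c (T c)]
  push_cast
  refine Finset.sum_congr rfl fun k _ => ?_
  rw [← hsym, h2, inner_smul_left, Complex.conj_ofReal, mul_left_comm]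
  congr 1
  rw [← inner_conj_symm, ← Complex.normSq_eq_conj_mul_self, Complex.normSq_eq_norm_sq]
  push_cast
  rfl

/-- Diagonalization of the quadratic form of `-Δ + V` on the span of an orthonormal system: the
diagonal entries of the form are averages of the eigenvalues `μ k` with doubly stochastic weights,
and the `μ k` dominate the min-max values. -/
theorem exists_doublyStochastic_energy {n : ℕ} {ψ : Fin n → L2Rd d} (hψ : Orthonormal ℂ ψ)
    {g : Fin n → Rd d → EuclideanSpace ℂ (Fin d)} (hg : ∀ i, MemLp (g i) 2 volume)
    (hw : ∀ i, IsWeakGradient (ψ i) (g i)) {V : Rd d → ℝ} (hVm : Measurable V)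
    (hV : ∀ i, Integrable fun x => V x * ‖ψ i x‖ ^ 2) :
    ∃ (p : Fin n → Fin n → ℝ) (μ : Fin n → ℝ), (∀ i k, 0 ≤ p i k) ∧ (∀ i, ∑ k, p i k = 1) ∧
      (∀ k, ∑ i, p i k = 1) ∧
      (∀ i, (∫ x, ‖g i x‖ ^ 2) + ∫ x, V x * ‖ψ i x‖ ^ 2 = ∑ k, p i k * μ k) ∧
      ∀ k : Fin n, schrodingerEigenvalue V k ≤ (μ k : EReal) := by
  have hψm : ∀ i, MemLp (ψ i : Rd d → ℂ) 2 volume := fun i => Lp.memLp (ψ i)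
  have hM := formMatrix_isHermitian V (fun i => (ψ i : Rd d → ℂ)) g
  set μ := hM.eigenvalues with hμ
  set v := hM.eigenvectorBasis with hv
  -- Mathlib lists the eigenvalues of a Hermitian matrix in its own order; comparison with the
  -- min-max values needs them nondecreasing.
  set σ := Tuple.sort μ with hσ
  have hmono : Monotone (μ ∘ σ) := Tuple.monotone_sort μ
  have hq : ∀ c : EuclideanSpace ℂ (Fin n),
      (∫ x, ‖∑ i, c i • g i x‖ ^ 2) + ∫ x, V x * ‖∑ i, c i * ψ i x‖ ^ 2
        = ∑ k, μ k * ‖(inner ℂ (v k) c : ℂ)‖ ^ 2 := by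
    intro c
    have h1 := (formMatrix_apply_sum hVm hψm hg hV c).2
    rw [hM.form_eq_sum_eigenvalues c] at h1
    exact_mod_cast h1.symm
  refine ⟨fun i k => ‖(inner ℂ (v (σ k)) (EuclideanSpace.single i (1 : ℂ)) : ℂ)‖ ^ 2, fun k => μ (σ k),
    fun i k => by positivity, fun i => ?_, fun k => ?_, fun i => ?_, fun j => ?_⟩
  · rw [Equiv.sum_comp σ fun k => ‖(inner ℂ (v k) (EuclideanSpace.single i (1 : ℂ)) : ℂ)‖ ^ 2,
      v.sum_sq_norm_inner_right]
    simp
  · have h1 := (EuclideanSpace.basisFun (Fin n) ℂ).sum_sq_norm_inner_left (v (σ k))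
    rw [v.orthonormal.1 (σ k), one_pow] at h1
    simpa using h1
  · have h1 := hq (EuclideanSpace.single i 1)
    rw [Equiv.sum_comp σ fun k => ‖(inner ℂ (v k) (EuclideanSpace.single i (1 : ℂ)) : ℂ)‖ ^ 2 * μ k]
    simp_rw [mul_comm (_ ^ 2) (μ _)]
    rw [← h1]
    congr 1
    · refine integral_congr_ae (Eventually.of_forall fun x => ?_)
      simp only
      rw [Finset.sum_eq_single i]
      · simp
      · intro j _ hj; simp [hj]
      · simp
    · refine integral_congr_ae (Eventually.of_forall fun x => ?_)
      simp only
      rw [Finset.sum_eq_single i]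
      · simp
      · intro j _ hj; simp [hj]
      · simp
  · set W : EuclideanSpace ℂ (Fin n) →ₗ[ℂ] L2Rd d :=
      (Fintype.linearCombination ℂ ψ) ∘ₗ (WithLp.linearEquiv 2 ℂ (Fin n → ℂ)).toLinearMap with hW
    have hWa : ∀ c, W c = ∑ i, c i • ψ i := fun c => by
      simp [hW, Fintype.linearCombination_apply]
    have hWinj : Function.Injective W := by
      have := linearIndependent_iff_injective_fintypeLinearCombination.1 hψ.linearIndependent
      exact this.comp (WithLp.linearEquiv 2 ℂ (Fin n → ℂ)).injective
    have hWn : ∀ c, ‖W c‖ = ‖c‖ := by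
      intro c
      have h1 := hψ.inner_sum (fun i => c i) (fun i => c i) Finset.univ
      rw [← hWa, inner_self_eq_norm_sq_to_K] at h1
      have h2 := inner_self_eq_norm_sq_to_K (𝕜 := ℂ) c
      rw [PiLp.inner_apply] at h2
      have h3 : ((‖W c‖ : ℂ)) ^ 2 = (‖c‖ : ℂ) ^ 2 := by
        refine h1.trans (Eq.trans ?_ h2)
        refine Finset.sum_congr rfl fun i _ => ?_
        rw [RCLike.inner_apply, mul_comm]
      have h4 : ‖W c‖ ^ 2 = ‖c‖ ^ 2 := by exact_mod_cast h3
      exact (pow_left_inj₀ (norm_nonneg _) (norm_nonneg _) two_ne_zero).1 h4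
    -- Trial space for the min-max value with index `j`: the span of the eigenvectors of the `j + 1`
    -- smallest eigenvalues, on which the form is at most `μ (σ j)`.
    set e : Fin (j + 1) → EuclideanSpace ℂ (Fin n) := fun k => v (σ (Fin.castLE j.2 k)) with he
    have heo : Orthonormal ℂ e := v.orthonormal.comp _
      (σ.injective.comp (Fin.castLE_injective j.2))
    have hind : LinearIndependent ℂ (W ∘ e) :=
      heo.linearIndependent.map' W (LinearMap.ker_eq_bot.2 hWinj)
    refine iInf_le_of_le (Submodule.span ℂ (range (W ∘ e))) (iInf_le_of_le ?_ ?_)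
    · rw [finrank_span_eq_card hind, Fintype.card_fin]
    refine iSup_le fun f => iSup_le fun hf => iSup_le fun hf1 => ?_
    obtain ⟨a, rfl⟩ := (Submodule.mem_span_range_iff_exists_fun ℂ).1 hf
    set c := ∑ k, a k • e k with hc
    have hfc : ∑ k, a k • (W ∘ e) k = W c := by
      rw [hc, map_sum]; simp
    rw [hfc] at hf1 ⊢
    have hcoe : ⇑(W c) =ᵐ[volume] fun x => ∑ i, c i * ψ i x := by
      rw [hWa]; exact Lp_coeFn_sum_smul Finset.univ (fun i => c i) ψ
    have hint := (formMatrix_apply_sum hVm hψm hg hV c).1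
    have hint' : Integrable fun x => V x * ‖W c x‖ ^ 2 := by
      refine hint.congr ?_
      filter_upwards [hcoe] with x hx
      rw [hx]
    have hwW : IsWeakGradient (W c) (fun x => ∑ i, c i • g i x) := by
      rw [hWa]; exact IsWeakGradient.sum_smul Finset.univ (fun i => c i) hg hw
    rw [schrodingerEnergy_eq (memLp_sum_smul Finset.univ (fun i => c i) hg) hwW hint']
    have e1 : ∫ x, V x * ‖W c x‖ ^ 2 = ∫ x, V x * ‖∑ i, c i * ψ i x‖ ^ 2 := by
      refine integral_congr_ae ?_
      filter_upwards [hcoe] with x hx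
      rw [hx]
    rw [e1, hq c]
    have hle : ∑ k, μ k * ‖(inner ℂ (v k) c : ℂ)‖ ^ 2 ≤ ∑ k, μ (σ j) * ‖(inner ℂ (v k) c : ℂ)‖ ^ 2 := by
      refine Finset.sum_le_sum fun m _ => ?_
      by_cases hm : ∃ k, m = σ (Fin.castLE j.2 k)
      · obtain ⟨k, rfl⟩ := hm
        refine mul_le_mul_of_nonneg_right (hmono ?_) (by positivity)
        rw [Fin.le_def]
        simpa using Nat.lt_succ_iff.1 k.2
      · have : (inner ℂ (v m) c : ℂ) = 0 := by
          rw [hc, inner_sum]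
          refine Finset.sum_eq_zero fun k _ => ?_
          rw [inner_smul_right, v.orthonormal.2 fun h => hm ⟨k, h⟩, mul_zero]
        rw [this]; simp
    rw [← Finset.mul_sum, v.sum_sq_norm_inner_right, ← hWn c, hf1, one_pow, mul_one] at hle
    exact_mod_cast hle

end Diagonalization

/-! ### Bounds on the min-max values -/

section EigenvalueBounds

variable {d : ℕ}

lemma integrable_norm_sq (ψ : L2Rd d) : Integrable fun x => ‖ψ x‖ ^ 2 :=
  (memLp_two_iff_integrable_sq_norm (Lp.memLp ψ).1).1 (Lp.memLp ψ)

lemma integral_norm_sq (ψ : L2Rd d) : ∫ x, ‖ψ x‖ ^ 2 = ‖ψ‖ ^ 2 := by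
  have h := L2.inner_def (𝕜 := ℂ) ψ ψ
  rw [inner_self_eq_norm_sq_to_K] at h
  have h2 : ∀ x, (inner ℂ (ψ x) (ψ x) : ℂ) = ((‖ψ x‖ ^ 2 : ℝ) : ℂ) := fun x => by
    rw [inner_self_eq_norm_sq_to_K]; push_cast; rfl
  simp_rw [h2] at h
  rw [integral_complex_ofReal] at h
  exact Complex.ofReal_injective (h.symm.trans (by push_cast; rfl))

lemma lintegral_enorm_sq (ψ : L2Rd d) : ∫⁻ x, ‖ψ x‖ₑ ^ 2 = ENNReal.ofReal (‖ψ‖ ^ 2) := by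
  rw [← integral_norm_sq, ofReal_integral_eq_lintegral_ofReal (integrable_norm_sq ψ)
    (Eventually.of_forall fun x => by positivity)]
  refine lintegral_congr fun x => ?_
  rw [ENNReal.ofReal_pow (norm_nonneg _), ofReal_norm]

lemma lintegral_neg_potential_le {V : Rd d → ℝ} {c : ℝ} (hc : ∀ᵐ x, c ≤ V x) {ψ : L2Rd d}
    (hψ : ‖ψ‖ = 1) : ∫⁻ x, ENNReal.ofReal (-V x) * ‖ψ x‖ₑ ^ 2 ≤ ENNReal.ofReal (-c) := by
  calc ∫⁻ x, ENNReal.ofReal (-V x) * ‖ψ x‖ₑ ^ 2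
      ≤ ∫⁻ x, ENNReal.ofReal (-c) * ‖ψ x‖ₑ ^ 2 := by
        refine lintegral_mono_ae ?_
        filter_upwards [hc] with x hx
        gcongr
    _ = ENNReal.ofReal (-c) := by
        rw [lintegral_const_mul _ ((Lp.stronglyMeasurable ψ).enorm.pow_const 2),
          lintegral_enorm_sq, hψ]
        simp

lemma exists_unit_mem {j : ℕ} {S : Submodule ℂ (L2Rd d)} (hS : Module.finrank ℂ S = j + 1) :
    ∃ ψ ∈ S, ‖ψ‖ = 1 := by
  have : Nontrivial S := Module.nontrivial_of_finrank_pos (R := ℂ) (by omega)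
  obtain ⟨φ, hφ⟩ := exists_ne (0 : S)
  have hn : ‖(φ : L2Rd d)‖ ≠ 0 := by simpa using hφ
  refine ⟨((‖(φ : L2Rd d)‖⁻¹ : ℝ) : ℂ) • (φ : L2Rd d), S.smul_mem _ φ.2, ?_⟩
  rw [norm_smul, Complex.norm_real, norm_inv, norm_norm, inv_mul_cancel₀ hn]

lemma neg_le_schrodingerEigenvalue {V : Rd d → ℝ} {c : ℝ} (hc : ∀ᵐ x, c ≤ V x) (j : ℕ) :
    -((ENNReal.ofReal (-c) : ℝ≥0∞) : EReal) ≤ schrodingerEigenvalue V j := by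
  refine le_iInf fun S => le_iInf fun hS => ?_
  obtain ⟨ψ, hψS, hψ⟩ := exists_unit_mem hS
  refine le_trans ?_ (le_iSup_of_le ψ (le_iSup_of_le hψS (le_iSup_of_le hψ le_rfl)))
  have h1 : ((∫⁻ x, ENNReal.ofReal (-V x) * ‖ψ x‖ₑ ^ 2 : ℝ≥0∞) : EReal)
      ≤ ((ENNReal.ofReal (-c) : ℝ≥0∞) : EReal) :=
    EReal.coe_ennreal_le_coe_ennreal_iff.2 (lintegral_neg_potential_le hc hψ)
  rw [schrodingerEnergy, sub_eq_add_neg]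
  refine (EReal.neg_le_neg_iff.2 h1).trans ?_
  refine le_add_of_nonneg_left ?_
  exact add_nonneg (EReal.coe_ennreal_nonneg _) (EReal.coe_ennreal_nonneg _)

lemma schrodingerEigenvalue_ne_bot {V : Rd d → ℝ} {c : ℝ} (hc : ∀ᵐ x, c ≤ V x) (j : ℕ) :
    schrodingerEigenvalue V j ≠ ⊥ := by
  refine ne_bot_of_le_ne_bot ?_ (neg_le_schrodingerEigenvalue hc j)
  rw [EReal.coe_ennreal_ofReal, ← EReal.coe_neg]
  exact EReal.coe_ne_bot _

/-- Fenchel's inequality at `λ_k ≤ μ_k` gives `-F(λ_k) ≤ ν_i μ_k + β(ν_i)` for every pair `i, k`.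
Averaging with the weights `p_ik`, whose row sums turn the right side into the energies and whose
column sums leave each `F(λ_k)` once, proves the bound. -/
lemma neg_tsum_le_energy_fin {b : EReal} (hb : b ≠ ⊥) {F : ℝ → ℝ≥0∞} (hF : ConvexProfile b F)
    {n : ℕ} {ψ : Fin n → L2Rd d} (hψ : Orthonormal ℂ ψ)
    {g : Fin n → Rd d → EuclideanSpace ℂ (Fin d)} (hg : ∀ i, MemLp (g i) 2 volume)
    (hw : ∀ i, IsWeakGradient (ψ i) (g i)) {V : Rd d → ℝ} (hVm : Measurable V)
    (hV : ∀ i, Integrable fun x => V x * ‖ψ i x‖ ^ 2) {c : ℝ} (hc : ∀ᵐ x, c ≤ V x)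
    (hle : ∀ j, schrodingerEigenvalue V j ≤ b) {ν : Fin n → ℝ} (hν : ∀ i, ν i ∈ transformDomain b F)
    (hfin : ∑' j, F (schrodingerEigenvalue V j).toReal ≠ ⊤) :
    -(∑' j, F (schrodingerEigenvalue V j).toReal).toReal
      ≤ ∑ i, ν i * ((∫ x, ‖g i x‖ ^ 2) + ∫ x, V x * ‖ψ i x‖ ^ 2) + ∑ i, betaFun b F (ν i) := by
  obtain ⟨p, μ, hp0, hp1, hp2, hE, hμ⟩ := exists_doublyStochastic_energy hψ hg hw hVm hV
  have key : ∀ (i k : Fin n), -(F (schrodingerEigenvalue V k).toReal).toReal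
      ≤ ν i * μ k + betaFun b F (ν i) := by
    intro i k
    set L := (schrodingerEigenvalue V k).toReal with hL
    have hLe : schrodingerEigenvalue V k = (L : EReal) := by
      rw [hL, EReal.coe_toReal]
      · exact ne_top_of_le_ne_top (EReal.coe_ne_top _) (hμ k)
      · exact schrodingerEigenvalue_ne_bot hc k
    have hLμ : L ≤ μ k := by
      have := hμ k
      rw [hLe] at this
      exact_mod_cast this
    have h1 : ν i * L ≤ ν i * μ k := mul_le_mul_of_nonneg_left hLμ (hν i).1
    have hLb := hle k
    rw [hLe] at hLb
    -- A min-max value may equal `b`, where nothing is known about `F` except `F ≥ 0`; there the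
    -- bound `-(ν b) ≤ β(ν)` takes the place of Fenchel's inequality.
    rcases hLb.lt_or_eq with h | h
    · have := hF.le_betaFun hb (hν i) (s := L) ⟨h, ENNReal.ne_top_of_tsum_ne_top hfin k⟩
      linarith
    · have := hF.neg_mul_le_betaFun hb (hν i) h.ge
      have h0 : 0 ≤ (F L).toReal := ENNReal.toReal_nonneg
      linarith
  have h1 : ∑ i, ν i * ((∫ x, ‖g i x‖ ^ 2) + ∫ x, V x * ‖ψ i x‖ ^ 2) + ∑ i, betaFun b F (ν i)
      = ∑ i, ∑ k, p i k * (ν i * μ k + betaFun b F (ν i)) := by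
    rw [← Finset.sum_add_distrib]
    refine Finset.sum_congr rfl fun i _ => ?_
    simp_rw [mul_add]
    rw [Finset.sum_add_distrib, ← Finset.sum_mul, hp1, one_mul, ← mul_add, hE i, Finset.mul_sum]
    congr 1
    exact Finset.sum_congr rfl fun k _ => by ring
  have h2 : ∑ k : Fin n, (F (schrodingerEigenvalue V k).toReal).toReal
      ≤ (∑' j, F (schrodingerEigenvalue V j).toReal).toReal := by
    rw [← ENNReal.toReal_sum (f := fun k : Fin n => F (schrodingerEigenvalue V k).toReal)
      fun k _ => ENNReal.ne_top_of_tsum_ne_top hfin (k : ℕ)]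
    refine ENNReal.toReal_mono hfin ?_
    rw [Fin.sum_univ_eq_sum_range (fun k => F (schrodingerEigenvalue V k).toReal) n]
    exact ENNReal.sum_le_tsum _
  rw [h1]
  calc -(∑' j, F (schrodingerEigenvalue V j).toReal).toReal
      ≤ -∑ k : Fin n, (F (schrodingerEigenvalue V k).toReal).toReal := neg_le_neg h2
    _ = ∑ i, ∑ k, p i k * -(F (schrodingerEigenvalue V k).toReal).toReal := by
        rw [Finset.sum_comm, ← Finset.sum_neg_distrib]
        refine Finset.sum_congr rfl fun k _ => ?_
        rw [← Finset.sum_mul, hp2, one_mul]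
    _ ≤ _ := Finset.sum_le_sum fun i _ => Finset.sum_le_sum fun k _ =>
        mul_le_mul_of_nonneg_left (key i k) (hp0 i k)

/-- The weak duality between `∑ F(λ_j)` and the energies of an orthonormal system. -/
theorem neg_tsum_le_energy {b : EReal} (hb : b ≠ ⊥) {F : ℝ → ℝ≥0∞} (hF : ConvexProfile b F)
    {ι : Type*} [Fintype ι] {ψ : ι → L2Rd d} (hψ : Orthonormal ℂ ψ)
    {g : ι → Rd d → EuclideanSpace ℂ (Fin d)} (hg : ∀ i, MemLp (g i) 2 volume)
    (hw : ∀ i, IsWeakGradient (ψ i) (g i)) {V : Rd d → ℝ} (hVm : Measurable V)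
    (hV : ∀ i, Integrable fun x => V x * ‖ψ i x‖ ^ 2) {c : ℝ} (hc : ∀ᵐ x, c ≤ V x)
    (hle : ∀ j, schrodingerEigenvalue V j ≤ b) {ν : ι → ℝ} (hν : ∀ i, ν i ∈ transformDomain b F)
    (hfin : ∑' j, F (schrodingerEigenvalue V j).toReal ≠ ⊤) :
    -(∑' j, F (schrodingerEigenvalue V j).toReal).toReal
      ≤ ∑ i, ν i * ((∫ x, ‖g i x‖ ^ 2) + ∫ x, V x * ‖ψ i x‖ ^ 2) + ∑ i, betaFun b F (ν i) := by
  set e := (Fintype.equivFin ι).symm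
  have := neg_tsum_le_energy_fin hb hF (hψ.comp e e.injective) (fun i => hg (e i))
    (fun i => hw (e i)) hVm (fun i => hV (e i)) hc hle (fun i => hν (e i)) hfin
  rw [← e.sum_comp fun i => betaFun b F (ν i),
    ← e.sum_comp fun i => ν i * ((∫ x, ‖g i x‖ ^ 2) + ∫ x, V x * ‖ψ i x‖ ^ 2)]
  exact this

/-- Low energy forces mass into the sublevel set: `M - M' ≤ ∫ (M - V)|ψ|² ≤ (M - c) ∫_{V < M} |ψ|²`.
The Dirichlet integral is at most `M' - c` because `∫ V|ψ|² ≥ c`. -/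
lemma bounds_of_energy_lt {V : Rd d → ℝ} (hVm : Measurable V) {c M M' : ℝ}
    (hc : ∀ᵐ x, c ≤ V x) (hM : M' < M) (hcM : c < M) {ψ : L2Rd d} (hψ : ‖ψ‖ = 1)
    (hE : schrodingerEnergy V ψ ≤ M') :
    gradEnergy ψ ≤ ENNReal.ofReal (M - c) ∧
      ENNReal.ofReal ((M - M') / (M - c)) ≤ ∫⁻ x in {x | V x < M}, ‖ψ x‖ₑ ^ 2 := by
  have hN : ∫⁻ x, ENNReal.ofReal (-V x) * ‖ψ x‖ₑ ^ 2 ≠ ⊤ :=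
    ne_top_of_le_ne_top ENNReal.ofReal_ne_top (lintegral_neg_potential_le hc hψ)
  have hfin : gradEnergy ψ + ∫⁻ x, ENNReal.ofReal (V x) * ‖ψ x‖ₑ ^ 2 ≠ ⊤ := by
    intro h
    rw [schrodingerEnergy, ← EReal.coe_ennreal_add, h, EReal.coe_ennreal_top,
      ← EReal.coe_ennreal_toReal hN, EReal.top_sub_coe] at hE
    exact absurd hE (by simp)
  obtain ⟨hG, hP⟩ := ENNReal.add_ne_top.1 hfin
  obtain ⟨g, hgm, hg, hw⟩ := exists_weakGradient hG
  have hsm : StronglyMeasurable ψ := Lp.stronglyMeasurable ψ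
  have hint : Integrable fun x => V x * ‖ψ x‖ ^ 2 := by
    refine ⟨(hVm.aestronglyMeasurable.mul (hsm.norm.pow 2).aestronglyMeasurable), ?_⟩
    rw [hasFiniteIntegral_iff_norm]
    rw [lintegral_ofReal_mul_sq] at hP
    have hN' := hN
    rw [lintegral_ofReal_mul_sq (V := fun x => -V x)] at hN'
    have : ∀ x, ENNReal.ofReal ‖V x * ‖ψ x‖ ^ 2‖
        ≤ ENNReal.ofReal (V x * ‖ψ x‖ ^ 2) + ENNReal.ofReal (-V x * ‖ψ x‖ ^ 2) := by
      intro x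
      rw [Real.norm_eq_abs]
      rcases abs_cases (V x * ‖ψ x‖ ^ 2) with ⟨h, -⟩ | ⟨h, -⟩
      · rw [h]; exact le_self_add
      · rw [h, ← neg_mul]; exact le_add_self
    refine (lintegral_mono this).trans_lt ?_
    rw [lintegral_add_left]
    · exact ENNReal.add_lt_top.2 ⟨hP.lt_top, hN'.lt_top⟩
    · exact (hVm.mul (hsm.measurable.norm.pow_const 2)).ennreal_ofReal
  rw [schrodingerEnergy_eq hg hw hint, EReal.coe_le_coe_iff] at hE
  have h0 := integrable_norm_sq ψ
  have h1 := integral_norm_sq ψ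
  rw [hψ, one_pow] at h1
  have hlow : c ≤ ∫ x, V x * ‖ψ x‖ ^ 2 := by
    rw [← mul_one c, ← h1, ← integral_const_mul]
    refine integral_mono_ae (h0.const_mul c) hint ?_
    filter_upwards [hc] with x hx
    exact mul_le_mul_of_nonneg_right hx (by positivity)
  have hgnn : 0 ≤ ∫ x, ‖g x‖ ^ 2 := integral_nonneg fun x => by positivity
  refine ⟨?_, ?_⟩
  · rw [gradEnergy_eq_ofReal hg hw]
    exact ENNReal.ofReal_le_ofReal (by linarith)
  · have hBm : MeasurableSet {x | V x < M} := measurableSet_lt hVm measurable_const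
    have h2 : M - M' ≤ (M - c) * ∫ x in {x | V x < M}, ‖ψ x‖ ^ 2 := by
      rw [← integral_indicator hBm, ← integral_const_mul]
      have h3 : M - M' ≤ ∫ x, (M * ‖ψ x‖ ^ 2 - V x * ‖ψ x‖ ^ 2) := by
        rw [integral_sub (h0.const_mul M) hint, integral_const_mul, h1]
        linarith
      refine h3.trans (integral_mono_ae ((h0.const_mul M).sub hint)
        ((h0.indicator hBm).const_mul _) ?_)
      filter_upwards [hc] with x hx
      by_cases hxM : V x < M
      · rw [indicator_of_mem (by exact hxM)]
        rw [← sub_mul]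
        exact mul_le_mul_of_nonneg_right (by linarith) (by positivity)
      · rw [indicator_of_notMem (by exact hxM), mul_zero]
        rw [← sub_mul]
        exact mul_nonpos_of_nonpos_of_nonneg (by linarith) (by positivity)
    have h4 : (M - M') / (M - c) ≤ ∫ x in {x | V x < M}, ‖ψ x‖ ^ 2 := by
      rw [div_le_iff₀ (by linarith)]; linarith
    refine (ENNReal.ofReal_le_ofReal h4).trans_eq ?_
    rw [ofReal_integral_eq_lintegral_ofReal h0.integrableOn
      (Eventually.of_forall fun x => by positivity)]
    refine lintegral_congr fun x => ?_
    rw [ENNReal.ofReal_pow (norm_nonneg _), ofReal_norm]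

/-- Integrating the density estimate over `B` gives `n η ≤ 2 |B| / |B_ℓ| + 2 ℓ² n L`. The choice `4
L ℓ² ≤ η` lets half of the left side absorb the last term. -/
lemma card_le_of_local_mass {n : ℕ} {ψ : Fin n → L2Rd d} (hψ : Orthonormal ℂ ψ) {B : Set (Rd d)}
    (hB : volume B ≠ ⊤) {L η ℓ : ℝ} (hL : 0 < L) (hη : 0 < η) (hℓ : 0 < ℓ)
    (hℓ2 : 4 * L * ℓ ^ 2 ≤ η)
    (h1 : ∀ i, gradEnergy (ψ i) ≤ ENNReal.ofReal L)
    (h2 : ∀ i, ENNReal.ofReal η ≤ ∫⁻ x in B, ‖ψ i x‖ₑ ^ 2) :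
    (n : ℝ) * η ≤ 4 * (volume.real B / volume.real (Metric.ball (0 : Rd d) ℓ)) := by
  obtain ⟨D, hDm, hD, hρ⟩ := density_le_add_oscillation hℓ hψ (ν := fun _ => 1) (m := 1)
    (fun _ => le_rfl)
  have hm : ∀ i, Measurable fun x => ‖ψ i x‖ₑ ^ 2 := fun i =>
    (Lp.stronglyMeasurable (ψ i)).enorm.pow_const 2
  set v := volume (Metric.ball (0 : Rd d) ℓ) with hv
  have hv0 : 0 < v.toReal := ENNReal.toReal_pos (volume_ball_ne_zero hℓ) volume_ball_ne_top
  have h3 : (n : ℝ≥0∞) * ENNReal.ofReal η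
      ≤ 2 * (v⁻¹ * volume B) + 2 * (ENNReal.ofReal ℓ ^ 2 * (n * ENNReal.ofReal L)) := by
    calc (n : ℝ≥0∞) * ENNReal.ofReal η = ∑ _i : Fin n, ENNReal.ofReal η := by simp
      _ ≤ ∑ i, ∫⁻ x in B, ‖ψ i x‖ₑ ^ 2 := Finset.sum_le_sum fun i _ => h2 i
      _ = ∫⁻ x in B, ∑ i, ‖ψ i x‖ₑ ^ 2 := (lintegral_finsetSum _ fun i _ => hm i).symm
      _ ≤ ∫⁻ x in B, (2 * v⁻¹ + 2 * D x) := by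
          refine lintegral_mono fun x => ?_
          have := hρ x
          simp only [one_mul, tsum_fintype] at this
          exact this
      _ ≤ 2 * (v⁻¹ * volume B) + 2 * ∫⁻ x, D x := by
          rw [lintegral_add_left measurable_const, lintegral_const_mul _ hDm, setLIntegral_const,
            mul_assoc]
          gcongr
          exact Measure.restrict_le_self
      _ ≤ _ := by
          gcongr
          refine hD.trans ?_
          gcongr
          simp only [one_mul, tsum_fintype]
          exact (Finset.sum_le_sum fun i _ => h1 i).trans_eq (by simp)
  have hvi : v⁻¹ ≠ ⊤ := ENNReal.inv_ne_top.2 (volume_ball_ne_zero hℓ)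
  have hfin1 : 2 * (v⁻¹ * volume B) ≠ ⊤ :=
    ENNReal.mul_ne_top (by norm_num) (ENNReal.mul_ne_top hvi hB)
  have hfin2 : 2 * (ENNReal.ofReal ℓ ^ 2 * ((n : ℝ≥0∞) * ENNReal.ofReal L)) ≠ ⊤ :=
    ENNReal.mul_ne_top (by norm_num) (ENNReal.mul_ne_top (ENNReal.pow_ne_top ENNReal.ofReal_ne_top)
      (ENNReal.mul_ne_top (ENNReal.natCast_ne_top n) ENNReal.ofReal_ne_top))
  have h4 := ENNReal.toReal_mono (ENNReal.add_ne_top.2 ⟨hfin1, hfin2⟩) h3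
  rw [ENNReal.toReal_add hfin1 hfin2] at h4
  simp only [ENNReal.toReal_mul, ENNReal.toReal_pow, ENNReal.toReal_inv, ENNReal.toReal_natCast,
    ENNReal.toReal_ofReal hη.le, ENNReal.toReal_ofReal hℓ.le, ENNReal.toReal_ofReal hL.le,
    ENNReal.toReal_ofNat] at h4
  have h5 : (n : ℝ) * (4 * L * ℓ ^ 2) ≤ n * η := mul_le_mul_of_nonneg_left hℓ2 (by positivity)
  rw [Measure.real, Measure.real, div_eq_inv_mul]
  linarith

/-- If `{V < M}` has finite measure, then only finitely many min-max values lie below `M' < M`. -/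
theorem eventually_le_schrodingerEigenvalue {V : Rd d → ℝ} (hVm : Measurable V) {c M M' : ℝ}
    (hc : ∀ᵐ x, c ≤ V x) (hM : M' < M) (hB : volume {x | V x < M} ≠ ⊤) :
    ∀ᶠ j in atTop, (M' : EReal) ≤ schrodingerEigenvalue V j := by
  -- Lowering `c` is harmless and makes `M - c` positive, as the divisions below require.
  wlog hcM : c < M generalizing c
  · refine this (c := min c (M - 1)) ?_ (lt_of_le_of_lt (min_le_right _ _) (by linarith))
    filter_upwards [hc] with x hx
    exact (min_le_left _ _).trans hx
  set L := M - c with hL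
  have hL0 : 0 < L := by simp only [hL]; linarith
  set η := (M - M') / L with hη
  have hη0 : 0 < η := div_pos (by linarith) hL0
  set ℓ := Real.sqrt (η / (4 * L)) with hℓ
  have hℓ0 : 0 < ℓ := Real.sqrt_pos.2 (by positivity)
  have hℓ2 : 4 * L * ℓ ^ 2 ≤ η := by
    rw [hℓ, Real.sq_sqrt (by positivity)]
    exact (mul_div_cancel₀ _ (by positivity)).le
  set C := 4 * (volume.real {x | V x < M} / volume.real (Metric.ball (0 : Rd d) ℓ)) with hC
  -- A min-max value below `M'` at index `j` would give `j + 1` orthonormal functions with the local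
  -- mass `η`, hence `j + 1 ≤ C / η`.
  filter_upwards [eventually_ge_atTop ⌈C / η⌉₊] with j hj
  by_contra! hlt
  obtain ⟨S, hS⟩ := iInf_lt_iff.1 hlt
  obtain ⟨hfr, hS⟩ := iInf_lt_iff.1 hS
  have : FiniteDimensional ℂ S := Module.finite_of_finrank_pos (by omega)
  set w := stdOrthonormalBasis ℂ S with hwdef
  have hwo : Orthonormal ℂ fun i => (w i : L2Rd d) :=
    w.orthonormal.comp_linearIsometry S.subtypeₗᵢ
  have hb : ∀ i, gradEnergy (w i : L2Rd d) ≤ ENNReal.ofReal L ∧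
      ENNReal.ofReal η ≤ ∫⁻ x in {x | V x < M}, ‖(w i : L2Rd d) x‖ₑ ^ 2 := fun i =>
    bounds_of_energy_lt hVm hc hM hcM (hwo.1 i)
      (le_trans (le_iSup₂_of_le (f := fun (φ : L2Rd d) (_ : φ ∈ S) =>
        ⨆ _ : ‖φ‖ = 1, schrodingerEnergy V φ) (w i : L2Rd d) (w i).2
        (le_iSup_of_le (hwo.1 i) le_rfl)) hS.le)
  have := card_le_of_local_mass hwo hB hL0 hη0 hℓ0 hℓ2 (fun i => (hb i).1) (fun i => (hb i).2)
  rw [hfr, ← hC, ← le_div_iff₀ hη0] at this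
  have h2 := (Nat.le_ceil (C / η)).trans (Nat.cast_le.2 hj)
  push_cast at this
  linarith

end EigenvalueBounds

/-! ### Trial spaces with small Dirichlet integral -/

section TestFunctions

variable {d : ℕ}

/-- The gradient of a real function, as a complex vector field. -/
noncomputable def complexGradient (f : Rd d → ℝ) (x : Rd d) : EuclideanSpace ℂ (Fin d) :=
  WithLp.toLp 2 fun j => ((fderiv ℝ f x (EuclideanSpace.single j 1) : ℝ) : ℂ)

lemma continuous_complexGradient {f : Rd d → ℝ} (hf : ContDiff ℝ ∞ f) :
    Continuous (complexGradient f) := by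
  refine (PiLp.continuous_toLp 2 _).comp (continuous_pi fun j => ?_)
  exact Complex.continuous_ofReal.comp
    ((hf.continuous_fderiv (by simp)).clm_apply continuous_const)

lemma hasCompactSupport_complexGradient {f : Rd d → ℝ} (hf : HasCompactSupport f) :
    HasCompactSupport (complexGradient f) := by
  refine (hf.fderiv ℝ).mono' ?_
  refine subset_trans (fun x hx => ?_) subset_closure
  contrapose! hx
  simp only [Function.mem_support, not_not] at hx ⊢
  simp only [complexGradient, hx]
  ext j
  simp

lemma isWeakGradient_complexGradient {f : Rd d → ℝ} (hf : ContDiff ℝ ∞ f)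
    (hfc : HasCompactSupport f) : IsWeakGradient (fun x => (f x : ℂ)) (complexGradient f) := by
  intro φ h1 h2 j
  have hc1 : Continuous fun x => fderiv ℝ φ x (EuclideanSpace.single j 1) :=
    (h1.continuous_fderiv (by simp)).clm_apply continuous_const
  have hc2 : Continuous fun x => fderiv ℝ f x (EuclideanSpace.single j 1) :=
    (hf.continuous_fderiv (by simp)).clm_apply continuous_const
  have h := integral_smul_fderiv_eq_neg_fderiv_smul_of_integrable (μ := (volume : Measure (Rd d)))
    (f := f) (g := φ) (v := EuclideanSpace.single j 1)
    ((hc2.mul h1.continuous).integrable_of_hasCompactSupport h2.mul_left)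
    ((hf.continuous.mul hc1).integrable_of_hasCompactSupport hfc.mul_right)
    ((hf.continuous.mul h1.continuous).integrable_of_hasCompactSupport h2.mul_left)
    (fun x _ => hf.differentiable (by simp) x) (fun x _ => h1.differentiable (by simp) x)
  have e1 : ∀ x, (fderiv ℝ φ x (EuclideanSpace.single j 1)) • (f x : ℂ)
      = ((f x • fderiv ℝ φ x (EuclideanSpace.single j 1) : ℝ) : ℂ) := fun x => by
    rw [Complex.real_smul, smul_eq_mul]; push_cast; ring
  have e2 : ∀ x, φ x • complexGradient f x j
      = ((fderiv ℝ f x (EuclideanSpace.single j 1) • φ x : ℝ) : ℂ) := fun x => by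
    simp only [complexGradient, Complex.real_smul, smul_eq_mul]; push_cast; ring
  simp_rw [e1, e2]
  rw [integral_complex_ofReal, integral_complex_ofReal, h]
  push_cast; rfl

lemma IsWeakGradient.congr_left {ψ ψ' : Rd d → ℂ} {g : Rd d → EuclideanSpace ℂ (Fin d)}
    (h : IsWeakGradient ψ g) (hψ : ψ =ᵐ[volume] ψ') : IsWeakGradient ψ' g := by
  intro φ h1 h2 j
  rw [← h φ h1 h2 j]
  refine integral_congr_ae ?_
  filter_upwards [hψ] with x hx
  rw [hx]

lemma integral_comp_smul_sub (F : Rd d → ℝ) {r : ℝ} (hr : 0 < r) (v : Rd d) :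
    ∫ x, F (r • x - v) = (r ^ d)⁻¹ * ∫ x, F x := by
  rw [Measure.integral_comp_smul volume (fun y => F (y - v)) r, integral_sub_right_eq_self,
    finrank_euclideanSpace, Fintype.card_fin, abs_of_pos (by positivity), smul_eq_mul]

lemma complexGradient_scale {χ : Rd d → ℝ} (hχ : ContDiff ℝ ∞ χ) (a r : ℝ) (v x : Rd d) :
    complexGradient (fun x => a * χ (r • x - v)) x = ((a * r : ℝ) : ℂ) • complexGradient χ (r • x - v) := by
  have hd : HasFDerivAt (fun x : Rd d => a * χ (r • x - v))
      (a • (fderiv ℝ χ (r • x - v)).comp (r • ContinuousLinearMap.id ℝ (Rd d))) x := by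
    have h1 : HasFDerivAt (fun x : Rd d => r • x - v) (r • ContinuousLinearMap.id ℝ (Rd d)) x :=
      ((hasFDerivAt_id x).const_smul r).sub_const v
    exact (((hχ.differentiable (by simp)) (r • x - v)).hasFDerivAt.comp x h1).const_mul a
  ext j
  simp only [complexGradient, hd.fderiv]
  simp [mul_assoc]

/-- There are subspaces of arbitrary dimension of compactly supported functions on which the
Dirichlet integral is small. -/
theorem exists_subspace_gradEnergy_le (hd : 0 < d) (n : ℕ) {ε : ℝ} (hε : 0 < ε) :
    ∃ S : Submodule ℂ (L2Rd d), Module.finrank ℂ S = n ∧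
      (∀ ψ ∈ S, gradEnergy ψ ≤ ENNReal.ofReal (ε * ‖ψ‖ ^ 2)) ∧
      ∃ R : ℝ, ∀ ψ ∈ S, ∀ᵐ x, R < ‖x‖ → ψ x = 0 := by
  let bump : ContDiffBump (0 : Rd d) := ⟨1, 2, one_pos, one_lt_two⟩
  set χ : Rd d → ℝ := fun x => bump x with hχdef
  have hχ : ContDiff ℝ ∞ χ := bump.contDiff
  have hχc : HasCompactSupport χ := bump.hasCompactSupport
  have hχ0 : ∀ y, 2 ≤ ‖y‖ → χ y = 0 := fun y hy => bump.zero_of_le_dist (by simpa using hy)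
  have hA0 : Integrable fun x => χ x ^ 2 := integrable_sq_of_test hχ.continuous hχc
  set A := ∫ x, χ x ^ 2 with hA
  have hApos : 0 < A := by
    refine (Continuous.integral_pos_of_hasCompactSupport_nonneg_nonzero (x := 0)
      (hχ.continuous.pow 2) ?_ (fun x => by positivity) ?_)
    · simp_rw [sq]; exact hχc.mul_right
    · have : χ 0 = 1 := bump.one_of_mem_closedBall (by simp [bump])
      simp [this]
  set G := ∫ x, ‖complexGradient χ x‖ ^ 2 with hG
  have hG0 : 0 ≤ G := integral_nonneg fun x => by positivity
  obtain ⟨r, hr, hrε⟩ : ∃ r : ℝ, 0 < r ∧ n * (r ^ 2 * (G / A)) ≤ ε := by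
    -- Dilation by `r` multiplies the Dirichlet quotient `G / A` by `r²`; the factor `n` pays for
    -- Cauchy–Schwarz in the sum of gradients. The `+ 1` keeps the denominator positive.
    refine ⟨Real.sqrt (ε / (n * (G / A) + 1)), Real.sqrt_pos.2 (by positivity), ?_⟩
    rw [Real.sq_sqrt (by positivity)]
    have h0 : 0 ≤ n * (G / A) := by positivity
    rw [div_mul_eq_mul_div, ← mul_div_assoc, div_le_iff₀ (by positivity)]
    nlinarith
  set e : Rd d := EuclideanSpace.single ⟨0, hd⟩ 1 with he
  have hen : ‖e‖ = 1 := by simp [he]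
  set a := Real.sqrt (r ^ d / A) with ha
  have ha2 : a ^ 2 = r ^ d / A := Real.sq_sqrt (by positivity)
  -- The bump vanishes outside radius `2`, so before dilation centres at distance `4` separate the
  -- supports; `a² = r^d / A` normalizes in `L²`.
  set f : Fin n → Rd d → ℝ := fun k x => a * χ (r • x - (4 * (k : ℝ)) • e) with hf
  have hfs : ∀ k, ContDiff ℝ ∞ (f k) := fun k => by
    refine contDiff_const.mul (hχ.comp ?_)
    fun_prop
  have hfz : ∀ (k : Fin n) x, 2 ≤ ‖r • x - (4 * (k : ℝ)) • e‖ → f k x = 0 := fun k x hx => by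
    simp [hf, hχ0 _ hx]
  have hfR : ∀ (k : Fin n) x, (2 + 4 * n) / r < ‖x‖ → f k x = 0 := fun k x hx => by
    refine hfz k x ?_
    rw [div_lt_iff₀ hr] at hx
    have h1 := norm_sub_norm_le (r • x) ((4 * (k : ℝ)) • e)
    rw [norm_smul, norm_smul, hen, Real.norm_eq_abs, Real.norm_eq_abs, abs_of_pos hr,
      abs_of_nonneg (by positivity)] at h1
    have h2 : (k : ℝ) ≤ n := by exact_mod_cast k.2.le
    nlinarith
  have hfc : ∀ k, HasCompactSupport (f k) := fun k =>
    HasCompactSupport.intro (isCompact_closedBall (0 : Rd d) ((2 + 4 * n) / r)) fun x hx =>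
      hfR k x (by simpa using hx)
  have hdisj : ∀ k l, k ≠ l → ∀ x, f k x * f l x = 0 := by
    intro k l hkl x
    by_contra h
    have hk : ‖r • x - (4 * (k : ℝ)) • e‖ < 2 := by
      by_contra! h'; exact h (by rw [hfz k x h', zero_mul])
    have hl : ‖r • x - (4 * (l : ℝ)) • e‖ < 2 := by
      by_contra! h'; exact h (by rw [hfz l x h', mul_zero])
    have h1 := norm_sub_le (r • x - (4 * (k : ℝ)) • e) (r • x - (4 * (l : ℝ)) • e)
    rw [sub_sub_sub_cancel_left, ← sub_smul, norm_smul, hen, mul_one, ← mul_sub, norm_mul,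
      Real.norm_eq_abs, Real.norm_eq_abs] at h1
    have h2 : (1 : ℝ) ≤ |(l : ℝ) - k| := by
      have : (l : ℤ) - k ≠ 0 := by
        intro h0; apply hkl; ext; omega
      have := Int.one_le_abs this
      exact_mod_cast this
    rw [abs_of_pos (by norm_num : (0 : ℝ) < 4)] at h1
    linarith
  have hmem : ∀ k, MemLp (fun x => (f k x : ℂ)) 2 volume := fun k =>
    (Complex.continuous_ofReal.comp (hfs k).continuous).memLp_of_hasCompactSupport
      ((hfc k).comp_left Complex.ofReal_zero)
  set ψ : Fin n → L2Rd d := fun k => (hmem k).toLp with hψ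
  have hψe : ∀ k, ⇑(ψ k) =ᵐ[volume] fun x => (f k x : ℂ) := fun k => (hmem k).coeFn_toLp
  have hinner : ∀ k l, (inner ℂ (ψ k) (ψ l) : ℂ) = ((∫ x, f k x * f l x : ℝ) : ℂ) := by
    intro k l
    rw [L2.inner_def, ← integral_complex_ofReal]
    refine integral_congr_ae ?_
    filter_upwards [hψe k, hψe l] with x h1 h2
    rw [h1, h2, RCLike.inner_apply, Complex.conj_ofReal]
    push_cast; ring
  have horth : Orthonormal ℂ ψ := by
    rw [orthonormal_iff_ite]
    intro k l
    rw [hinner]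
    split_ifs with h
    · subst h
      have : ∀ x, f k x * f k x = a ^ 2 * (fun y => χ y ^ 2) (r • x - (4 * (k : ℝ)) • e) := fun x => by
        simp only [hf]; ring
      simp_rw [this]
      rw [integral_const_mul, integral_comp_smul_sub (fun y => χ y ^ 2) hr, ← hA, ha2]
      have : r ^ d / A * ((r ^ d)⁻¹ * A) = 1 := by field_simp
      rw [this]; simp
    · simp_rw [hdisj k l h]
      simp
  have hgm : ∀ k, MemLp (complexGradient (f k)) 2 volume := fun k =>
    (continuous_complexGradient (hfs k)).memLp_of_hasCompactSupport
      (hasCompactSupport_complexGradient (hfc k))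
  have hgw : ∀ k, IsWeakGradient (ψ k) (complexGradient (f k)) := fun k =>
    (isWeakGradient_complexGradient (hfs k) (hfc k)).congr_left (hψe k).symm
  have hgE : ∀ k, ∫ x, ‖complexGradient (f k) x‖ ^ 2 = r ^ 2 * (G / A) := by
    intro k
    have : ∀ x, ‖complexGradient (f k) x‖ ^ 2
        = (a ^ 2 * r ^ 2) * (fun y => ‖complexGradient χ y‖ ^ 2) (r • x - (4 * (k : ℝ)) • e) := fun x => by
      rw [hf, complexGradient_scale hχ, norm_smul, Complex.norm_real, mul_pow, Real.norm_eq_abs,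
        sq_abs]
      ring
    simp_rw [this]
    rw [integral_const_mul, integral_comp_smul_sub (fun y => ‖complexGradient χ y‖ ^ 2) hr, ← hG, ha2]
    field_simp
  refine ⟨Submodule.span ℂ (range ψ), ?_, fun φ hφ => ?_, (2 + 4 * n) / r, fun φ hφ => ?_⟩
  · rw [finrank_span_eq_card horth.linearIndependent, Fintype.card_fin]
  · obtain ⟨c, rfl⟩ := (Submodule.mem_span_range_iff_exists_fun ℂ).1 hφ
    have hn : ‖∑ k, c k • ψ k‖ ^ 2 = ∑ k, ‖c k‖ ^ 2 := by
      have h1 := horth.inner_sum c c Finset.univ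
      rw [inner_self_eq_norm_sq_to_K] at h1
      simp_rw [← Complex.normSq_eq_conj_mul_self, Complex.normSq_eq_norm_sq] at h1
      exact Complex.ofReal_injective (by push_cast at h1 ⊢; exact h1)
    rw [gradEnergy_eq_ofReal (memLp_sum_smul Finset.univ c hgm)
      (IsWeakGradient.sum_smul Finset.univ c hgm hgw), hn]
    refine ENNReal.ofReal_le_ofReal ?_
    have hI : ∀ k, Integrable fun x => ‖complexGradient (f k) x‖ ^ 2 := fun k =>
      (memLp_two_iff_integrable_sq_norm (hgm k).1).1 (hgm k)
    have hIs : Integrable fun x => ‖∑ k, c k • complexGradient (f k) x‖ ^ 2 :=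
      (memLp_two_iff_integrable_sq_norm (memLp_sum_smul Finset.univ c hgm).1).1
        (memLp_sum_smul Finset.univ c hgm)
    calc ∫ x, ‖∑ k, c k • complexGradient (f k) x‖ ^ 2
        ≤ ∫ x, n * ∑ k, ‖c k‖ ^ 2 * ‖complexGradient (f k) x‖ ^ 2 := by
          refine integral_mono hIs ((integrable_finsetSum _ fun k _ =>
            (hI k).const_mul _).const_mul _) fun x => ?_
          have h1 : ‖∑ k, c k • complexGradient (f k) x‖ ≤ ∑ k, ‖c k‖ * ‖complexGradient (f k) x‖ :=
            (norm_sum_le _ _).trans_eq (by simp_rw [norm_smul])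
          have h2 := sq_sum_le_card_mul_sum_sq (s := (Finset.univ : Finset (Fin n)))
            (f := fun k => ‖c k‖ * ‖complexGradient (f k) x‖)
          simp only [Finset.card_univ, Fintype.card_fin, mul_pow] at h2
          exact (pow_le_pow_left₀ (norm_nonneg _) h1 2).trans h2
      _ = n * (r ^ 2 * (G / A)) * ∑ k, ‖c k‖ ^ 2 := by
          rw [integral_const_mul, integral_finsetSum _ fun k _ => (hI k).const_mul _]
          simp_rw [integral_const_mul, hgE]
          rw [← Finset.sum_mul]; ring
      _ ≤ _ := mul_le_mul_of_nonneg_right hrε (Finset.sum_nonneg fun k _ => by positivity)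
  · obtain ⟨c, rfl⟩ := (Submodule.mem_span_range_iff_exists_fun ℂ).1 hφ
    filter_upwards [Lp_coeFn_sum_smul Finset.univ c ψ, ae_all_iff.2 hψe] with x h1 h2 hx
    rw [h1]
    refine Finset.sum_eq_zero fun k _ => ?_
    rw [h2 k, hfR k x hx]
    simp

end TestFunctions

/-! ### Admissible potentials, confinement and wells -/

section Admissible

variable {d : ℕ}

lemma schrodingerEnergy_le {V : Rd d → ℝ} (hVm : Measurable V) {c B ε : ℝ} (hc : ∀ᵐ x, c ≤ V x)
    {ψ : L2Rd d} (hε : 0 ≤ ε) (hψ : gradEnergy ψ ≤ ENNReal.ofReal ε)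
    (hB : ∀ᵐ x, V x * ‖ψ x‖ ^ 2 ≤ B * ‖ψ x‖ ^ 2) :
    schrodingerEnergy V ψ ≤ ((ε + B * ‖ψ‖ ^ 2 : ℝ) : EReal) := by
  obtain ⟨g, hgm, hg, hw⟩ := exists_weakGradient (ne_top_of_le_ne_top ENNReal.ofReal_ne_top hψ)
  have hsm : StronglyMeasurable ψ := Lp.stronglyMeasurable ψ
  have h0 := integrable_norm_sq ψ
  have hint : Integrable fun x => V x * ‖ψ x‖ ^ 2 := by
    refine (h0.const_mul (|c| + |B|)).mono'
      (hVm.aestronglyMeasurable.mul (hsm.norm.pow 2).aestronglyMeasurable) ?_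
    filter_upwards [hc, hB] with x h1 h2
    have h3 : c * ‖ψ x‖ ^ 2 ≤ V x * ‖ψ x‖ ^ 2 := mul_le_mul_of_nonneg_right h1 (by positivity)
    have h4 : 0 ≤ ‖ψ x‖ ^ 2 := by positivity
    rw [Real.norm_eq_abs, abs_le]
    constructor <;> nlinarith [neg_abs_le c, le_abs_self B, abs_nonneg c, abs_nonneg B]
  rw [schrodingerEnergy_eq hg hw hint, EReal.coe_le_coe_iff]
  rw [gradEnergy_eq_ofReal hg hw, ENNReal.ofReal_le_ofReal_iff hε] at hψ
  refine add_le_add hψ ?_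
  rw [← integral_norm_sq, ← integral_const_mul]
  exact integral_mono_ae hint (h0.const_mul B) hB

/-- Trial spaces of any dimension with Dirichlet quotient below `B' - B` give energies at most `B'`,
for each `B' > B`. This keeps the min-max values below a finite `b`. -/
lemma schrodingerEigenvalue_le_of_le (hd : 0 < d) {V : Rd d → ℝ} (hVm : Measurable V) {c B : ℝ}
    (hc : ∀ᵐ x, c ≤ V x) (hB : ∀ᵐ x, V x ≤ B) (j : ℕ) : schrodingerEigenvalue V j ≤ (B : EReal) := by
  refine EReal.le_of_forall_lt_iff_le.1 fun B' hB' => ?_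
  have hB'' : B < B' := by exact_mod_cast hB'
  obtain ⟨S, hS, hE, -⟩ := exists_subspace_gradEnergy_le hd (j + 1) (sub_pos.2 hB'')
  refine iInf₂_le_of_le S hS (iSup_le fun ψ => iSup_le fun hψS => iSup_le fun hψ => ?_)
  have h1 := hE ψ hψS
  rw [hψ, one_pow, mul_one] at h1
  have := schrodingerEnergy_le hVm hc (B := B) (sub_pos.2 hB'').le h1 (by
    filter_upwards [hB] with x hx
    exact mul_le_mul_of_nonneg_right hx (by positivity))
  rw [hψ, one_pow, mul_one, sub_add_cancel] at this
  exact this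

/-- A function supported in a large ball with Dirichlet integral at most `-s / 2` has energy at most
`-s / 2 + s` in a well of depth `s`. The radius does not depend on the potential outside. -/
lemma exists_schrodingerEigenvalue_zero_lt (hd : 0 < d) {s : ℝ} (hs : s < 0) :
    ∃ R : ℝ, ∀ V : Rd d → ℝ, Measurable V → (∃ c : ℝ, ∀ᵐ x, c ≤ V x) →
      (∀ x, ‖x‖ ≤ R → V x = s) → schrodingerEigenvalue V 0 ≤ ((s / 2 : ℝ) : EReal) := by
  obtain ⟨S, hS, hE, R, hR⟩ := exists_subspace_gradEnergy_le hd 1 (ε := -s / 2) (by linarith)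
  refine ⟨R, fun V hVm ⟨c, hc⟩ hV => ?_⟩
  refine iInf₂_le_of_le S hS (iSup_le fun ψ => iSup_le fun hψS => iSup_le fun hψ => ?_)
  have h1 := hE ψ hψS
  rw [hψ, one_pow, mul_one] at h1
  have := schrodingerEnergy_le hVm hc (B := s) (by linarith) h1 (by
    filter_upwards [hR ψ hψS] with x hx
    by_cases h : R < ‖x‖
    · simp [hx h]
    · rw [hV x (not_lt.1 h)])
  rw [hψ, one_pow, mul_one] at this
  refine this.trans_eq ?_
  congr 1; ring

/-- Measurable potentials with values in a compact part of `[c, b)` on bounded sets whose sublevel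
sets below `b` have finite measure are admissible. -/
theorem admissible_of_sublevel (hd : 0 < d) {b : EReal} (hb : b ≠ ⊥) {V : Rd d → ℝ}
    (hVm : Measurable V) {c : ℝ} (hc : ∀ x, c ≤ V x) (hbdd : ∀ R : ℝ, ∃ C, ∀ x, ‖x‖ ≤ R → V x ≤ C)
    (hVb : ∀ x, (V x : EReal) < b) (hM : ∀ M : ℝ, (M : EReal) < b → volume {x | V x < M} ≠ ⊤) :
    AdmissiblePotential b V ∧ ∀ j, schrodingerEigenvalue V j ≤ b := by
  have hc' : ∀ᵐ x, c ≤ V x := Eventually.of_forall hc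
  have hle : ∀ j, schrodingerEigenvalue V j ≤ b := by
    intro j
    induction b using EReal.rec with
    | bot => exact absurd rfl hb
    | top => exact le_top
    | coe B =>
      exact schrodingerEigenvalue_le_of_le hd hVm hc' (Eventually.of_forall fun x =>
        (by exact_mod_cast (hVb x).le : V x ≤ B)) j
  refine ⟨⟨?_, ⟨c, hc'⟩, ?_⟩, hle⟩
  · intro x
    refine ⟨Metric.ball x 1, Metric.ball_mem_nhds x one_pos, ?_⟩
    obtain ⟨C, hC⟩ := hbdd (‖x‖ + 1)
    refine Measure.integrableOn_of_bounded (M := max |c| |C|) measure_ball_lt_top.ne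
      hVm.aestronglyMeasurable ?_
    refine (ae_restrict_iff' measurableSet_ball).2 (Eventually.of_forall fun y hy => ?_)
    have h1 : ‖y‖ ≤ ‖x‖ + 1 := by
      have := norm_add_le x (y - x)
      rw [add_sub_cancel] at this
      rw [mem_ball_iff_norm] at hy
      linarith
    exact abs_le_max_abs_abs (hc y) (hC y h1)
  · refine tendsto_order.2 ⟨fun a ha => ?_, fun a ha => Eventually.of_forall fun j =>
      (hle j).trans_lt ha⟩
    obtain ⟨M', h1, h2⟩ := EReal.lt_iff_exists_real_btwn.1 ha
    obtain ⟨M, h3, h4⟩ := EReal.lt_iff_exists_real_btwn.1 h2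
    filter_upwards [eventually_le_schrodingerEigenvalue hVm hc' (by exact_mod_cast h3) (hM M h4)]
      with j hj
    exact h1.trans_le hj

/-- A potential tending to `b` at infinity for which `∫ Φ(τ)` is as small as desired. -/
theorem ConvexProfile.exists_confining {b : EReal} (hb : b ≠ ⊥) {Φ : ℝ → ℝ≥0∞}
    (hΦ : ConvexProfile b Φ) {s₀ : ℝ} (hs₀ : (s₀ : EReal) < b) {δ : ℝ} (hδ : 0 < δ) :
    ∃ τ : Rd d → ℝ, Measurable τ ∧ (∀ x, s₀ ≤ τ x) ∧
      (∀ x, τ x ∈ interior (finiteDomain b Φ)) ∧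
      (∀ M : ℝ, (M : EReal) < b → ∃ R : ℝ, ∀ x, R ≤ ‖x‖ → M ≤ τ x) ∧
      (∀ R : ℝ, ∃ C, ∀ x, ‖x‖ ≤ R → τ x ≤ C) ∧
      ∀ x, Φ (τ x) ≤ ENNReal.ofReal (δ * (1 + ‖x‖) ^ (-(d + 1 : ℝ))) := by
  have := belowFilter_neBot hb
  obtain ⟨u, hu⟩ := exists_seq_tendsto (belowFilter b)
  have hev : ∀ m : ℕ, ∀ᶠ k in atTop, u k ∈ interior (finiteDomain b Φ) ∧ s₀ ≤ u k ∧
      Φ (u k) ≤ ENNReal.ofReal (δ * (2 + m) ^ (-(d + 1 : ℝ))) := by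
    intro m
    have hpos : 0 < ENNReal.ofReal (δ * (2 + m) ^ (-(d + 1 : ℝ))) :=
      ENNReal.ofReal_pos.2 (by positivity)
    filter_upwards [hu.eventually (hΦ.eventually_mem hb),
      hu.eventually (eventually_gt_belowFilter hb hs₀),
      hu.eventually (hΦ.tendsto_zero.eventually_lt_const hpos)] with k h1 h2 h3
    exact ⟨h1, by exact_mod_cast h2.le, h3.le⟩
  -- The potential is the radial step function `u (φ ⌊‖x‖⌋₊)`. Since `1 + ‖x‖ ≤ 2 + ⌊‖x‖⌋₊`, the
  -- bound imposed on step `m` implies the required decay.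
  obtain ⟨φ, hφ, hφP⟩ := extraction_forall_of_eventually hev
  have hσ : Tendsto (u ∘ φ) atTop (belowFilter b) := hu.comp hφ.tendsto_atTop
  refine ⟨fun x => u (φ ⌊‖x‖⌋₊), ?_, fun x => (hφP _).2.1, fun x => (hφP _).1, fun M hM => ?_,
    fun R => ?_, fun x => (hφP _).2.2.trans ?_⟩
  · exact (measurable_of_countable (u ∘ φ)).comp (Nat.measurable_floor.comp measurable_norm)
  · have h1 := hσ.eventually (eventually_gt_belowFilter hb hM)
    obtain ⟨m₀, hm₀⟩ := eventually_atTop.1 h1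
    refine ⟨m₀, fun x hx => ?_⟩
    have := hm₀ ⌊‖x‖⌋₊ (Nat.le_floor hx)
    exact_mod_cast this.le
  · obtain ⟨C, hC⟩ := ((Finset.range (⌊R⌋₊ + 1)).image (u ∘ φ)).bddAbove
    refine ⟨C, fun x hx => hC ?_⟩
    simp only [Finset.coe_image, Function.comp_apply, Set.mem_image, Finset.mem_coe,
      Finset.mem_range]
    exact ⟨⌊‖x‖⌋₊, Nat.lt_succ_of_le (Nat.floor_le_floor hx), rfl⟩
  · refine ENNReal.ofReal_le_ofReal (mul_le_mul_of_nonneg_left ?_ hδ.le)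
    refine Real.rpow_le_rpow_of_nonpos (by positivity) ?_ (by
      have : (0 : ℝ) ≤ d := Nat.cast_nonneg d
      linarith)
    have := (Nat.lt_floor_add_one ‖x‖).le
    linarith

lemma integrable_weight : Integrable fun x : Rd d => (1 + ‖x‖) ^ (-(d + 1 : ℝ)) :=
  integrable_one_add_norm (by simp)

/-- If `G` is finite at some `s < 0 < b`, then `F` is finite at some negative number. -/
theorem exists_neg_mem_finiteDomain (hd : 0 < d) {b : EReal} (hb : 0 < b) {F G : ℝ → ℝ≥0∞}
    (hG : ConvexProfile b G)
    (hFG : ∀ V : Rd d → ℝ, AdmissiblePotential b V →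
      ∑' i, F (schrodingerEigenvalue V i).toReal ≤ ∫⁻ x, G (V x))
    {s : ℝ} (hs : s < 0) (hsG : s ∈ finiteDomain b G) : ∃ t < 0, t ∈ finiteDomain b F := by
  have hb' : b ≠ ⊥ := (bot_lt_iff_ne_bot.1 (bot_le.trans_lt hb))
  obtain ⟨R, hR⟩ := exists_schrodingerEigenvalue_zero_lt hd hs
  obtain ⟨τ, hτm, hτs, hτI, hτM, hτC, hτG⟩ :=
    hG.exists_confining (d := d) hb' hsG.1 one_pos
  -- A well of depth `s` inside a confining potential: `∫ G(V)` is finite while the lowest min-max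
  -- value is at most `s / 2`, so the hypothesis forces `F` to be finite there.
  set V : Rd d → ℝ := fun x => if ‖x‖ ≤ R then s else τ x with hV
  have hVm : Measurable V :=
    Measurable.ite (measurableSet_le measurable_norm measurable_const) measurable_const hτm
  have hVs : ∀ x, s ≤ V x := fun x => by
    simp only [hV]; split_ifs
    · exact le_rfl
    · exact hτs x
  obtain ⟨hVa, hVb⟩ := admissible_of_sublevel hd hb' hVm hVs
    (fun R' => by
      obtain ⟨C, hC⟩ := hτC R'
      refine ⟨max s C, fun x hx => ?_⟩
      simp only [hV]; split_ifs
      · exact le_max_left _ _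
      · exact (hC x hx).trans (le_max_right _ _))
    (fun x => by
      simp only [hV]; split_ifs
      · exact hsG.1
      · exact finiteDomain_lt (hτI x))
    (fun M hM => by
      obtain ⟨R', hR'⟩ := hτM M hM
      refine measure_ne_top_of_subset (s := Metric.ball (0 : Rd d) (max (R + 1) R'))
        (fun x hx => ?_) (measure_ball_lt_top (μ := volume)).ne
      rw [mem_ball_zero_iff]
      by_contra! h
      have h1 := (le_max_left _ _).trans h
      have h2 := hR' x ((le_max_right _ _).trans h)
      simp only [hV, mem_ofPred_eq, if_neg (by linarith : ¬ ‖x‖ ≤ R)] at hx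
      linarith)
  have h0 := hR V hVm ⟨s, Eventually.of_forall hVs⟩ (fun x hx => by simp [hV, hx])
  have hbot := schrodingerEigenvalue_ne_bot (Eventually.of_forall hVs) 0
  have hL := EReal.coe_toReal (ne_top_of_le_ne_top (EReal.coe_ne_top _) h0) hbot
  set t := (schrodingerEigenvalue V 0).toReal with ht
  rw [← hL] at h0
  have h1 : t < 0 := by
    have : t ≤ s / 2 := by exact_mod_cast h0
    linarith
  refine ⟨t, h1, lt_trans (by exact_mod_cast h1) hb, ?_⟩
  have hfin : ∫⁻ x, G (V x) ≠ ⊤ := by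
    have : ∀ x, G (V x) ≤ (Metric.closedBall (0 : Rd d) R).indicator (fun _ => G s) x
        + ENNReal.ofReal (1 * (1 + ‖x‖) ^ (-(d + 1 : ℝ))) := by
      intro x
      by_cases h : ‖x‖ ≤ R
      · rw [indicator_of_mem (by simpa using h)]
        simp only [hV, if_pos h]
        exact le_self_add
      · simp only [hV, if_neg h]
        exact (hτG x).trans le_add_self
    refine ne_top_of_le_ne_top ?_ (lintegral_mono this)
    rw [lintegral_add_left (measurable_const.indicator measurableSet_closedBall),
      lintegral_indicator measurableSet_closedBall, setLIntegral_const]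
    refine ENNReal.add_ne_top.2 ⟨ENNReal.mul_ne_top hsG.2 measure_closedBall_lt_top.ne, ?_⟩
    exact (integrable_weight.const_mul 1).lintegral_lt_top.ne
  exact ENNReal.ne_top_of_tsum_ne_top (ne_top_of_le_ne_top hfin (hFG V hVa)) 0

end Admissible

/-! ### The clamped minimizer and its bounds -/

section Clamp

variable {b : EReal} {Φ : ℝ → ℝ≥0∞}

/-- Fatou's lemma with a convergent additive term, which is subtracted before passing to the limit
and so has to be finite. -/
lemma lintegral_add_le_of_tendsto {α : Type*} [MeasurableSpace α] {μ : Measure α}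
    {f : ℕ → α → ℝ≥0∞} {f' : α → ℝ≥0∞} {c B : ℕ → ℝ≥0∞} {c' B' : ℝ≥0∞}
    (hf : ∀ n, AEMeasurable (f n) μ)
    (hlim : ∀ᵐ x ∂μ, Tendsto (fun n => f n x) atTop (𝓝 (f' x)))
    (hc : Tendsto c atTop (𝓝 c')) (hcn : ∀ n, c n ≠ ⊤) (hc' : c' ≠ ⊤)
    (hB : Tendsto B atTop (𝓝 B')) (h : ∀ n, ∫⁻ x, f n x ∂μ + c n ≤ B n) :
    ∫⁻ x, f' x ∂μ + c' ≤ B' := by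
  have h1 : c' ≤ B' := le_of_tendsto_of_tendsto' hc hB fun n => le_add_self.trans (h n)
  have h2 : ∫⁻ x, f' x ∂μ ≤ B' - c' := by
    calc ∫⁻ x, f' x ∂μ = ∫⁻ x, liminf (fun n => f n x) atTop ∂μ := by
          refine lintegral_congr_ae ?_
          filter_upwards [hlim] with x hx
          exact hx.liminf_eq.symm
      _ ≤ liminf (fun n => ∫⁻ x, f n x ∂μ) atTop := lintegral_liminf_le' hf
      _ ≤ liminf (fun n => B n - c n) atTop :=
          liminf_le_liminf (Eventually.of_forall fun n =>
            ENNReal.le_sub_of_add_le_right (hcn n) (h n))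
      _ = B' - c' := (ENNReal.Tendsto.sub hB hc (Or.inr hc')).liminf_eq
  calc ∫⁻ x, f' x ∂μ + c' ≤ B' - c' + c' := by gcongr
    _ = B' := tsub_add_cancel_of_le h1

lemma continuousOn_betaFun_open : ContinuousOn (betaFun b Φ) (openTransformDomain b Φ) := by
  rintro t ⟨h0, r, hr, htr⟩
  exact ((continuousOn_betaFun hr).continuousAt (Icc_mem_nhds h0 htr)).continuousWithinAt

lemma measurable_indicator_of_continuousOn {s : Set ℝ} (hs : IsOpen s) {f : ℝ → ℝ}
    (hf : ContinuousOn f s) : Measurable (s.indicator f) := by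
  classical
  rw [← piecewise_eq_indicator]
  exact hf.measurable_piecewise continuousOn_const hs.measurableSet

lemma measurable_indicator_betaFun :
    Measurable ((openTransformDomain b Φ).indicator (betaFun b Φ)) :=
  measurable_indicator_of_continuousOn isOpen_openTransformDomain continuousOn_betaFun_open

lemma indicator_betaFun_eq {r : ℝ} (hr : r = 0 ∨ r ∈ openTransformDomain b Φ) :
    (openTransformDomain b Φ).indicator (betaFun b Φ) r = betaFun b Φ r := by
  rcases hr with rfl | hr
  · rw [betaFun_zero, indicator_apply_eq_zero]
    exact fun _ => betaFun_zero
  · exact indicator_of_mem hr _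

open Classical in
/-- The minimizer of `Φ(s) + s r`, restricted to the interval `[s, t]`. -/
noncomputable def clampPoint (b : EReal) (Φ : ℝ → ℝ≥0∞) (s t r : ℝ) : ℝ :=
  if r ∈ openTransformDomain b Φ then
    max s (min ((openTransformDomain b Φ).indicator (legendrePoint b Φ) r) t) else t

lemma ConvexProfile.measurable_clampPoint (hΦ : ConvexProfile b Φ) {α : Type*} [MeasurableSpace α]
    (s : ℝ) {τ ρ : α → ℝ} (hτ : Measurable τ) (hρ : Measurable ρ) :
    Measurable fun x => clampPoint b Φ s (τ x) (ρ x) := by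
  refine Measurable.ite (isOpen_openTransformDomain.measurableSet.preimage hρ) ?_ hτ
  refine measurable_const.max (Measurable.min ?_ hτ)
  exact (measurable_indicator_of_continuousOn isOpen_openTransformDomain
    hΦ.continuousOn_legendrePoint).comp hρ

lemma clampPoint_cases {s t r : ℝ} (hst : s ≤ t) :
    (r ∉ openTransformDomain b Φ ∧ clampPoint b Φ s t r = t) ∨
    (r ∈ openTransformDomain b Φ ∧ legendrePoint b Φ r < s ∧ clampPoint b Φ s t r = s) ∨
    (r ∈ openTransformDomain b Φ ∧ s ≤ legendrePoint b Φ r ∧ legendrePoint b Φ r ≤ t ∧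
      clampPoint b Φ s t r = legendrePoint b Φ r) ∨
    (r ∈ openTransformDomain b Φ ∧ s ≤ legendrePoint b Φ r ∧ t < legendrePoint b Φ r ∧
      clampPoint b Φ s t r = t) := by
  by_cases hr : r ∈ openTransformDomain b Φ
  · simp only [clampPoint, if_pos hr, indicator_of_mem hr]
    rcases lt_or_ge (legendrePoint b Φ r) s with h | h
    · refine Or.inr (Or.inl ⟨hr, h, ?_⟩)
      rw [min_eq_left (h.le.trans hst), max_eq_left h.le]
    rcases le_or_gt (legendrePoint b Φ r) t with h' | h'
    · refine Or.inr (Or.inr (Or.inl ⟨hr, h, h', ?_⟩))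
      rw [min_eq_left h', max_eq_right h]
    · refine Or.inr (Or.inr (Or.inr ⟨hr, h, h', ?_⟩))
      rw [min_eq_right h'.le, max_eq_right hst]
  · exact Or.inl ⟨hr, by simp [clampPoint, hr]⟩

lemma clampPoint_mem {s t r : ℝ} (hst : s ≤ t) (hs : s ∈ interior (finiteDomain b Φ))
    (ht : t ∈ interior (finiteDomain b Φ)) :
    clampPoint b Φ s t r ∈ interior (finiteDomain b Φ) := by
  rcases clampPoint_cases (b := b) (Φ := Φ) (r := r) hst with ⟨-, h⟩ | ⟨-, -, h⟩ | ⟨hr, -, -, h⟩ |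
    ⟨-, -, -, h⟩ <;> rw [h]
  · exact ht
  · exact hs
  · exact legendrePoint_mem hr
  · exact ht

lemma le_clampPoint {s t r : ℝ} (hst : s ≤ t) : s ≤ clampPoint b Φ s t r := by
  rcases clampPoint_cases (b := b) (Φ := Φ) (r := r) hst with ⟨-, h⟩ | ⟨-, -, h⟩ | ⟨hr, h', -, h⟩ |
    ⟨-, -, -, h⟩ <;> rw [h]
  · exact hst
  · exact h'
  · exact hst

lemma clampPoint_le {s t r : ℝ} (hst : s ≤ t) : clampPoint b Φ s t r ≤ t := by
  rcases clampPoint_cases (b := b) (Φ := Φ) (r := r) hst with ⟨-, h⟩ | ⟨-, -, h⟩ | ⟨hr, -, h', h⟩ |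
    ⟨-, -, -, h⟩ <;> rw [h]
  · exact hst
  · exact h'

/-- If the minimizer of `Φ(s) + s r` lies to the left of `u`, then `r ≥ -Φ'(u)`. -/
lemma ConvexProfile.neg_deriv_le (hΦ : ConvexProfile b Φ) {u r : ℝ}
    (hu : u ∈ interior (finiteDomain b Φ)) (hr : r ∈ openTransformDomain b Φ)
    (h : legendrePoint b Φ r ≤ u) : -profileDeriv Φ u ≤ r := by
  obtain ⟨h1, h2⟩ := legendrePoint_spec hr
  have := hΦ.monotoneOn_deriv h1 hu h
  linarith

/-- The value `Φ(v) + v r` at the restricted minimizer `v`. -/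
noncomputable def clampValue (b : EReal) (Φ : ℝ → ℝ≥0∞) (s t r : ℝ) : ℝ :=
  (Φ (clampPoint b Φ s t r)).toReal + clampPoint b Φ s t r * r

lemma ConvexProfile.neg_betaFun_le_clampValue (hΦ : ConvexProfile b Φ) (hb : b ≠ ⊥) {s t r : ℝ}
    (hst : s ≤ t) (hs : s ∈ interior (finiteDomain b Φ)) (ht : t ∈ interior (finiteDomain b Φ))
    (hr : r = 0 ∨ r ∈ openTransformDomain b Φ) : -betaFun b Φ r ≤ clampValue b Φ s t r := by
  have hr' : r ∈ transformDomain b Φ := by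
    rcases hr with rfl | hr
    · exact zero_mem_transformDomain
    · exact openTransformDomain_subset hr
  have := hΦ.le_betaFun hb hr' (interior_subset (clampPoint_mem (r := r) hst hs ht))
  rw [clampValue, mul_comm]
  linarith

/-- When the lower cutoff is inactive, clamping costs at most `Φ(t)`: if the minimizer `u` exceeds
`t`, then `t r ≤ u r`. At `r = 0` the clamped point is `t` and `β(0) = 0`. -/
lemma ConvexProfile.clampValue_le (hΦ : ConvexProfile b Φ) (hb : b ≠ ⊥) {s t r : ℝ}
    (hst : s ≤ t)
    (hr : r = 0 ∨ (r ∈ openTransformDomain b Φ ∧ s ≤ legendrePoint b Φ r)) :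
    clampValue b Φ s t r ≤ (Φ t).toReal - betaFun b Φ r := by
  have h0 : 0 ≤ (Φ t).toReal := ENNReal.toReal_nonneg
  rcases hr with rfl | ⟨hr, hrs⟩
  · have : (0 : ℝ) ∉ openTransformDomain b Φ := fun h => lt_irrefl _ h.1
    simp [clampValue, clampPoint, this, betaFun_zero]
  · have hβ := hΦ.betaFun_eq hb hr
    rcases clampPoint_cases (b := b) (Φ := Φ) (r := r) hst with ⟨h, -⟩ | ⟨-, h, -⟩ | ⟨-, -, -, h⟩ |
      ⟨-, -, h', h⟩
    · exact absurd hr h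
    · exact absurd h (not_lt.2 hrs)
    · rw [clampValue, h]; linarith
    · rw [clampValue, h]
      have h1 : 0 ≤ (Φ (legendrePoint b Φ r)).toReal := ENNReal.toReal_nonneg
      nlinarith [hr.1]

/-- To the right of its minimizer the convex function `v ↦ Φ(v) + v r` increases, so its value at
the cutoff `s` is at most that at `s₀ ≥ s`. -/
lemma ConvexProfile.clampValue_le_of_lt (hΦ : ConvexProfile b Φ) {s s₀ t r : ℝ}
    (hst : s ≤ t) (hs : s ∈ interior (finiteDomain b Φ)) (hs₀ : s₀ ∈ interior (finiteDomain b Φ))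
    (hss : s ≤ s₀) (hr : r ∈ openTransformDomain b Φ) (hrs : legendrePoint b Φ r < s) :
    clampValue b Φ s t r ≤ (Φ s₀).toReal + s₀ * r := by
  have hc : clampPoint b Φ s t r = s := by
    rcases clampPoint_cases (b := b) (Φ := Φ) (r := r) hst with ⟨h, -⟩ | ⟨-, -, h⟩ | ⟨-, h, -, -⟩ |
      ⟨-, h, -, -⟩
    · exact absurd hr h
    · exact h
    · exact absurd hrs (not_lt.2 h)
    · exact absurd hrs (not_lt.2 h)
  rw [clampValue, hc]
  have h1 := hΦ.subgradient hs (interior_subset hs₀)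
  obtain ⟨h2, h3⟩ := legendrePoint_spec hr
  have h4 := hΦ.monotoneOn_deriv h2 hs hrs.le
  rw [h3] at h4
  nlinarith

/-- A bound for `clampValue` that is uniform in `s ≤ s₀`. -/
lemma ConvexProfile.clampValue_le_bound (hΦ : ConvexProfile b Φ) (hb : b ≠ ⊥) {s s₀ t r : ℝ}
    (hst : s ≤ t) (hs : s ∈ interior (finiteDomain b Φ)) (hs₀ : s₀ ∈ interior (finiteDomain b Φ))
    (hss : s ≤ s₀) (hr : r = 0 ∨ r ∈ openTransformDomain b Φ) :
    clampValue b Φ s t r ≤ (Φ t).toReal + (max (-betaFun b Φ r) 0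
      + {r | -profileDeriv Φ s₀ ≤ r}.indicator (fun r => (Φ s₀).toReal + |s₀| * r) r) := by
  have h0 : 0 ≤ (Φ t).toReal := ENNReal.toReal_nonneg
  have hr0 : 0 ≤ r := by
    rcases hr with rfl | hr
    · exact le_rfl
    · exact hr.1.le
  have hi : 0 ≤ {r | -profileDeriv Φ s₀ ≤ r}.indicator (fun r => (Φ s₀).toReal + |s₀| * r) r := by
    refine indicator_apply_nonneg fun _ => add_nonneg ENNReal.toReal_nonneg (by positivity)
  by_cases h : r ∈ openTransformDomain b Φ ∧ legendrePoint b Φ r < s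
  · have h1 := hΦ.clampValue_le_of_lt hst hs hs₀ hss h.1 h.2
    rw [indicator_of_mem (by exact hΦ.neg_deriv_le hs₀ h.1 (h.2.le.trans hss))]
    have h2 : s₀ * r ≤ |s₀| * r := mul_le_mul_of_nonneg_right (le_abs_self _) hr0
    have h3 := le_max_right (-betaFun b Φ r) 0
    linarith
  · have h1 := hΦ.clampValue_le hb hst (r := r) (hr.imp_right fun hr => ⟨hr, by
      by_contra! h'; exact h ⟨hr, h'⟩⟩)
    have h3 := le_max_left (-betaFun b Φ r) 0
    linarith

/-- There is a sequence which is eventually smaller than each element of the interior of the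
finiteness domain. -/
lemma exists_coinitial_seq {I : Set ℝ} (hI : IsOpen I) {s₀ : ℝ} (hs₀ : s₀ ∈ I) :
    ∃ s : ℕ → ℝ, (∀ k, s k ∈ I) ∧ (∀ k, s k ≤ s₀) ∧ ∀ u ∈ I, ∀ᶠ k in atTop, s k ≤ u := by
  classical
  obtain ⟨q, hq⟩ := exists_surjective_nat ℚ
  set r : ℕ → ℝ := fun n => if (q n : ℝ) ∈ I then (q n : ℝ) else s₀ with hr
  have hrI : ∀ n, r n ∈ I := fun n => by
    simp only [hr]; split_ifs with h
    · exact h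
    · exact hs₀
  set s : ℕ → ℝ := fun n => Nat.rec s₀ (fun k x => min x (r k)) n with hs
  have hsucc : ∀ k, s (k + 1) = min (s k) (r k) := fun k => rfl
  have hanti : Antitone s := antitone_nat_of_succ_le fun k => by rw [hsucc]; exact min_le_left _ _
  refine ⟨s, fun k => ?_, fun k => hanti (Nat.zero_le k), fun u hu => ?_⟩
  · induction k with
    | zero => exact hs₀
    | succ k ih =>
      rw [hsucc]
      rcases min_choice (s k) (r k) with h | h <;> rw [h]
      · exact ih
      · exact hrI k
  -- An open set containing `u` has a rational to the left of `u`; the running minimum over the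
  -- enumerated rationals of `I` is at most it from some index on.
  · have hev : ∀ᶠ x in 𝓝[<] u, x ∈ I ∧ x ∈ Iio u :=
      Filter.Eventually.and (nhdsWithin_le_nhds (hI.mem_nhds hu)) self_mem_nhdsWithin
    obtain ⟨l, hl, hlI⟩ := (mem_nhdsLT_iff_exists_Ioo_subset).1 hev
    obtain ⟨p, hp1, hp2⟩ := exists_rat_btwn (mem_Iio.1 hl)
    obtain ⟨n, rfl⟩ := hq p
    have hpI : (q n : ℝ) ∈ I := (hlI ⟨hp1, hp2⟩).1
    filter_upwards [eventually_ge_atTop (n + 1)] with k hk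
    refine (hanti hk).trans ?_
    rw [hsucc]
    refine (min_le_right _ _).trans ?_
    simp only [hr, if_pos hpI]
    exact hp2.le

end Clamp

/-! ### The dual inequality for finite families -/

section FiniteFamily

variable {d : ℕ}

lemma ConvexProfile.measurable_toReal_comp {b : EReal} {Φ : ℝ → ℝ≥0∞} (hΦ : ConvexProfile b Φ)
    {α : Type*} [MeasurableSpace α] {V : α → ℝ} (hV : Measurable V)
    (hVI : ∀ x, V x ∈ interior (finiteDomain b Φ)) : Measurable fun x => (Φ (V x)).toReal := by
  have e : (fun x => (Φ (V x)).toReal) =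
      (interior (finiteDomain b Φ)).indicator (fun s => (Φ s).toReal) ∘ V := by
    ext x
    exact (indicator_of_mem (hVI x) fun s => (Φ s).toReal).symm
  rw [e]
  exact (measurable_indicator_of_continuousOn isOpen_interior hΦ.contDiffOn.continuousOn).comp hV

/-- The density of a finite family, as a real function. -/
noncomputable def finDensity {ι : Type*} [Fintype ι] (ν : ι → ℝ) (ψ : ι → L2Rd d) (x : Rd d) : ℝ :=
  ∑ i, ν i * ‖ψ i x‖ ^ 2

variable {ι : Type*} [Fintype ι]

lemma measurable_finDensity (ν : ι → ℝ) (ψ : ι → L2Rd d) : Measurable (finDensity ν ψ) :=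
  Finset.measurable_fun_sum _ fun i _ =>
    ((Lp.stronglyMeasurable (ψ i)).measurable.norm.pow_const 2).const_mul _

lemma integrable_finDensity (ν : ι → ℝ) (ψ : ι → L2Rd d) : Integrable (finDensity ν ψ) :=
  integrable_finsetSum _ fun i _ => (integrable_norm_sq (ψ i)).const_mul _

/-- Weak duality combined with the hypothesis for the potential `V`. Positivity of the `ν_i` gives
integrability of each `V|ψ_i|²` from that of `V ρ`, since `ν_i |ψ_i|² ≤ ρ`. -/
lemma neg_energy_le_integral {b : EReal} (hb : b ≠ ⊥) {F G : ℝ → ℝ≥0∞} (hF : ConvexProfile b F)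
    (hFG : ∀ V : Rd d → ℝ, AdmissiblePotential b V →
      ∑' i, F (schrodingerEigenvalue V i).toReal ≤ ∫⁻ x, G (V x))
    {ψ : ι → L2Rd d} (hψ : Orthonormal ℂ ψ)
    {g : ι → Rd d → EuclideanSpace ℂ (Fin d)} (hg : ∀ i, MemLp (g i) 2 volume)
    (hw : ∀ i, IsWeakGradient (ψ i) (g i)) {ν : ι → ℝ} (hν0 : ∀ i, 0 < ν i)
    (hν : ∀ i, ν i ∈ transformDomain b F)
    {V : Rd d → ℝ} (hVm : Measurable V) (hVa : AdmissiblePotential b V)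
    (hle : ∀ j, schrodingerEigenvalue V j ≤ b) (hVI : ∀ x, V x ∈ interior (finiteDomain b G))
    (hGV : Integrable fun x => (G (V x)).toReal)
    (hVρ : Integrable fun x => V x * finDensity ν ψ x) :
    -(∑ i, ν i * (∫ x, ‖g i x‖ ^ 2) + ∑ i, betaFun b F (ν i))
      ≤ ∫ x, ((G (V x)).toReal + V x * finDensity ν ψ x) := by
  have hV : ∀ i, Integrable fun x => V x * ‖ψ i x‖ ^ 2 := by
    intro i
    have hm : AEStronglyMeasurable (fun x => V x * ‖ψ i x‖ ^ 2) volume :=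
      (hVm.mul ((Lp.stronglyMeasurable (ψ i)).measurable.norm.pow_const 2)).aestronglyMeasurable
    refine (hVρ.norm.const_mul (ν i)⁻¹).mono' hm (Eventually.of_forall fun x => ?_)
    rw [norm_mul, norm_mul, mul_left_comm]
    refine mul_le_mul_of_nonneg_left ?_ (norm_nonneg _)
    have h1 : ν i * ‖ψ i x‖ ^ 2 ≤ finDensity ν ψ x :=
      Finset.single_le_sum (f := fun i => ν i * ‖ψ i x‖ ^ 2)
        (fun j _ => mul_nonneg (hν0 j).le (by positivity)) (Finset.mem_univ i)
    rw [norm_pow, norm_norm, ← div_eq_inv_mul, le_div_iff₀ (hν0 i), mul_comm]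
    exact h1.trans (le_abs_self _)
  obtain ⟨c, hc⟩ := hVa.bounded_below
  have hGl : ∫⁻ x, G (V x) = ENNReal.ofReal (∫ x, (G (V x)).toReal) := by
    rw [ofReal_integral_eq_lintegral_ofReal hGV (Eventually.of_forall fun x => ENNReal.toReal_nonneg)]
    exact lintegral_congr fun x => (finiteDomain_ofReal (hVI x)).symm
  have hF' := hFG V hVa
  rw [hGl] at hF'
  have h1 := neg_tsum_le_energy hb hF hψ hg hw hVm hV hc hle hν
    (ne_top_of_le_ne_top ENNReal.ofReal_ne_top hF')
  have h2 := ENNReal.toReal_mono ENNReal.ofReal_ne_top hF'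
  rw [ENNReal.toReal_ofReal (integral_nonneg fun x => ENNReal.toReal_nonneg)] at h2
  rw [integral_add hGV hVρ]
  have h3 : ∫ x, V x * finDensity ν ψ x = ∑ i, ν i * ∫ x, V x * ‖ψ i x‖ ^ 2 := by
    simp_rw [finDensity, Finset.mul_sum, ← integral_const_mul]
    rw [← integral_finsetSum _ fun i _ => (hV i).const_mul _]
    refine integral_congr_ae (Eventually.of_forall fun x => ?_)
    exact Finset.sum_congr rfl fun i _ => by ring
  simp_rw [mul_add] at h1
  rw [Finset.sum_add_distrib] at h1
  rw [h3]
  linarith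

/-- Passes from real numbers to positive and negative parts, the form in which Fatou and dominated
convergence can act on each side separately. -/
lemma ennreal_rearrange {α : Type*} [MeasurableSpace α] {μ : Measure α} {f : α → ℝ}
    (hf : Integrable f μ) {K : ℝ} (hK : 0 ≤ K) {β : ι → ℝ}
    (h : -(K + ∑ i, β i) ≤ ∫ x, f x ∂μ) :
    ∫⁻ x, ENNReal.ofReal (-f x) ∂μ + ∑ i, ENNReal.ofReal (-β i)
      ≤ ENNReal.ofReal K + ∑ i, ENNReal.ofReal (β i) + ∫⁻ x, ENNReal.ofReal (f x) ∂μ := by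
  have h1 : ∫⁻ x, ENNReal.ofReal (f x) ∂μ ≠ ⊤ := hf.lintegral_lt_top.ne
  have h2 : ∫⁻ x, ENNReal.ofReal (-f x) ∂μ ≠ ⊤ := hf.neg.lintegral_lt_top.ne
  have h3 : ∀ i ∈ (Finset.univ : Finset ι), ENNReal.ofReal (β i) ≠ ⊤ := fun i _ => ENNReal.ofReal_ne_top
  have h4 : ∀ i ∈ (Finset.univ : Finset ι), ENNReal.ofReal (-β i) ≠ ⊤ := fun i _ => ENNReal.ofReal_ne_top
  have h5 := ENNReal.sum_ne_top.2 h3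
  have h6 := ENNReal.sum_ne_top.2 h4
  rw [← ENNReal.toReal_le_toReal (ENNReal.add_ne_top.2 ⟨h2, h6⟩)
    (ENNReal.add_ne_top.2 ⟨ENNReal.add_ne_top.2 ⟨ENNReal.ofReal_ne_top, h5⟩, h1⟩),
    ENNReal.toReal_add h2 h6, ENNReal.toReal_add (ENNReal.add_ne_top.2 ⟨ENNReal.ofReal_ne_top, h5⟩) h1,
    ENNReal.toReal_add ENNReal.ofReal_ne_top h5, ENNReal.toReal_sum h3, ENNReal.toReal_sum h4,
    ENNReal.toReal_ofReal hK]
  rw [integral_eq_lintegral_pos_part_sub_lintegral_neg_part hf] at h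
  have h7 : ∑ i, β i = ∑ i, (ENNReal.ofReal (β i)).toReal - ∑ i, (ENNReal.ofReal (-β i)).toReal := by
    rw [← Finset.sum_sub_distrib]
    refine Finset.sum_congr rfl fun i _ => ?_
    simp only [ENNReal.toReal_ofReal']
    rcases le_total (β i) 0 with h | h
    · rw [max_eq_right h, max_eq_left (by linarith)]; ring
    · rw [max_eq_left h, max_eq_right (by linarith)]; ring
  linarith

/-- The dual inequality for a finite family whose density has values in the interior of the domain
of the transform. -/
theorem finite_family_inequality (hd : 0 < d) {b : EReal} (hb : b ≠ ⊥) {F G : ℝ → ℝ≥0∞}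
    (hF : ConvexProfile b F) (hG : ConvexProfile b G)
    (hFG : ∀ V : Rd d → ℝ, AdmissiblePotential b V →
      ∑' i, F (schrodingerEigenvalue V i).toReal ≤ ∫⁻ x, G (V x))
    {ψ : ι → L2Rd d} (hψ : Orthonormal ℂ ψ) (hfin : ∀ i, gradEnergy (ψ i) ≠ ⊤)
    {ν : ι → ℝ} (hν0 : ∀ i, 0 < ν i) (hν : ∀ i, ν i ∈ transformDomain b F)
    (hρ : ∀ᵐ x, finDensity ν ψ x = 0 ∨ finDensity ν ψ x ∈ openTransformDomain b G) :
    (∫⁻ x, ENNReal.ofReal (betaFun b G (finDensity ν ψ x)))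
        + ∑ i, ENNReal.ofReal (-betaFun b F (ν i))
      ≤ ∑ i, ENNReal.ofReal (ν i) * gradEnergy (ψ i) + ∑ i, ENNReal.ofReal (betaFun b F (ν i))
        + ∫⁻ x, ENNReal.ofReal (-betaFun b G (finDensity ν ψ x)) := by
  by_cases hHfin : ∫⁻ x, ENNReal.ofReal (-betaFun b G (finDensity ν ψ x)) = ⊤
  · rw [hHfin, add_top]; exact le_top
  choose g hgm hg hw using fun i => exists_weakGradient (hfin i)
  set ρ := finDensity ν ψ with hρdef
  have hρm : Measurable ρ := measurable_finDensity ν ψ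
  have hρi : Integrable ρ := integrable_finDensity ν ψ
  have hρ0 : ∀ x, 0 ≤ ρ x := fun x =>
    Finset.sum_nonneg fun i _ => mul_nonneg (hν0 i).le (by positivity)
  have hgnn : ∀ i, 0 ≤ ∫ x, ‖g i x‖ ^ 2 := fun i => integral_nonneg fun x => by positivity
  set K := ∑ i, ν i * ∫ x, ‖g i x‖ ^ 2 with hK
  have hK0 : 0 ≤ K := Finset.sum_nonneg fun i _ => mul_nonneg (hν0 i).le (hgnn i)
  have hKe : ∑ i, ENNReal.ofReal (ν i) * gradEnergy (ψ i) = ENNReal.ofReal K := by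
    rw [hK, ENNReal.ofReal_sum_of_nonneg fun i _ => mul_nonneg (hν0 i).le (hgnn i)]
    refine Finset.sum_congr rfl fun i _ => ?_
    rw [ENNReal.ofReal_mul (hν0 i).le, gradEnergy_eq_ofReal (hg i) (hw i)]
  rw [hKe]
  set I := interior (finiteDomain b G) with hI
  have hne := belowFilter_neBot hb
  obtain ⟨s₀, hs₀⟩ := (hG.eventually_mem hb).exists
  obtain ⟨s, hsI, hss, hsev⟩ := exists_coinitial_seq isOpen_interior hs₀
  have hδ : ∀ k : ℕ, (0 : ℝ) < 1 / ((k : ℝ) + 1) := fun k => by positivity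
  choose τ hτm hτs hτI hτM hτC hτG using fun k =>
    hG.exists_confining (d := d) hb (finiteDomain_lt (hsI k)) (hδ k)
  set w : Rd d → ℝ := fun x => (1 + ‖x‖) ^ (-(d + 1 : ℝ)) with hwdef
  have hw0 : ∀ x, 0 ≤ w x := fun x => Real.rpow_nonneg (by positivity) _
  have hwi : Integrable w := integrable_weight
  have hτG' : ∀ k x, (G (τ k x)).toReal ≤ 1 / ((k : ℝ) + 1) * w x := fun k x =>
    ENNReal.toReal_le_of_le_ofReal (mul_nonneg (hδ k).le (hw0 x)) (hτG k x)
  have hδ1 : ∀ k : ℕ, 1 / ((k : ℝ) + 1) ≤ 1 := fun k => by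
    rw [div_le_one (by positivity)]; linarith [(Nat.cast_nonneg k : (0 : ℝ) ≤ k)]
  have hτw : ∀ k x, (G (τ k x)).toReal ≤ w x := fun k x =>
    (hτG' k x).trans (mul_le_of_le_one_left (hw0 x) (hδ1 k))
  -- The lower cutoff can act only where `ρ ≥ κ`. As `κ > 0`, a constant on this set is at most a
  -- multiple of the integrable `ρ`, which makes `D2` integrable.
  set κ := -profileDeriv G s₀ with hκ
  have hκ0 : 0 < κ := neg_pos.2 (hG.deriv_neg hb hs₀)
  set D1 : Rd d → ℝ := fun x => max (-betaFun b G (ρ x)) 0 with hD1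
  set D2 : Rd d → ℝ := fun x =>
    {r | κ ≤ r}.indicator (fun r => (G s₀).toReal + |s₀| * r) (ρ x) with hD2
  have hD10 : ∀ x, 0 ≤ D1 x := fun x => le_max_right _ _
  have hD20 : ∀ x, 0 ≤ D2 x := fun x =>
    indicator_apply_nonneg fun _ => add_nonneg ENNReal.toReal_nonneg
      (mul_nonneg (abs_nonneg _) (hρ0 x))
  have hHm : AEMeasurable (fun x => betaFun b G (ρ x)) := by
    refine ⟨(openTransformDomain b G).indicator (betaFun b G) ∘ ρ,
      measurable_indicator_betaFun.comp hρm, ?_⟩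
    filter_upwards [hρ] with x hx
    exact (indicator_betaFun_eq hx).symm
  have hD1i : Integrable D1 := by
    refine ⟨(hHm.neg.max aemeasurable_const).aestronglyMeasurable, ?_⟩
    rw [hasFiniteIntegral_iff_ofReal (Eventually.of_forall hD10)]
    refine lt_of_le_of_lt (lintegral_mono fun x => ?_) (lt_top_iff_ne_top.2 hHfin)
    simp [hD1]
  have hD2m : Measurable D2 :=
    (Measurable.indicator (by fun_prop) measurableSet_Ici).comp hρm
  have hD2i : Integrable D2 := by
    refine (hρi.const_mul ((G s₀).toReal / κ + |s₀|)).mono' hD2m.aestronglyMeasurable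
      (Eventually.of_forall fun x => ?_)
    rw [Real.norm_eq_abs, abs_of_nonneg (hD20 x)]
    simp only [hD2]
    have h0 : 0 ≤ (G s₀).toReal := ENNReal.toReal_nonneg
    by_cases h : κ ≤ ρ x
    · rw [indicator_of_mem (by exact h), add_mul]
      have : (G s₀).toReal ≤ (G s₀).toReal / κ * ρ x := by
        rw [div_mul_eq_mul_div, le_div_iff₀ hκ0]
        exact mul_le_mul_of_nonneg_left h h0
      linarith
    · rw [indicator_of_notMem (by exact h)]
      exact mul_nonneg (by positivity) (hρ0 x)
  set V : ℕ → Rd d → ℝ := fun k x => clampPoint b G (s k) (τ k x) (ρ x) with hV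
  set f : ℕ → Rd d → ℝ := fun k x => clampValue b G (s k) (τ k x) (ρ x) with hf
  have hfV : ∀ k x, f k x = (G (V k x)).toReal + V k x * ρ x := fun k x => rfl
  have hVm : ∀ k, Measurable (V k) := fun k => hG.measurable_clampPoint (s k) (hτm k) hρm
  have hVI : ∀ k x, V k x ∈ I := fun k x => clampPoint_mem (hτs k x) (hsI k) (hτI k x)
  have hVs : ∀ k x, s k ≤ V k x := fun k x => le_clampPoint (hτs k x)
  have hVτ : ∀ k x, V k x ≤ τ k x := fun k x => clampPoint_le (hτs k x)
  have hGVm : ∀ k, Measurable fun x => (G (V k x)).toReal := fun k =>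
    hG.measurable_toReal_comp (hVm k) (hVI k)
  have hfm : ∀ k, Measurable (f k) := fun k => (hGVm k).add ((hVm k).mul hρm)
  have hVadm : ∀ k, AdmissiblePotential b (V k) ∧ ∀ j, schrodingerEigenvalue (V k) j ≤ b := by
    intro k
    refine admissible_of_sublevel hd hb (hVm k) (hVs k) (fun R => ?_)
      (fun x => finiteDomain_lt (hVI k x)) (fun M hM => ?_)
    · obtain ⟨C, hC⟩ := hτC k R
      exact ⟨C, fun x hx => (hVτ k x).trans (hC x hx)⟩
    · obtain ⟨R, hR⟩ := hτM k M hM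
      obtain ⟨u, hu, hMu⟩ := ((hG.eventually_mem hb).and (eventually_gt_belowFilter hb hM)).exists
      have hMu' : M < u := by exact_mod_cast hMu
      have hu0 : 0 < -profileDeriv G u := neg_pos.2 (hG.deriv_neg hb hu)
      -- Far out `τ_k ≥ M`, so `V_k < M` only if the minimizer lies to the left of `u > M`, that is
      -- `ρ ≥ -G'(u) > 0`; Chebyshev's inequality makes this set finite in measure.
      refine measure_ne_top_of_subset
        (s := Metric.ball (0 : Rd d) R ∪ {x | -profileDeriv G u ≤ ρ x}) (fun x hx => ?_)
        (measure_union_lt_top measure_ball_lt_top (hρi.measure_ge_lt_top hu0)).ne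
      have hx' : V k x < M := hx
      by_contra hn
      simp only [mem_union, mem_ball_zero_iff, mem_ofPred_eq, not_or, not_lt, not_le] at hn
      have h1 := hR x hn.1
      rcases clampPoint_cases (b := b) (Φ := G) (r := ρ x) (hτs k x) with ⟨-, h⟩ | ⟨hr, h2, h⟩ |
        ⟨hr, -, -, h⟩ | ⟨-, -, -, h⟩
      · have : V k x = τ k x := h
        linarith
      · have : V k x = s k := h
        have := hG.neg_deriv_le hu hr (by linarith)
        linarith [hn.2]
      · have : V k x = legendrePoint b G (ρ x) := h
        have := hG.neg_deriv_le hu hr (by linarith)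
        linarith [hn.2]
      · have : V k x = τ k x := h
        linarith
  have hlow : ∀ k, ∀ᵐ x, -betaFun b G (ρ x) ≤ f k x := fun k => by
    filter_upwards [hρ] with x hx
    exact hG.neg_betaFun_le_clampValue hb (hτs k x) (hsI k) (hτI k x) hx
  have hup : ∀ k, ∀ᵐ x, f k x ≤ w x + (D1 x + D2 x) := fun k => by
    filter_upwards [hρ] with x hx
    exact (hG.clampValue_le_bound hb (hτs k x) (hsI k) hs₀ (hss k) hx).trans
      (add_le_add (hτw k x) le_rfl)
  have hBi : Integrable fun x => w x + (D1 x + D2 x) := hwi.add (hD1i.add hD2i)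
  -- Above, `V_k ρ ≤ f_k` because `G ≥ 0`, and `f_k` has the integrable majorant; below, `V_k ρ ≥
  -- s_k ρ`.
  have hVρi : ∀ k, Integrable fun x => V k x * ρ x := fun k => by
    refine (hBi.add (hρi.const_mul |s k|)).mono' ((hVm k).mul hρm).aestronglyMeasurable ?_
    filter_upwards [hup k] with x hx
    have h1 : 0 ≤ (G (V k x)).toReal := ENNReal.toReal_nonneg
    have h2 : s k * ρ x ≤ V k x * ρ x := mul_le_mul_of_nonneg_right (hVs k x) (hρ0 x)
    have h3 : -(|s k| * ρ x) ≤ s k * ρ x := by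
      rw [← neg_mul]; exact mul_le_mul_of_nonneg_right (neg_abs_le _) (hρ0 x)
    rw [hfV] at hx
    have h4 : 0 ≤ |s k| * ρ x := mul_nonneg (abs_nonneg _) (hρ0 x)
    have h5 := hw0 x
    have h6 := hD10 x
    have h7 := hD20 x
    simp only [Pi.add_apply]
    rw [Real.norm_eq_abs, abs_le]
    constructor <;> linarith
  have hGVi : ∀ k, Integrable fun x => (G (V k x)).toReal := fun k => by
    refine (hBi.sub (hVρi k)).mono' (hGVm k).aestronglyMeasurable ?_
    filter_upwards [hup k] with x hx
    rw [hfV] at hx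
    rw [Real.norm_eq_abs, abs_of_nonneg ENNReal.toReal_nonneg]
    simp only [Pi.sub_apply]
    linarith
  have hfi : ∀ k, Integrable (f k) := fun k => (hGVi k).add (hVρi k)
  have hmain : ∀ k, (∫⁻ x, ENNReal.ofReal (-f k x)) + ∑ i, ENNReal.ofReal (-betaFun b F (ν i))
      ≤ ENNReal.ofReal K + ∑ i, ENNReal.ofReal (betaFun b F (ν i)) + ∫⁻ x, ENNReal.ofReal (f k x) :=
    fun k => ennreal_rearrange (hfi k) hK0 (neg_energy_le_integral hb hF hFG hψ hg hw hν0 hν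
      (hVm k) (hVadm k).1 (hVadm k).2 (hVI k) (hGVi k) (hVρi k))
  -- At each `x` the lower cutoff is eventually inactive, as `s_k` drops below any point of `I`.
  -- From then on `f_k` exceeds `-H(ρ)` by at most `G(τ_k) ≤ w / (k + 1)`.
  have hlim : ∀ᵐ x, Tendsto (fun k => f k x) atTop (𝓝 (-betaFun b G (ρ x))) := by
    filter_upwards [hρ, ae_all_iff.2 hlow] with x hx hxl
    have hδt : Tendsto (fun k : ℕ => 1 / ((k : ℝ) + 1) * w x + -betaFun b G (ρ x)) atTop
        (𝓝 (0 * w x + -betaFun b G (ρ x))) :=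
      (tendsto_one_div_add_atTop_nhds_zero_nat.mul_const _).add_const _
    rw [zero_mul, zero_add] at hδt
    refine tendsto_of_tendsto_of_tendsto_of_le_of_le' tendsto_const_nhds hδt
      (Eventually.of_forall hxl) ?_
    have hev : ∀ᶠ k in atTop, ρ x = 0 ∨ (ρ x ∈ openTransformDomain b G ∧
        s k ≤ legendrePoint b G (ρ x)) := by
      rcases hx with h | h
      · exact Eventually.of_forall fun k => Or.inl h
      · filter_upwards [hsev _ (legendrePoint_mem h)] with k hk using Or.inr ⟨h, hk⟩
    filter_upwards [hev] with k hk
    have h1 := hG.clampValue_le hb (hτs k x) hk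
    have h2 := hτG' k x
    simp only [hf]
    linarith
  have hDCT : Tendsto (fun k => ∫⁻ x, ENNReal.ofReal (f k x)) atTop
      (𝓝 (∫⁻ x, ENNReal.ofReal (-betaFun b G (ρ x)))) := by
    refine tendsto_lintegral_of_dominated_convergence'
      (fun x => ENNReal.ofReal (w x + (D1 x + D2 x)))
      (fun k => (hfm k).ennreal_ofReal.aemeasurable) (fun k => ?_) hBi.lintegral_lt_top.ne ?_
    · filter_upwards [hup k] with x hx using ENNReal.ofReal_le_ofReal hx
    · filter_upwards [hlim] with x hx using (ENNReal.continuous_ofReal.tendsto _).comp hx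
  refine lintegral_add_le_of_tendsto (f := fun k x => ENNReal.ofReal (-f k x))
    (c := fun _ => ∑ i, ENNReal.ofReal (-betaFun b F (ν i)))
    (fun k => (hfm k).neg.ennreal_ofReal.aemeasurable) ?_ tendsto_const_nhds
    (fun _ => ENNReal.sum_ne_top.2 fun i _ => ENNReal.ofReal_ne_top)
    (ENNReal.sum_ne_top.2 fun i _ => ENNReal.ofReal_ne_top) (hDCT.const_add _) hmain
  filter_upwards [hlim] with x hx
  have := (ENNReal.continuous_ofReal.tendsto _).comp hx.neg
  rwa [neg_neg] at this

end FiniteFamily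

/-! ### Monotonicity and negative part of the transform -/

section Domination

variable {b : EReal} {Φ : ℝ → ℝ≥0∞}

lemma betaFun_le_of_legendrePoint_nonneg {r r' : ℝ} (hr : r ∈ transformDomain b Φ) (h0 : 0 ≤ r')
    (h : r' ≤ r) (hl : ∀ t ∈ Ioo 0 r, 0 ≤ legendrePoint b Φ t) : betaFun b Φ r ≤ betaFun b Φ r' := by
  rw [← sub_nonneg, betaFun_sub hr h0 h, intervalIntegral.integral_of_le h,
    integral_Ioc_eq_integral_Ioo]
  exact setIntegral_nonneg measurableSet_Ioo fun t ht => hl t ⟨h0.trans_lt ht.1, ht.2⟩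

lemma ConvexProfile.zero_mem_interior (hΦ : ConvexProfile b Φ) (hb : 0 < b) {s : ℝ} (hs : s < 0)
    (hsΦ : s ∈ finiteDomain b Φ) : (0 : ℝ) ∈ interior (finiteDomain b Φ) := by
  have hb' : b ≠ ⊥ := bot_lt_iff_ne_bot.1 (bot_le.trans_lt hb)
  have := belowFilter_neBot hb'
  obtain ⟨u, hu, hu0⟩ := ((hΦ.eventually_mem hb').and (eventually_gt_belowFilter hb' hb)).exists
  have hu0' : (0 : ℝ) < u := by exact_mod_cast hu0
  have hsub : Icc s u ⊆ finiteDomain b Φ :=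
    hΦ.convexOn.1.ordConnected.out hsΦ (interior_subset hu)
  exact mem_interior.2 ⟨Ioo s u, Ioo_subset_Icc_self.trans hsub, isOpen_Ioo, hs, hu0'⟩

/-- The negative part of the transform at `r' ≤ r` is controlled by the one at `r`, up to a constant
for large `r`, which can be dropped unless `Φ` is finite at some negative number and `b > 0`. -/
lemma ConvexProfile.exists_neg_part_bound (hΦ : ConvexProfile b Φ) (hb : b ≠ ⊥) :
    ∃ c > 0, ∃ C : ℝ≥0∞, C ≠ ⊤ ∧ (C = 0 ∨ (0 < b ∧ ∃ s < 0, s ∈ finiteDomain b Φ)) ∧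
      ∀ r ∈ transformDomain b Φ, ∀ r', 0 ≤ r' → r' ≤ r →
        ENNReal.ofReal (-betaFun b Φ r')
          ≤ ENNReal.ofReal (-betaFun b Φ r) + (Ioi c).indicator (fun _ => C) r := by
  -- For `b ≤ 0` the transform is nonnegative. For `b > 0` with `Φ` finite at a negative number, it
  -- is bounded below by `-Φ(0)` and decreases on `[0, -Φ'(0)]`. Otherwise every minimizer is
  -- nonnegative and it decreases throughout.
  by_cases hb0 : b ≤ 0
  · refine ⟨1, one_pos, 0, ENNReal.zero_ne_top, Or.inl rfl, fun r hr r' h0 h => ?_⟩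
    have := hΦ.neg_mul_le_betaFun hb (transformDomain_of_le hr h0 h) (x := 0) (by simpa using hb0)
    rw [ENNReal.ofReal_of_nonpos (by linarith)]
    exact zero_le
  by_cases hs : ∃ s < 0, s ∈ finiteDomain b Φ
  · have hb1 := not_le.1 hb0
    obtain ⟨s, hs0, hsΦ⟩ := hs
    have h0I := hΦ.zero_mem_interior hb1 hs0 hsΦ
    refine ⟨-profileDeriv Φ 0, neg_pos.2 (hΦ.deriv_neg hb h0I), Φ 0, (interior_subset h0I).2,
      Or.inr ⟨hb1, s, hs0, hsΦ⟩, fun r hr r' h0 h => ?_⟩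
    by_cases hc : -profileDeriv Φ 0 < r
    · rw [indicator_of_mem (by exact hc)]
      refine le_add_of_nonneg_of_le zero_le ?_
      have := hΦ.le_betaFun hb (transformDomain_of_le hr h0 h) (interior_subset h0I)
      rw [← finiteDomain_ofReal h0I]
      exact ENNReal.ofReal_le_ofReal (by linarith)
    · refine le_add_of_le_of_nonneg (ENNReal.ofReal_le_ofReal (neg_le_neg ?_)) zero_le
      refine betaFun_le_of_legendrePoint_nonneg hr h0 h fun t ht => ?_
      have hto := mem_openTransformDomain hr ht.1 ht.2
      by_contra hn
      have := hΦ.neg_deriv_le h0I hto (not_le.1 hn).le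
      linarith [ht.2]
  · push Not at hs
    refine ⟨1, one_pos, 0, ENNReal.zero_ne_top, Or.inl rfl, fun r hr r' h0 h => ?_⟩
    refine le_add_of_le_of_nonneg (ENNReal.ofReal_le_ofReal (neg_le_neg ?_)) zero_le
    refine betaFun_le_of_legendrePoint_nonneg hr h0 h fun t ht => ?_
    by_contra hn
    exact hs _ (not_le.1 hn)
      (interior_subset (legendrePoint_mem (mem_openTransformDomain hr ht.1 ht.2)))

end Domination

/-! ### Infinite families and the conclusion -/

section Main

variable {d : ℕ}

lemma tendsto_volume_ball_atTop (hd : 0 < d) :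
    Tendsto (fun n : ℕ => volume (Metric.ball (0 : Rd d) n)) atTop (𝓝 ⊤) := by
  have : Nonempty (Fin d) := ⟨⟨0, hd⟩⟩
  have : NoncompactSpace (Rd d) := NormedSpace.noncompactSpace ℝ (Rd d)
  have h := tendsto_measure_iUnion_atTop (μ := (volume : Measure (Rd d)))
    (s := fun n : ℕ => Metric.ball (0 : Rd d) n)
    fun m n hmn => Metric.ball_subset_ball (by exact_mod_cast hmn)
  rwa [Metric.iUnion_ball_nat, measure_univ_of_isAddLeftInvariant] at h

/-- Averaging over large balls makes the bounded part of the density estimate smaller than `c / 2`,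
so `ρ > c` forces the integrable error `D` to be at least `c / 4`; Markov's inequality concludes. -/
lemma volume_density_gt_ne_top (hd : 0 < d) {ψ : ℕ → L2Rd d} (hψ : Orthonormal ℂ ψ) {ν : ℕ → ℝ}
    (hK : kineticEnergy ν ψ ≠ ⊤) {m : ℝ} (hm : ∀ i, ν i ≤ m) {c : ℝ} (hc : 0 < c) :
    volume {x | c < (density ν ψ x).toReal} ≠ ⊤ := by
  set e := ENNReal.ofReal (c / 4) with he
  have he0 : e ≠ 0 := (ENNReal.ofReal_pos.2 (by linarith)).ne'
  have hlim : Tendsto (fun n : ℕ => 2 * (ENNReal.ofReal m * (volume (Metric.ball (0 : Rd d) n))⁻¹))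
      atTop (𝓝 (2 * (ENNReal.ofReal m * 0))) :=
    ENNReal.Tendsto.const_mul (ENNReal.Tendsto.const_mul
      (ENNReal.inv_top ▸ (tendsto_volume_ball_atTop hd).inv) (Or.inr ENNReal.ofReal_ne_top))
      (Or.inr ENNReal.ofNat_ne_top)
  rw [mul_zero, mul_zero] at hlim
  obtain ⟨n, hn, hn0⟩ := ((hlim.eventually_lt_const (pos_iff_ne_zero.2 (mul_ne_zero two_ne_zero he0))).and
    (eventually_gt_atTop 0)).exists
  obtain ⟨D, hDm, hDi, hD⟩ := density_le_add_oscillation (ℓ := (n : ℝ)) (by exact_mod_cast hn0) hψ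
    (ν := fun i => ENNReal.ofReal (ν i)) fun i => ENNReal.ofReal_le_ofReal (hm i)
  refine measure_ne_top_of_subset (s := {x | e ≤ D x}) (fun x hx => ?_)
    (ne_top_of_le_ne_top ?_ (meas_ge_le_lintegral_div hDm.aemeasurable he0 ENNReal.ofReal_ne_top))
  · by_contra hlt
    have hlt' : D x < e := not_le.1 hlt
    have h1 : density ν ψ x ≤ 2 * e + 2 * e := (hD x).trans (add_le_add hn.le (by gcongr))
    have h2 : 2 * e + 2 * e = ENNReal.ofReal c := by
      rw [← mul_add, ← two_mul, he, ← ENNReal.ofReal_ofNat 2, ← ENNReal.ofReal_mul (by norm_num),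
        ← ENNReal.ofReal_mul (by norm_num)]
      congr 1; ring
    have hx' : c < (density ν ψ x).toReal := hx
    exact absurd (ENNReal.toReal_le_of_le_ofReal hc.le (h1.trans h2.le)) (not_le.2 hx')
  · exact ENNReal.div_ne_top (ne_top_of_le_ne_top
      (ENNReal.mul_ne_top (ENNReal.pow_ne_top ENNReal.ofReal_ne_top) hK) hDi) he0

/-- Fenchel's inequality at `t < 0` reads `|t| ν_i ≤ β(ν_i) + F(t)`, and each `β(ν_i)` is at most
the finite sum of positive parts. -/
lemma ConvexProfile.exists_occupation_bound {b : EReal} (hb : b ≠ ⊥) {F : ℝ → ℝ≥0∞}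
    (hF : ConvexProfile b F) {t : ℝ} (ht : t < 0) (htF : t ∈ finiteDomain b F) {ν : ℕ → ℝ}
    (hν : ∀ i, ν i ∈ transformDomain b F)
    (hβ : ∑' i, ENNReal.ofReal (betaFun b F (ν i)) ≠ ⊤) : ∃ m, ∀ i, ν i ≤ m := by
  refine ⟨((∑' i, ENNReal.ofReal (betaFun b F (ν i))).toReal + (F t).toReal) / (-t), fun i => ?_⟩
  rw [le_div_iff₀ (by linarith)]
  have h1 := hF.le_betaFun hb (hν i) htF
  have h2 : betaFun b F (ν i) ≤ (∑' i, ENNReal.ofReal (betaFun b F (ν i))).toReal :=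
    (ENNReal.ofReal_le_iff_le_toReal hβ).1 (ENNReal.le_tsum i)
  linarith

lemma ofReal_sum_mul_norm_sq (s : Finset ℕ) {ν : ℕ → ℝ} (hν : ∀ i, 0 ≤ ν i) (ψ : ℕ → L2Rd d) (x : Rd d) :
    ENNReal.ofReal (∑ i ∈ s, ν i * ‖ψ i x‖ ^ 2) = ∑ i ∈ s, ENNReal.ofReal (ν i) * ‖ψ i x‖ₑ ^ 2 := by
  rw [ENNReal.ofReal_sum_of_nonneg fun i _ => mul_nonneg (hν i) (by positivity)]
  refine Finset.sum_congr rfl fun i _ => ?_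
  rw [ENNReal.ofReal_mul (hν i), ENNReal.ofReal_pow (norm_nonneg _), ofReal_norm]

lemma sum_le_density_toReal (s : Finset ℕ) {ν : ℕ → ℝ} (hν : ∀ i, 0 ≤ ν i) {ψ : ℕ → L2Rd d} {x : Rd d}
    (hx : density ν ψ x ≠ ⊤) : ∑ i ∈ s, ν i * ‖ψ i x‖ ^ 2 ≤ (density ν ψ x).toReal := by
  rw [← ENNReal.ofReal_le_iff_le_toReal hx, ofReal_sum_mul_norm_sq s hν]
  exact ENNReal.sum_le_tsum s

lemma tendsto_sum_range_density {ν : ℕ → ℝ} (hν : ∀ i, 0 ≤ ν i) {ψ : ℕ → L2Rd d} {x : Rd d}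
    (hx : density ν ψ x ≠ ⊤) :
    Tendsto (fun N => ∑ i ∈ Finset.range N, ν i * ‖ψ i x‖ ^ 2) atTop (𝓝 (density ν ψ x).toReal) := by
  have h := (ENNReal.tendsto_toReal hx).comp
    (ENNReal.tendsto_nat_tsum fun i => ENNReal.ofReal (ν i) * ‖ψ i x‖ₑ ^ 2)
  refine h.congr fun N => ?_
  rw [Function.comp_apply, ← ofReal_sum_mul_norm_sq _ hν, ENNReal.toReal_ofReal]
  exact Finset.sum_nonneg fun i _ => mul_nonneg (hν i) (by positivity)

lemma scaled_sum_mem {b : EReal} {G : ℝ → ℝ≥0∞} (s : Finset ℕ) {ν : ℕ → ℝ} (hν : ∀ i, 0 ≤ ν i)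
    {ψ : ℕ → L2Rd d} {x : Rd d} (hx : density ν ψ x ≠ ⊤)
    (hxG : (density ν ψ x).toReal ∈ transformDomain b G) {θ : ℝ} (h0 : 0 < θ) (h1 : θ < 1) :
    θ * ∑ i ∈ s, ν i * ‖ψ i x‖ ^ 2 = 0 ∨
      θ * ∑ i ∈ s, ν i * ‖ψ i x‖ ^ 2 ∈ openTransformDomain b G := by
  have h2 := sum_le_density_toReal s hν hx
  rcases (Finset.sum_nonneg fun i _ => mul_nonneg (hν i) (by positivity) :
    0 ≤ ∑ i ∈ s, ν i * ‖ψ i x‖ ^ 2).eq_or_lt with h | h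
  · left; rw [← h, mul_zero]
  · exact Or.inr (mem_openTransformDomain hxG (mul_pos h0 h)
      ((mul_lt_of_lt_one_left h h1).trans_le h2))

/-- The factor `θ < 1` moves nonzero partial densities strictly below a point of the domain, as the
finite case requires. Indices with `ν_i = 0` contribute nothing and are dropped; positive parts do
not grow, since `β(θ ν) ≤ θ β(ν)`. -/
lemma scaled_family_inequality (hd : 0 < d) {b : EReal} (hb : b ≠ ⊥) {F G : ℝ → ℝ≥0∞}
    (hF : ConvexProfile b F) (hG : ConvexProfile b G)
    (hFG : ∀ V : Rd d → ℝ, AdmissiblePotential b V →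
      ∑' i, F (schrodingerEigenvalue V i).toReal ≤ ∫⁻ x, G (V x))
    {ν : ℕ → ℝ} (hν : ∀ i, ν i ∈ transformDomain b F)
    {ψ : ℕ → L2Rd d} (hψ : Orthonormal ℂ ψ) (hK : kineticEnergy ν ψ ≠ ⊤)
    (hρ : ∀ᵐ x, density ν ψ x ≠ ⊤ ∧ (density ν ψ x).toReal ∈ transformDomain b G)
    (s : Finset ℕ) {θ : ℝ} (h0 : 0 < θ) (h1 : θ < 1) :
    (∫⁻ x, ENNReal.ofReal (betaFun b G (θ * ∑ i ∈ s, ν i * ‖ψ i x‖ ^ 2)))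
        + ∑ i ∈ s, ENNReal.ofReal (-betaFun b F (θ * ν i))
      ≤ kineticEnergy ν ψ + ∑' i, ENNReal.ofReal (betaFun b F (ν i))
        + ∫⁻ x, ENNReal.ofReal (-betaFun b G (θ * ∑ i ∈ s, ν i * ‖ψ i x‖ ^ 2)) := by
  classical
  set p := s.filter fun i => 0 < ν i with hp
  have hpos : ∀ i : p, 0 < ν i := fun i => (Finset.mem_filter.1 i.2).2
  have hzero : ∀ i ∈ s, i ∉ p → ν i = 0 := fun i hi hip =>
    le_antisymm (not_lt.1 fun h => hip (Finset.mem_filter.2 ⟨hi, h⟩)) (hν i).1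
  have hfd : ∀ x, finDensity (fun i : p => θ * ν i) (fun i : p => ψ i) x
      = θ * ∑ i ∈ s, ν i * ‖ψ i x‖ ^ 2 := by
    intro x
    rw [finDensity, Finset.sum_coe_sort p fun i => θ * ν i * ‖ψ i x‖ ^ 2, Finset.mul_sum]
    rw [Finset.sum_subset (Finset.filter_subset _ s)
      fun i hi hip => by rw [hzero i hi hip]; ring]
    exact Finset.sum_congr rfl fun i _ => by ring
  have hfin : ∀ i : p, gradEnergy (ψ i) ≠ ⊤ := fun i h => by
    refine ENNReal.ne_top_of_tsum_ne_top hK i ?_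
    rw [h, ENNReal.mul_top (ENNReal.ofReal_pos.2 (hpos i)).ne']
  have hle : ∀ i, θ * ν i ≤ ν i := fun i => mul_le_of_le_one_left (hν i).1 h1.le
  have key := finite_family_inequality hd hb hF hG hFG
    (hψ.comp (fun i : p => (i : ℕ)) Subtype.val_injective) hfin
    (ν := fun i : p => θ * ν i) (fun i => mul_pos h0 (hpos i))
    (fun i => transformDomain_of_le (hν i) (mul_pos h0 (hpos i)).le (hle i)) (by
      filter_upwards [hρ] with x hx
      have := scaled_sum_mem s (fun i => (hν i).1) hx.1 hx.2 h0 h1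
      rwa [← hfd x] at this)
  have hfd' : ∀ x, finDensity (fun i : p => θ * ν i) (ψ ∘ fun i : p => (i : ℕ)) x
      = θ * ∑ i ∈ s, ν i * ‖ψ i x‖ ^ 2 := hfd
  simp only [hfd', Function.comp_apply] at key
  rw [Finset.sum_coe_sort p fun i => ENNReal.ofReal (-betaFun b F (θ * ν i)),
    Finset.sum_coe_sort p fun i => ENNReal.ofReal (θ * ν i) * gradEnergy (ψ i),
    Finset.sum_coe_sort p fun i => ENNReal.ofReal (betaFun b F (θ * ν i)),
    Finset.sum_subset (f := fun i => ENNReal.ofReal (-betaFun b F (θ * ν i)))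
      (Finset.filter_subset _ s)
      fun i hi hip => by rw [hzero i hi hip, mul_zero, betaFun_zero, neg_zero, ENNReal.ofReal_zero]] at key
  refine key.trans ?_
  gcongr
  · refine (Finset.sum_le_sum fun i _ => ?_).trans
      (ENNReal.sum_le_tsum (f := fun i => ENNReal.ofReal (ν i) * gradEnergy (ψ i)) p)
    gcongr
    exact hle i
  · refine (Finset.sum_le_sum fun i _ => ?_).trans
      (ENNReal.sum_le_tsum (f := fun i => ENNReal.ofReal (betaFun b F (ν i))) p)
    have h2 := hF.betaFun_mul_le hb (hν i) h0 h1
    rcases le_total 0 (betaFun b F (ν i)) with h | h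
    · exact ENNReal.ofReal_le_ofReal (h2.trans (mul_le_of_le_one_left h h1.le))
    · rw [ENNReal.ofReal_of_nonpos (h2.trans (mul_nonpos_of_nonneg_of_nonpos h0.le h))]
      exact zero_le

lemma measurable_density (ν : ℕ → ℝ) (ψ : ℕ → L2Rd d) : Measurable (density ν ψ) :=
  Measurable.tsum fun i =>
    ((Lp.stronglyMeasurable (ψ i)).measurable.enorm.pow_const 2).const_mul _

lemma tendsto_one_sub_half_div :
    Tendsto (fun n : ℕ => 1 - 1 / 2 * (1 / ((n : ℝ) + 1))) atTop (𝓝 1) := by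
  have := (tendsto_one_div_add_atTop_nhds_zero_nat (𝕜 := ℝ)).const_mul (1 / 2) |>.const_sub 1
  rwa [mul_zero, sub_zero] at this

lemma tendsto_betaFun {b : EReal} {Φ : ℝ → ℝ≥0∞} {r : ℝ} (hr : r ∈ transformDomain b Φ) {u : ℕ → ℝ}
    (hu0 : ∀ n, 0 ≤ u n) (hur : ∀ n, u n ≤ r) (hu : Tendsto u atTop (𝓝 r)) :
    Tendsto (fun n => betaFun b Φ (u n)) atTop (𝓝 (betaFun b Φ r)) :=
  (continuousOn_betaFun hr r ⟨hr.1, le_rfl⟩).tendsto.comp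
    (tendsto_nhdsWithin_iff.2 ⟨hu, Eventually.of_forall fun n => ⟨hu0 n, hur n⟩⟩)

/-- Dominated convergence with the majorant `H(ρ)₋ + C 1_{ρ > c}`. If `C ≠ 0`, finiteness of `G` at
a negative number passes to `F`, which bounds the `ν_i` and hence the measure of `{ρ > c}`. -/
lemma tendsto_lintegral_neg_betaFun (hd : 0 < d) {b : EReal} (hb : b ≠ ⊥) {F G : ℝ → ℝ≥0∞}
    (hF : ConvexProfile b F) (hG : ConvexProfile b G)
    (hFG : ∀ V : Rd d → ℝ, AdmissiblePotential b V →
      ∑' i, F (schrodingerEigenvalue V i).toReal ≤ ∫⁻ x, G (V x))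
    {ν : ℕ → ℝ} (hν : ∀ i, ν i ∈ transformDomain b F)
    {ψ : ℕ → L2Rd d} (hψ : Orthonormal ℂ ψ) (hK : kineticEnergy ν ψ ≠ ⊤)
    (hβ : ∑' i, ENNReal.ofReal (betaFun b F (ν i)) ≠ ⊤)
    (hρ : ∀ᵐ x, density ν ψ x ≠ ⊤ ∧ (density ν ψ x).toReal ∈ transformDomain b G)
    (hH : ∫⁻ x, ENNReal.ofReal (-betaFun b G (density ν ψ x).toReal) ≠ ⊤)
    {u : ℕ → Rd d → ℝ} (hum : ∀ n, AEMeasurable fun x => betaFun b G (u n x))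
    (hu : ∀ᵐ x, ∀ n, 0 ≤ u n x ∧ u n x ≤ (density ν ψ x).toReal)
    (hlim : ∀ᵐ x, Tendsto (fun n => betaFun b G (u n x)) atTop
      (𝓝 (betaFun b G (density ν ψ x).toReal))) :
    Tendsto (fun n => ∫⁻ x, ENNReal.ofReal (-betaFun b G (u n x))) atTop
      (𝓝 (∫⁻ x, ENNReal.ofReal (-betaFun b G (density ν ψ x).toReal))) := by
  obtain ⟨c, hc, C, hC, hC', hbd⟩ := hG.exists_neg_part_bound hb
  have hm : Measurable fun x => (Ioi c).indicator (fun _ => C) (density ν ψ x).toReal :=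
    (measurable_const.indicator measurableSet_Ioi).comp (measurable_density ν ψ).ennreal_toReal
  refine tendsto_lintegral_of_dominated_convergence' (fun x =>
    ENNReal.ofReal (-betaFun b G (density ν ψ x).toReal)
      + (Ioi c).indicator (fun _ => C) (density ν ψ x).toReal)
    (fun n => (hum n).neg.ennreal_ofReal) (fun n => ?_) ?_ ?_
  · filter_upwards [hρ, hu] with x hx hux using hbd _ hx.2 _ (hux n).1 (hux n).2
  · rw [lintegral_add_right _ hm]
    refine ENNReal.add_ne_top.2 ⟨hH, ?_⟩
    have e : (fun x => (Ioi c).indicator (fun _ => C) (density ν ψ x).toReal)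
        = {x | c < (density ν ψ x).toReal}.indicator fun _ => C := rfl
    have hms : MeasurableSet {x | c < (density ν ψ x).toReal} :=
      measurableSet_lt measurable_const (measurable_density ν ψ).ennreal_toReal
    rw [e, lintegral_indicator_const hms]
    rcases hC' with rfl | ⟨hb0, s, hs, hsG⟩
    · rw [zero_mul]; exact ENNReal.zero_ne_top
    · obtain ⟨t, ht, htF⟩ := exists_neg_mem_finiteDomain hd hb0 hG hFG hs hsG
      obtain ⟨m, hm⟩ := hF.exists_occupation_bound hb ht htF hν hβ
      exact ENNReal.mul_ne_top hC (volume_density_gt_ne_top hd hψ hK hm hc)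
  · filter_upwards [hlim] with x hx using (ENNReal.continuous_ofReal.tendsto _).comp hx.neg

/-- The dual inequality in `[0, ∞]`. -/
theorem dual_inequality (hd : 0 < d) {b : EReal} (hb : b ≠ ⊥) {F G : ℝ → ℝ≥0∞}
    (hF : ConvexProfile b F) (hG : ConvexProfile b G)
    (hFG : ∀ V : Rd d → ℝ, AdmissiblePotential b V →
      ∑' i, F (schrodingerEigenvalue V i).toReal ≤ ∫⁻ x, G (V x))
    {ν : ℕ → ℝ} (hν : ∀ i, ν i ∈ transformDomain b F)
    {ψ : ℕ → L2Rd d} (hψ : Orthonormal ℂ ψ)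
    (hρ : ∀ᵐ x, density ν ψ x ≠ ⊤ ∧ (density ν ψ x).toReal ∈ transformDomain b G) :
    (∫⁻ x, ENNReal.ofReal (betaFun b G (density ν ψ x).toReal))
        + ∑' i, ENNReal.ofReal (-betaFun b F (ν i))
      ≤ kineticEnergy ν ψ + ∑' i, ENNReal.ofReal (betaFun b F (ν i))
        + ∫⁻ x, ENNReal.ofReal (-betaFun b G (density ν ψ x).toReal) := by
  by_cases hK : kineticEnergy ν ψ = ⊤
  · simp [hK]
  by_cases hβ : ∑' i, ENNReal.ofReal (betaFun b F (ν i)) = ⊤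
  · simp [hβ]
  by_cases hH : ∫⁻ x, ENNReal.ofReal (-betaFun b G (density ν ψ x).toReal) = ⊤
  · simp [hH]
  have hν0 : ∀ i, 0 ≤ ν i := fun i => (hν i).1
  set θ : ℕ → ℝ := fun n => 1 - 1 / 2 * (1 / ((n : ℝ) + 1)) with hθ
  have hθt : Tendsto θ atTop (𝓝 1) := tendsto_one_sub_half_div
  have hθ0 : ∀ n, 0 < θ n := fun n => by
    have : 1 / ((n : ℝ) + 1) ≤ 1 := by
      rw [div_le_one (by positivity)]; linarith [(Nat.cast_nonneg n : (0 : ℝ) ≤ n)]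
    simp only [hθ]; linarith
  have hθ1 : ∀ n, θ n < 1 := fun n => by
    have : 0 < 1 / ((n : ℝ) + 1) := by positivity
    simp only [hθ]; linarith
  have hσ0 : ∀ n x, 0 ≤ ∑ i ∈ Finset.range n, ν i * ‖ψ i x‖ ^ 2 := fun n x =>
    Finset.sum_nonneg fun i _ => mul_nonneg (hν0 i) (by positivity)
  set u : ℕ → Rd d → ℝ := fun n x => θ n * ∑ i ∈ Finset.range n, ν i * ‖ψ i x‖ ^ 2 with hu
  have hum : ∀ n, AEMeasurable fun x => betaFun b G (u n x) := fun n => by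
    have hm : Measurable (u n) := (Finset.measurable_fun_sum _ fun i _ =>
      ((Lp.stronglyMeasurable (ψ i)).measurable.norm.pow_const 2).const_mul _).const_mul _
    refine ⟨(openTransformDomain b G).indicator (betaFun b G) ∘ u n,
      measurable_indicator_betaFun.comp hm, ?_⟩
    filter_upwards [hρ] with x hx
    exact (indicator_betaFun_eq (scaled_sum_mem _ hν0 hx.1 hx.2 (hθ0 n) (hθ1 n))).symm
  have hub : ∀ᵐ x, ∀ n, 0 ≤ u n x ∧ u n x ≤ (density ν ψ x).toReal := by
    filter_upwards [hρ] with x hx n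
    exact ⟨mul_nonneg (hθ0 n).le (hσ0 n x), (mul_le_of_le_one_left (hσ0 n x) (hθ1 n).le).trans
      (sum_le_density_toReal _ hν0 hx.1)⟩
  have hlim : ∀ᵐ x, Tendsto (fun n => betaFun b G (u n x)) atTop
      (𝓝 (betaFun b G (density ν ψ x).toReal)) := by
    filter_upwards [hρ, hub] with x hx hux
    refine tendsto_betaFun hx.2 (fun n => (hux n).1) (fun n => (hux n).2) ?_
    have := hθt.mul (tendsto_sum_range_density hν0 hx.1)
    rwa [one_mul] at this
  have hT := tendsto_lintegral_neg_betaFun hd hb hF hG hFG hν hψ hK hβ hρ hH hum hub hlim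
  -- Only the first `M` negative parts of `β` are kept while `n → ∞`; the shift to `n + M` ensures
  -- that the partial families contain these indices. The supremum over `M` comes last.
  refine le_of_tendsto' ((ENNReal.tendsto_nat_tsum
    fun i => ENNReal.ofReal (-betaFun b F (ν i))).const_add _) fun M => ?_
  refine lintegral_add_le_of_tendsto (f := fun n x => ENNReal.ofReal (betaFun b G (u (n + M) x)))
    (c := fun n => ∑ i ∈ Finset.range M, ENNReal.ofReal (-betaFun b F (θ (n + M) * ν i)))
    (fun n => (hum _).ennreal_ofReal) ?_ (tendsto_finsetSum _ fun i _ => ?_)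
    (fun n => ENNReal.sum_ne_top.2 fun i _ => ENNReal.ofReal_ne_top)
    (ENNReal.sum_ne_top.2 fun i _ => ENNReal.ofReal_ne_top)
    ((hT.comp (tendsto_add_atTop_nat M)).const_add _) fun n => ?_
  · filter_upwards [hlim] with x hx
    exact (ENNReal.continuous_ofReal.tendsto _).comp (hx.comp (tendsto_add_atTop_nat M))
  · have h1 : Tendsto (fun n => θ n * ν i) atTop (𝓝 (ν i)) := by
      simpa using hθt.mul_const (ν i)
    have h2 := tendsto_betaFun (hν i) (fun n => mul_nonneg (hθ0 n).le (hν0 i))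
      (fun n => mul_le_of_le_one_left (hν0 i) (hθ1 n).le) h1
    exact (ENNReal.continuous_ofReal.tendsto _).comp (h2.neg.comp (tendsto_add_atTop_nat M))
  · refine le_trans (add_le_add le_rfl ?_) (scaled_family_inequality hd hb hF hG hFG hν hψ hK hρ
      (Finset.range (n + M)) (hθ0 (n + M)) (hθ1 (n + M)))
    exact Finset.sum_le_sum_of_subset (Finset.range_subset_range.2 (Nat.le_add_left M n))

lemma summable_tsum_eq_sub_ofReal {β : ℕ → ℝ} (h : Summable β) :
    ∑' i, ENNReal.ofReal (β i) ≠ ⊤ ∧ ∑' i, ENNReal.ofReal (-β i) ≠ ⊤ ∧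
      ∑' i, β i = (∑' i, ENNReal.ofReal (β i)).toReal - (∑' i, ENNReal.ofReal (-β i)).toReal := by
  have h1 : Summable fun i => max (β i) 0 :=
    h.abs.of_nonneg_of_le (fun i => le_max_right _ _) fun i => max_le (le_abs_self _) (abs_nonneg _)
  have h2 : Summable fun i => max (-β i) 0 :=
    h.abs.of_nonneg_of_le (fun i => le_max_right _ _) fun i => max_le (neg_le_abs _) (abs_nonneg _)
  have e : ∀ x : ℝ, ENNReal.ofReal x = ENNReal.ofReal (max x 0) := fun x => by
    rcases le_total x 0 with h | h
    · rw [max_eq_right h, ENNReal.ofReal_zero, ENNReal.ofReal_of_nonpos h]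
    · rw [max_eq_left h]
  have e1 : ∑' i, ENNReal.ofReal (β i) = ENNReal.ofReal (∑' i, max (β i) 0) := by
    rw [ENNReal.ofReal_tsum_of_nonneg (fun i => le_max_right _ _) h1]
    exact tsum_congr fun i => e _
  have e2 : ∑' i, ENNReal.ofReal (-β i) = ENNReal.ofReal (∑' i, max (-β i) 0) := by
    rw [ENNReal.ofReal_tsum_of_nonneg (fun i => le_max_right _ _) h2]
    exact tsum_congr fun i => e _
  refine ⟨e1 ▸ ENNReal.ofReal_ne_top, e2 ▸ ENNReal.ofReal_ne_top, ?_⟩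
  rw [e1, e2, ENNReal.toReal_ofReal (tsum_nonneg fun i => le_max_right _ _),
    ENNReal.toReal_ofReal (tsum_nonneg fun i => le_max_right _ _), ← h1.tsum_sub h2]
  refine tsum_congr fun i => ?_
  rcases le_total (β i) 0 with h | h
  · rw [max_eq_right h, max_eq_left (by linarith)]; ring
  · rw [max_eq_left h, max_eq_right (by linarith)]; ring

end Main

/-- If `∑ F(λ_i(V)) ≤ ∫ G(V)` for all admissible potentials, then
`K[ν,ψ] + ∑ β(ν_i) ≥ ∫ H(ρ)` for all occupation numbers and orthonormal systems for which the terms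
`β(ν_i)` and `H(ρ(x))` are defined. The first part is this inequality with the positive and negative
parts of `β(ν_i)` and `H(ρ)` put on the sides where they are added, so that it is meaningful in
`[0,∞]` without any convergence assumption; the second is the inequality between real numbers. -/
theorem mainTheorem5 (d : ℕ) (hd : 0 < d) (b : EReal) (hb : b ≠ ⊥) (F G : ℝ → ℝ≥0∞)
    (hF : ConvexProfile b F) (hG : ConvexProfile b G)
    (hFG : ∀ V : Rd d → ℝ, AdmissiblePotential b V →
      ∑' i, F (schrodingerEigenvalue V i).toReal ≤ ∫⁻ x, G (V x))
    (ν : ℕ → ℝ) (hν : ∀ i, ν i ∈ transformDomain b F)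
    (ψ : ℕ → L2Rd d) (hψ : Orthonormal ℂ ψ)
    (hρ : ∀ᵐ x, density ν ψ x ≠ ⊤ ∧ (density ν ψ x).toReal ∈ transformDomain b G) :
    ((∫⁻ x, ENNReal.ofReal (HFun b G (density ν ψ x).toReal))
        + ∑' i, ENNReal.ofReal (- betaFun b F (ν i))
      ≤ kineticEnergy ν ψ + ∑' i, ENNReal.ofReal (betaFun b F (ν i))
        + ∫⁻ x, ENNReal.ofReal (- HFun b G (density ν ψ x).toReal)) ∧
    (kineticEnergy ν ψ ≠ ⊤ → Summable (fun i => betaFun b F (ν i)) →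
      Integrable (fun x => HFun b G (density ν ψ x).toReal) volume →
      ∫ x, HFun b G (density ν ψ x).toReal
        ≤ (kineticEnergy ν ψ).toReal + ∑' i, betaFun b F (ν i)) := by
  rw [betaFun_eq_HFun]
  have h := dual_inequality hd hb hF hG hFG hν hψ hρ
  refine ⟨h, fun hK hβ hH => ?_⟩
  obtain ⟨h1, h2, h3⟩ := summable_tsum_eq_sub_ofReal hβ
  have h4 : ∫⁻ x, ENNReal.ofReal (betaFun b G (density ν ψ x).toReal) ≠ ⊤ :=
    hH.lintegral_lt_top.ne
  have h5 : ∫⁻ x, ENNReal.ofReal (-betaFun b G (density ν ψ x).toReal) ≠ ⊤ :=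
    hH.neg.lintegral_lt_top.ne
  have h6 := ENNReal.add_ne_top.2 ⟨hK, h1⟩
  rw [← ENNReal.toReal_le_toReal (ENNReal.add_ne_top.2 ⟨h4, h2⟩) (ENNReal.add_ne_top.2 ⟨h6, h5⟩),
    ENNReal.toReal_add h4 h2, ENNReal.toReal_add h6 h5, ENNReal.toReal_add hK h1] at h
  rw [integral_eq_lintegral_pos_part_sub_lintegral_neg_part hH, h3]
  linarith
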